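/- **Conventions.** A *category with discarding* is a monoidal category $\mathcal D$ with a chosen morphism $\mathrm{disc}_A\colon A\to I$ for every object, $\mathrm{disc}_I=\mathrm{id}_I$; $f\colon A\to B$ is *causal* if $\mathrm{disc}_B\circ f=\mathrm{disc}_A$. A functor $F$ between such categories is *causal* if $\mathrm{disc}_{F(I)}$ is invertible and $\mathrm{disc}_{F(A)}=\mathrm{disc}_{F(I)}\circ F(\mathrm{disc}_A)$ for all $A$; it is a *causal monoidal equivalence* if it is causal, admits a strong monoidal structure with causal structure isomorphisms, and is an equivalence via a causal functor in the opposite direction with causal natural isomorphisms as unit and counit. For a semi-additive (enriched in commutative monoids, with bilinear $\otimes$) monoidal category $\mathcal D$ with discarding satisfying $\mathrm{disc}_{A\otimes B}=\lambda_I\circ(\mathrm{disc}_A\otimes\mathrm{disc}_B)$: $\mathcal D^\oplus$ is the free biproduct completion (finite families of objects and matrices of morphisms, discarding entrywise). $\mathrm{Split}^{c}(\mathcal D)$ has as objects the pairs $(A,p)$ with $p\colon A\to A$ a causal idempotent, as morphisms $(A,p)\to(B,q)$ the $f\colon A\to B$ with $q\circ f\circ p=f$, and discarding $\mathrm{disc}_A\circ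 p$. If $\mathcal D$ has a dagger, $\mathrm{Split}^{c}_\dagger(\mathcal D)$ is the full subcategory on the $(A,p)$ with $p=p^\dagger$. $\mathcal D$ has the *finite decomposition property* if every causal idempotent $p\colon A\to A$ is a finite sum $p=\sum_i m_i\circ e_i$ with $e_i\colon A\to B_i$, $m_i\colon B_i\to A$, $e_i\circ m_i=\mathrm{id}$, every $m_i$ causal, and $(m_j\circ e_j)\circ (m_i\circ e_i)=0$ for $i\neq j$. For a dagger compact category $\mathcal C$: $\mathrm{CPM}(\mathcal C)$ is the category of completely positive maps $A^*\otimes A\to B^*\otimes B$, with the caps $A^*\otimes A\to I$ as discarding. $\mathrm{CP}^*(\mathcal C)$ has as objects the symmetric special dagger Frobenius structures $(A,\delta,\varepsilon)$ in $\mathcal C$ (comonoids satisfying the dagger Frobenius law, $\delta^\dagger\circ\delta=\mathrm{id}_A$ and $\varepsilon\circ\delta^\dagger\circ\beta_{A,A}=\varepsilon\circ\delta^\dagger$, with $\beta$ the symmetry), as morphisms $(A,\delta_A)\to(B,\delta_B)$ the $f\colon A\to B$ for which $(\mathrm{id}_A\otimes\delta_B^\dagger)\circ(\mathrm{id}_A\otimes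 f\otimes\mathrm{id}_B)\circ(\delta_A\otimes\mathrm{id}_B)$ has the form $h^\dagger\circ h$, and the counits as discarding. $\mathcal C$ is *positive-dimensional* if for every object $A$ there is a scalar $z\colon I\to I$ with $(z^\dagger\circ z\circ\dim A)\bullet\mathrm{id}_A=\mathrm{id}_A$, where $\dim A=\eta_A^\dagger\circ\eta_A$ for a dagger dual of $A$ with unit $\eta_A$. **Theorem.** (1) Let $\mathcal C$ be a positive-dimensional dagger compact category with dagger biproducts, such that $\mathrm{CPM}(\mathcal C)$ has the finite decomposition property. Then each of the inclusions $$\mathrm{CPM}(\mathcal C)^\oplus\longrightarrow\mathrm{CP}^*(\mathcal C)\longrightarrow\mathrm{Split}^{c}_\dagger(\mathrm{CPM}(\mathcal C))\longrightarrow\mathrm{Split}^{c}(\mathrm{CPM}(\mathcal C))$$ is a causal monoidal equivalence. Here the second functor sends $(A,\delta,\varepsilon)$ to $(A,\delta\circ\delta^\dagger)$, where $A$ is its own dual through $\delta$ and $\varepsilon$, and $f\colon (A,\delta_A)\to(B,\delta_B)$ to $\delta_B\circ f\circ\delta_A^\dagger$; the third is the inclusion of the full subcategory; and the first is a functor whose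 composite with the other two, restricted to $\mathrm{CPM}(\mathcal C)$, is causally isomorphic to $A\mapsto(A,\mathrm{id}_A)$. (2) Let $\mathrm{Quant}$ be the category of finite-dimensional Hilbert spaces whose morphisms $H\to K$ are the completely positive maps $B(H)\to B(K)$, and $\mathrm{CStar}$ the category of finite-dimensional C*-algebras and completely positive maps, both with their tensor products and with the trace as discarding (in $\mathrm{CStar}$: the sum of the matrix traces of the blocks), and the dagger of $\mathrm{Quant}$ the Hilbert–Schmidt adjoint. There are causal monoidal equivalences $$\mathrm{Quant}^\oplus\simeq\mathrm{CStar}\simeq\mathrm{Split}^{c}_\dagger(\mathrm{Quant})\simeq\mathrm{Split}^{c}(\mathrm{Quant}),$$ the first of which restricts on $\mathrm{Quant}$ to $H\mapsto B(H)$, up to causal isomorphism, the last of which is the inclusion, and whose composite restricts on $\mathrm{Quant}$ to $H\mapsto(H,\mathrm{id}_H)$, up to causal isomorphism. -/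

import Mathlib

open CategoryTheory MonoidalCategory

namespace TwoRoads

universe v u v' u'

section Discarding

/-- A monoidal category with a chosen discarding effect on every object. -/
class Discarding (C : Type u) [Category.{v} C] [MonoidalCategory C] where
  discard : ∀ A : C, A ⟶ 𝟙_ C
  discard_unit : discard (𝟙_ C) = 𝟙 (𝟙_ C)

open Discarding (discard discard_unit)

/-- A morphism is causal when it preserves discarding. -/
def Causal {C : Type u} [Category.{v} C] [MonoidalCategory C] [Discarding C] {A B : C}
    (f : A ⟶ B) : Prop :=
  f ≫ discard B = discard A

/-- Discarding is compatible with the tensor product.  (The coherence isomorphisms are then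
causal, see `causal_leftUnitor`, `causal_rightUnitor`, `causal_associator`.) -/
class MonoidalDiscarding (C : Type u) [Category.{v} C] [MonoidalCategory C] [Discarding C] :
    Prop where
  discard_tensor : ∀ A B : C,
    discard (A ⊗ B) = (discard A ⊗ₘ discard B) ≫ (λ_ (𝟙_ C)).hom

section

variable {C : Type u} [Category.{v} C] [MonoidalCategory C] [Discarding C]

theorem causal_id (A : C) : Causal (𝟙 A) := Category.id_comp _

theorem Causal.comp {A B D : C} {f : A ⟶ B} {g : B ⟶ D} (hf : Causal f) (hg : Causal g) :
    Causal (f ≫ g) := by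
  unfold Causal at *
  rw [Category.assoc, hg, hf]

variable [MonoidalDiscarding C]

theorem Causal.tensor {A B A' B' : C} {f : A ⟶ B} {g : A' ⟶ B'} (hf : Causal f)
    (hg : Causal g) : Causal (f ⊗ₘ g) := by
  unfold Causal at *
  rw [MonoidalDiscarding.discard_tensor, MonoidalDiscarding.discard_tensor,
    tensorHom_comp_tensorHom_assoc, hf, hg]

theorem causal_leftUnitor (A : C) : Causal (λ_ A).hom := by
  unfold Causal
  rw [MonoidalDiscarding.discard_tensor, discard_unit, id_tensorHom, leftUnitor_naturality]

theorem causal_rightUnitor (A : C) : Causal (ρ_ A).hom := by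
  unfold Causal
  rw [MonoidalDiscarding.discard_tensor, discard_unit, tensorHom_id, unitors_equal,
    rightUnitor_naturality]

theorem causal_associator (A B D : C) : Causal (α_ A B D).hom := by
  unfold Causal
  rw [MonoidalDiscarding.discard_tensor, MonoidalDiscarding.discard_tensor,
    MonoidalDiscarding.discard_tensor, MonoidalDiscarding.discard_tensor,
    ← Category.comp_id (discard A), ← Category.comp_id (discard D),
    ← tensorHom_comp_tensorHom, ← tensorHom_comp_tensorHom, Category.comp_id, Category.comp_id,
    Category.assoc, Category.assoc, ← associator_naturality_assoc]
  monoidal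

end

variable {C : Type u} [Category.{v} C] [MonoidalCategory C] [Discarding C]
  {D : Type u'} [Category.{v'} D] [MonoidalCategory D] [Discarding D]

/-- A functor is causal when it preserves the discarding effects, up to the canonical
isomorphism `F I ≅ I`. -/
structure IsCausalFunctor (F : C ⥤ D) : Prop where
  isIso_discard : IsIso (discard (F.obj (𝟙_ C)))
  map_discard : ∀ A : C,
    discard (F.obj A) = F.map (discard A) ≫ discard (F.obj (𝟙_ C))

/-- `F` is a causal functor, it has a strong monoidal structure all of whose structure
isomorphisms are causal, and it is an equivalence by means of a causal functor and causal natural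
isomorphisms. -/
structure IsCausalMonoidalEquivalence (F : C ⥤ D) : Prop where
  causal : IsCausalFunctor F
  monoidal : ∃ _ : F.Monoidal,
    Causal (Functor.LaxMonoidal.ε F) ∧ ∀ A B : C, Causal (Functor.LaxMonoidal.μ F A B)
  equivalence : ∃ (G : D ⥤ C) (unit : 𝟭 C ≅ F ⋙ G) (counit : G ⋙ F ≅ 𝟭 D),
    IsCausalFunctor G ∧ (∀ A : C, Causal (unit.hom.app A)) ∧
      ∀ B : D, Causal (counit.hom.app B)

/-- Two functors are causally isomorphic. -/
def CausallyIsomorphic {B : Type*} [Category* B] (F G : B ⥤ D) : Prop :=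
  ∃ φ : F ≅ G, ∀ A : B, Causal (φ.hom.app A)

end Discarding

section SemiAdditive

/-- Enrichment in commutative monoids. -/
class SemiAdditive (C : Type u) [Category.{v} C] where
  homAddCommMonoid : ∀ A B : C, AddCommMonoid (A ⟶ B)
  add_comp : ∀ {A B D : C} (f g : A ⟶ B) (h : B ⟶ D), (f + g) ≫ h = f ≫ h + g ≫ h
  comp_add : ∀ {A B D : C} (f : A ⟶ B) (g h : B ⟶ D), f ≫ (g + h) = f ≫ g + f ≫ h
  zero_comp : ∀ {A B D : C} (h : B ⟶ D), (0 : A ⟶ B) ≫ h = 0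
  comp_zero : ∀ {A B D : C} (h : A ⟶ B), h ≫ (0 : B ⟶ D) = 0

attribute [reducible, instance] SemiAdditive.homAddCommMonoid

/-- A semi-additive monoidal category: the tensor product is bilinear on morphisms. -/
class SemiAdditiveMonoidal (C : Type u) [Category.{v} C] [MonoidalCategory C]
    [SemiAdditive C] : Prop where
  tensor_add : ∀ {A B A' B' : C} (f : A ⟶ B) (g h : A' ⟶ B'),
    f ⊗ₘ (g + h) = f ⊗ₘ g + f ⊗ₘ h
  add_tensor : ∀ {A B A' B' : C} (f g : A ⟶ B) (h : A' ⟶ B'),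
    (f + g) ⊗ₘ h = f ⊗ₘ h + g ⊗ₘ h
  tensor_zero : ∀ {A B A' B' : C} (f : A ⟶ B), f ⊗ₘ (0 : A' ⟶ B') = 0
  zero_tensor : ∀ {A B A' B' : C} (f : A' ⟶ B'), (0 : A ⟶ B) ⊗ₘ f = 0

variable {C : Type u} [Category.{v} C] [SemiAdditive C]

theorem sum_comp {ι : Type*} (s : Finset ι) {A B D : C} (f : ι → (A ⟶ B)) (h : B ⟶ D) :
    (∑ i ∈ s, f i) ≫ h = ∑ i ∈ s, f i ≫ h :=
  map_sum (⟨⟨fun f => f ≫ h, SemiAdditive.zero_comp h⟩,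
    fun f g => SemiAdditive.add_comp f g h⟩ : (A ⟶ B) →+ (A ⟶ D)) f s

theorem comp_sum {ι : Type*} (s : Finset ι) {A B D : C} (h : A ⟶ B) (f : ι → (B ⟶ D)) :
    h ≫ (∑ i ∈ s, f i) = ∑ i ∈ s, h ≫ f i :=
  map_sum (⟨⟨fun f => h ≫ f, SemiAdditive.comp_zero h⟩,
    fun f g => SemiAdditive.comp_add h f g⟩ : (B ⟶ D) →+ (A ⟶ D)) f s

variable [MonoidalCategory C] [SemiAdditiveMonoidal C]

theorem sum_tensor {ι : Type*} (s : Finset ι) {A B A' B' : C} (f : ι → (A ⟶ B))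
    (h : A' ⟶ B') : (∑ i ∈ s, f i) ⊗ₘ h = ∑ i ∈ s, f i ⊗ₘ h :=
  map_sum (⟨⟨fun f => f ⊗ₘ h, SemiAdditiveMonoidal.zero_tensor h⟩,
    fun f g => SemiAdditiveMonoidal.add_tensor f g h⟩ : (A ⟶ B) →+ (A ⊗ A' ⟶ B ⊗ B')) f s

theorem tensor_sum {ι : Type*} (s : Finset ι) {A B A' B' : C} (h : A' ⟶ B')
    (f : ι → (A ⟶ B)) : h ⊗ₘ (∑ i ∈ s, f i) = ∑ i ∈ s, h ⊗ₘ f i :=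
  map_sum (⟨⟨fun f => h ⊗ₘ f, SemiAdditiveMonoidal.tensor_zero h⟩,
    fun f g => SemiAdditiveMonoidal.tensor_add h f g⟩ : (A ⟶ B) →+ (A' ⊗ A ⟶ B' ⊗ B)) f s

end SemiAdditive

section BiprodCompletion

open Discarding (discard discard_unit)

/-- Objects of the free biproduct completion: finite families of objects. -/
structure BiprodCompletion (E : Type u) where
  ι : Type
  [fintype : Fintype ι]
  X : ι → E

namespace BiprodCompletion

attribute [instance] BiprodCompletion.fintype

variable {E : Type u} [Category.{v} E] [SemiAdditive E]

open scoped Classical in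
/-- Morphisms are matrices of morphisms, composed by matrix multiplication. -/
noncomputable instance : Category.{v} (BiprodCompletion E) where
  Hom M N := ∀ (i : M.ι) (j : N.ι), M.X i ⟶ N.X j
  id M i j := if h : i = j then eqToHom (congrArg M.X h) else 0
  comp f g i k := ∑ j, f i j ≫ g j k
  id_comp f := by
    funext i k
    rw [Finset.sum_eq_single i]
    · simp
    · intro j _ hj
      simp [Ne.symm hj, SemiAdditive.zero_comp]
    · simp
  comp_id f := by
    funext i k
    rw [Finset.sum_eq_single k]
    · simp
    · intro j _ hj
      simp [hj, SemiAdditive.comp_zero]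
    · simp
  assoc f g h := by
    funext i l
    simp only [sum_comp, comp_sum, Category.assoc]
    rw [Finset.sum_comm]

variable (E) in
/-- The embedding of a category in its biproduct completion. -/
noncomputable def incl : E ⥤ BiprodCompletion E where
  obj A := ⟨Unit, fun _ => A⟩
  map f := fun _ _ => f
  map_id A := by
    funext i j
    cases i; cases j
    simp [CategoryStruct.id]
  map_comp f g := by
    funext i j
    exact (Fintype.sum_unique (ι := Unit) fun _ => f ≫ g).symm

open scoped Classical in
/-- The matrix with entries `φ i` at the places `(i, f i)` and zeroes elsewhere. -/
noncomputable def mono {M N : BiprodCompletion E} (f : M.ι → N.ι)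
    (φ : ∀ i, M.X i ⟶ N.X (f i)) : M ⟶ N :=
  fun i j => if h : f i = j then φ i ≫ eqToHom (congrArg N.X h) else 0

theorem comp_apply {M N K : BiprodCompletion E} (f : M ⟶ N) (g : N ⟶ K) (i : M.ι) (k : K.ι) :
    (f ≫ g) i k = ∑ j, f i j ≫ g j k := rfl

theorem mono_apply_of_ne {M N : BiprodCompletion E} (f : M.ι → N.ι)
    (φ : ∀ i, M.X i ⟶ N.X (f i)) {i : M.ι} {j : N.ι} (h : f i ≠ j) : mono f φ i j = 0 :=
  dif_neg h

theorem mono_comp_apply {M N K : BiprodCompletion E} (f : M.ι → N.ι)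
    (φ : ∀ i, M.X i ⟶ N.X (f i)) (g : N ⟶ K) (i : M.ι) (k : K.ι) :
    (mono f φ ≫ g) i k = φ i ≫ g (f i) k := by
  rw [comp_apply, Finset.sum_eq_single (f i)]
  · simp [mono]
  · intro j _ hj
    simp [mono, Ne.symm hj, SemiAdditive.zero_comp]
  · simp

theorem mono_comp_mono {M N K : BiprodCompletion E} (f : M.ι → N.ι)
    (φ : ∀ i, M.X i ⟶ N.X (f i)) (g : N.ι → K.ι) (ψ : ∀ j, N.X j ⟶ K.X (g j)) :
    mono f φ ≫ mono g ψ = mono (g ∘ f) fun i => φ i ≫ ψ (f i) := by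
  funext i k
  rw [mono_comp_apply]
  by_cases h : g (f i) = k
  · simp [mono, h]
  · simp [mono, h, SemiAdditive.comp_zero]

theorem id_eq_mono (M : BiprodCompletion E) : 𝟙 M = mono id fun i => 𝟙 (M.X i) := by
  funext i j
  by_cases h : i = j
  · subst h; simp [mono, CategoryStruct.id]
  · simp [mono, CategoryStruct.id, h]

open scoped Classical in
/-- The isomorphism given by a bijection of the indices and a family of isomorphisms. -/
noncomputable def monoIso {M N : BiprodCompletion E} (e : M.ι ≃ N.ι)
    (φ : ∀ i, M.X i ≅ N.X (e i)) : M ≅ N where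
  hom := mono e fun i => (φ i).hom
  inv := fun j i => if h : e i = j then eqToHom (congrArg N.X h.symm) ≫ (φ i).inv else 0
  hom_inv_id := by
    funext i k
    rw [mono_comp_apply]
    by_cases h : k = i
    · subst h; simp [CategoryStruct.id]
    · simp [CategoryStruct.id, h, Ne.symm h, SemiAdditive.comp_zero]
  inv_hom_id := by
    funext j k
    rw [comp_apply, Finset.sum_eq_single (e.symm j)]
    · by_cases h : j = k
      · subst h
        obtain ⟨i, rfl⟩ := e.surjective j
        simp [mono, CategoryStruct.id]
      · simp [mono, CategoryStruct.id, h, SemiAdditive.comp_zero]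
    · intro i _ hi
      have : e i ≠ j := fun h => hi (by simp [← h])
      simp [this, SemiAdditive.zero_comp]
    · simp

theorem comp_monoIso_apply {M N K : BiprodCompletion E} (f : K ⟶ M) (e : M.ι ≃ N.ι)
    (φ : ∀ i, M.X i ≅ N.X (e i)) (k : K.ι) (i : M.ι) :
    (f ≫ (monoIso e φ).hom) k (e i) = f k i ≫ (φ i).hom := by
  rw [comp_apply, Finset.sum_eq_single i]
  · simp [monoIso, mono]
  · intro j _ hj
    simp [monoIso, mono, hj, SemiAdditive.comp_zero]
  · simp

variable [MonoidalCategory E] [SemiAdditiveMonoidal E]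

noncomputable instance : MonoidalCategoryStruct (BiprodCompletion E) where
  tensorObj M N := ⟨M.ι × N.ι, fun i => M.X i.1 ⊗ N.X i.2⟩
  tensorHom f g := fun i j => f i.1 j.1 ⊗ₘ g i.2 j.2
  whiskerLeft M _ _ g := fun i j => (𝟙 M : M ⟶ M) i.1 j.1 ⊗ₘ g i.2 j.2
  whiskerRight f N := fun i j => f i.1 j.1 ⊗ₘ (𝟙 N : N ⟶ N) i.2 j.2
  tensorUnit := ⟨Unit, fun _ => 𝟙_ E⟩
  associator M N K := monoIso (Equiv.prodAssoc M.ι N.ι K.ι) fun _ => α_ _ _ _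
  leftUnitor M := monoIso (Equiv.punitProd M.ι) fun _ => λ_ _
  rightUnitor M := monoIso (Equiv.prodPUnit M.ι) fun _ => ρ_ _

theorem mono_tensor_mono {M N M' N' : BiprodCompletion E} (f : M.ι → N.ι)
    (φ : ∀ i, M.X i ⟶ N.X (f i)) (g : M'.ι → N'.ι) (ψ : ∀ j, M'.X j ⟶ N'.X (g j)) :
    mono f φ ⊗ₘ mono g ψ =
      mono (M := M ⊗ M') (N := N ⊗ N') (Prod.map f g) fun i => φ i.1 ⊗ₘ ψ i.2 := by
  funext i j
  obtain ⟨i, i'⟩ := i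
  obtain ⟨j, j'⟩ := j
  change mono f φ i j ⊗ₘ mono g ψ i' j' = _
  by_cases h : f i = j
  · by_cases h' : g i' = j'
    · subst h; subst h'; simp [mono]
    · have hh : ¬ (Prod.map f g (i, i') = (j, j')) := fun e => h' (congrArg Prod.snd e)
      rw [mono_apply_of_ne (M := M ⊗ M') _ _ hh, mono_apply_of_ne _ _ h',
        SemiAdditiveMonoidal.tensor_zero]
  · have hh : ¬ (Prod.map f g (i, i') = (j, j')) := fun e => h (congrArg Prod.fst e)
    rw [mono_apply_of_ne (M := M ⊗ M') _ _ hh, mono_apply_of_ne _ _ h,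
      SemiAdditiveMonoidal.zero_tensor]

theorem tensor_comp_tensor {M N K M' N' K' : BiprodCompletion E} (f : M ⟶ N) (g : N ⟶ K)
    (f' : M' ⟶ N') (g' : N' ⟶ K') :
    (f ⊗ₘ f') ≫ (g ⊗ₘ g') = (f ≫ g) ⊗ₘ (f' ≫ g') := by
  funext i k
  change ∑ j : N.ι × N'.ι, (f i.1 j.1 ⊗ₘ f' i.2 j.2) ≫ (g j.1 k.1 ⊗ₘ g' j.2 k.2) =
    (∑ j, f i.1 j ≫ g j k.1) ⊗ₘ (∑ j, f' i.2 j ≫ g' j k.2)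
  simp only [tensorHom_comp_tensorHom, sum_tensor, tensor_sum, Fintype.sum_prod_type_right]

noncomputable instance : MonoidalCategory (BiprodCompletion E) :=
  MonoidalCategory.ofTensorHom
    (id_tensorHom_id := fun M N => by
      rw [id_eq_mono, id_eq_mono, mono_tensor_mono, id_eq_mono]
      simp
      rfl)
    (id_tensorHom := fun _ _ _ _ => rfl)
    (tensorHom_id := fun _ _ => rfl)
    (tensorHom_comp_tensorHom := fun _ _ _ _ => tensor_comp_tensor _ _ _ _)
    (associator_naturality := fun f₁ f₂ f₃ => by
      funext i j
      obtain ⟨j, rfl⟩ := (Equiv.prodAssoc _ _ _).surjective j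
      refine (comp_monoIso_apply _ _ _ _ _).trans ?_
      refine Eq.trans ?_ (mono_comp_apply _ _ _ _ _).symm
      exact associator_naturality _ _ _)
    (leftUnitor_naturality := fun {M N} f => by
      funext i j
      obtain ⟨j, rfl⟩ := (Equiv.punitProd _).surjective j
      refine (comp_monoIso_apply _ _ _ _ _).trans ?_
      refine Eq.trans ?_ (mono_comp_apply _ _ _ _ _).symm
      obtain ⟨⟨⟩, i⟩ := i
      obtain ⟨⟨⟩, j⟩ := j
      have : (𝟙 (𝟙_ (BiprodCompletion E)) : 𝟙_ (BiprodCompletion E) ⟶ _) () () = 𝟙 (𝟙_ E) :=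
        dif_pos rfl
      change ((𝟙 (𝟙_ (BiprodCompletion E)) : 𝟙_ (BiprodCompletion E) ⟶ _) () () ⊗ₘ f i j) ≫ _ = _
      rw [this]
      refine (congrArg (· ≫ (λ_ (N.X j)).hom) (id_tensorHom _ (f i j))).trans ?_
      exact leftUnitor_naturality _)
    (rightUnitor_naturality := fun {M N} f => by
      funext i j
      obtain ⟨j, rfl⟩ := (Equiv.prodPUnit _).surjective j
      refine (comp_monoIso_apply _ _ _ _ _).trans ?_
      refine Eq.trans ?_ (mono_comp_apply _ _ _ _ _).symm
      obtain ⟨i, ⟨⟩⟩ := i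
      obtain ⟨j, ⟨⟩⟩ := j
      have : (𝟙 (𝟙_ (BiprodCompletion E)) : 𝟙_ (BiprodCompletion E) ⟶ _) () () = 𝟙 (𝟙_ E) :=
        dif_pos rfl
      change (f i j ⊗ₘ (𝟙 (𝟙_ (BiprodCompletion E)) : 𝟙_ (BiprodCompletion E) ⟶ _) () ()) ≫ _ = _
      rw [this]
      refine (congrArg (· ≫ (ρ_ (N.X j)).hom) (tensorHom_id (f i j) _)).trans ?_
      exact rightUnitor_naturality _)
    (pentagon := fun M N K L => by
      change (mono _ _ ⊗ₘ _) ≫ mono _ _ ≫ (_ ⊗ₘ mono _ _) = mono _ _ ≫ mono _ _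
      rw [id_eq_mono, id_eq_mono, mono_tensor_mono, mono_tensor_mono, mono_comp_mono,
        mono_comp_mono, mono_comp_mono]
      refine congrArg (mono _) (funext fun i => ?_)
      simp only [tensorHom_id, id_tensorHom]
      exact pentagon _ _ _ _)
    (triangle := fun M N => by
      change mono _ _ ≫ (_ ⊗ₘ mono _ _) = mono _ _ ⊗ₘ _
      rw [id_eq_mono, id_eq_mono, mono_tensor_mono, mono_tensor_mono, mono_comp_mono]
      refine congrArg (mono _) (funext fun i => ?_)
      simp only [tensorHom_id, id_tensorHom]
      exact triangle _ _)

instance [Discarding E] : Discarding (BiprodCompletion E) where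
  discard M := fun i _ => (discard (M.X i) : M.X i ⟶ 𝟙_ E)
  discard_unit := by
    funext i j
    have : (𝟙 (𝟙_ (BiprodCompletion E)) : 𝟙_ (BiprodCompletion E) ⟶ _) () () = 𝟙 (𝟙_ E) :=
      dif_pos rfl
    exact Eq.trans discard_unit this.symm

end BiprodCompletion
end BiprodCompletion

section Splitting

open Discarding (discard discard_unit)
open Idempotents

variable {E : Type u} [Category.{v} E] [MonoidalCategory E]

theorem karoubi_tensor_comm {P Q P' Q' : Karoubi E} (f : P ⟶ Q) (g : P' ⟶ Q') :
    f.f ⊗ₘ g.f = (P.p ⊗ₘ P'.p) ≫ (f.f ⊗ₘ g.f) ≫ (Q.p ⊗ₘ Q'.p) := by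
  simp

instance : MonoidalCategoryStruct (Karoubi E) where
  tensorObj P Q := ⟨P.X ⊗ Q.X, P.p ⊗ₘ Q.p, by simp⟩
  tensorHom f g := ⟨f.f ⊗ₘ g.f, by simp⟩
  whiskerLeft P _ _ g := ⟨P.p ⊗ₘ g.f, by simp⟩
  whiskerRight f Q := ⟨f.f ⊗ₘ Q.p, by simp⟩
  tensorUnit := (toKaroubi E).obj (𝟙_ E)
  associator P Q R :=
    { hom := ⟨((P.p ⊗ₘ Q.p) ⊗ₘ R.p) ≫ (α_ _ _ _).hom, by simp⟩
      inv := ⟨(P.p ⊗ₘ Q.p ⊗ₘ R.p) ≫ (α_ _ _ _).inv, by simp⟩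
      hom_inv_id := by ext; simp
      inv_hom_id := by ext; simp }
  leftUnitor P :=
    { hom := ⟨(𝟙 _ ⊗ₘ P.p) ≫ (λ_ _).hom, by simp⟩
      inv := ⟨P.p ≫ (λ_ _).inv, by simp⟩
      hom_inv_id := by ext; simp
      inv_hom_id := by ext; simp }
  rightUnitor P :=
    { hom := ⟨(P.p ⊗ₘ 𝟙 _) ≫ (ρ_ _).hom, by simp⟩
      inv := ⟨P.p ≫ (ρ_ _).inv, by simp⟩
      hom_inv_id := by ext; simp
      inv_hom_id := by ext; simp }

theorem karoubi_tensorHom_f {P Q P' Q' : Karoubi E} (f : P ⟶ Q) (g : P' ⟶ Q') :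
    (f ⊗ₘ g).f = f.f ⊗ₘ g.f := rfl

theorem karoubi_associator_hom_f (P Q R : Karoubi E) :
    (α_ P Q R).hom.f = ((P.p ⊗ₘ Q.p) ⊗ₘ R.p) ≫ (α_ P.X Q.X R.X).hom := rfl

theorem karoubi_leftUnitor_hom_f (P : Karoubi E) :
    (λ_ P).hom.f = (𝟙 (𝟙_ E) ⊗ₘ P.p) ≫ (λ_ P.X).hom := rfl

theorem karoubi_rightUnitor_hom_f (P : Karoubi E) :
    (ρ_ P).hom.f = (P.p ⊗ₘ 𝟙 (𝟙_ E)) ≫ (ρ_ P.X).hom := rfl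

theorem karoubi_tensorUnit_p : (𝟙_ (Karoubi E)).p = 𝟙 (𝟙_ E) := rfl

theorem karoubi_tensorObj_p (P Q : Karoubi E) : (P ⊗ Q).p = P.p ⊗ₘ Q.p := rfl

theorem karoubi_pentagon {A B C D : E} {p : A ⟶ A} {q : B ⟶ B} {r : C ⟶ C} {s : D ⟶ D}
    (hp : p ≫ p = p) (hq : q ≫ q = q) (hr : r ≫ r = r) (hs : s ≫ s = s) :
    ((((p ⊗ₘ q) ⊗ₘ r) ≫ (α_ A B C).hom) ⊗ₘ s) ≫
        (((p ⊗ₘ (q ⊗ₘ r)) ⊗ₘ s) ≫ (α_ A (B ⊗ C) D).hom) ≫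
          (p ⊗ₘ (((q ⊗ₘ r) ⊗ₘ s) ≫ (α_ B C D).hom)) =
      ((((p ⊗ₘ q) ⊗ₘ r) ⊗ₘ s) ≫ (α_ (A ⊗ B) C D).hom) ≫
        (((p ⊗ₘ q) ⊗ₘ (r ⊗ₘ s)) ≫ (α_ A B (C ⊗ D)).hom) := by
  have h1 : ((((p ⊗ₘ q) ⊗ₘ r) ≫ (α_ A B C).hom) ⊗ₘ s) =
      ((α_ A B C).hom ▷ D) ≫ ((p ⊗ₘ (q ⊗ₘ r)) ⊗ₘ s) := by
    rw [associator_naturality, ← tensorHom_id, tensorHom_comp_tensorHom, Category.id_comp]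
  have h2 : (p ⊗ₘ (((q ⊗ₘ r) ⊗ₘ s) ≫ (α_ B C D).hom)) =
      (A ◁ (α_ B C D).hom) ≫ (p ⊗ₘ (q ⊗ₘ r ⊗ₘ s)) := by
    rw [associator_naturality, ← id_tensorHom, tensorHom_comp_tensorHom, Category.id_comp]
  rw [h1, h2]
  have h4 : (p ⊗ₘ (q ⊗ₘ r ⊗ₘ s)) ≫ (p ⊗ₘ (q ⊗ₘ r ⊗ₘ s)) = (p ⊗ₘ (q ⊗ₘ r ⊗ₘ s)) := by
    simp only [tensorHom_comp_tensorHom, hp, hq, hr, hs]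
  have h5 : (p ⊗ₘ ((q ⊗ₘ r) ⊗ₘ s)) ≫ (A ◁ (α_ B C D).hom) =
      (A ◁ (α_ B C D).hom) ≫ (p ⊗ₘ (q ⊗ₘ r ⊗ₘ s)) := by
    rw [← h2, ← id_tensorHom, tensorHom_comp_tensorHom, Category.comp_id]
  simp only [Category.assoc, associator_naturality]
  rw [reassoc_of% h5, h4, associator_naturality_assoc, reassoc_of% h5, h4,
    associator_naturality_assoc, h4, pentagon_assoc]

theorem karoubi_triangle {A B : E} {p : A ⟶ A} {q : B ⟶ B}
    (hp : p ≫ p = p) (hq : q ≫ q = q) :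
    (((p ⊗ₘ 𝟙 (𝟙_ E)) ⊗ₘ q) ≫ (α_ A (𝟙_ E) B).hom) ≫
        (p ⊗ₘ ((𝟙 (𝟙_ E) ⊗ₘ q) ≫ (λ_ B).hom)) =
      ((p ⊗ₘ 𝟙 (𝟙_ E)) ≫ (ρ_ A).hom) ⊗ₘ q := by
  have h2 : (p ⊗ₘ ((𝟙 (𝟙_ E) ⊗ₘ q) ≫ (λ_ B).hom)) =
      (A ◁ (λ_ B).hom) ≫ (p ⊗ₘ q) := by
    rw [id_tensorHom, leftUnitor_naturality, ← id_tensorHom A, tensorHom_comp_tensorHom,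
      Category.id_comp]
  have h3 : (p ⊗ₘ 𝟙 (𝟙_ E) ⊗ₘ q) ≫ (A ◁ (λ_ B).hom) = (A ◁ (λ_ B).hom) ≫ (p ⊗ₘ q) := by
    rw [← h2, ← id_tensorHom, tensorHom_comp_tensorHom, Category.comp_id]
  rw [h2, Category.assoc, associator_naturality_assoc, reassoc_of% h3,
    tensorHom_comp_tensorHom, hp, hq, triangle_assoc, tensorHom_id p, rightUnitor_naturality,
    ← tensorHom_id (ρ_ A).hom, tensorHom_comp_tensorHom, Category.id_comp]

instance : MonoidalCategory (Karoubi E) :=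
  MonoidalCategory.ofTensorHom
    (id_tensorHom_id := fun _ _ => rfl)
    (id_tensorHom := fun _ _ _ _ => rfl)
    (tensorHom_id := fun _ _ => rfl)
    (tensorHom_comp_tensorHom := fun _ _ _ _ => by ext; exact tensorHom_comp_tensorHom _ _ _ _)
    (associator_naturality := fun f₁ f₂ f₃ => by
      ext
      simp only [Karoubi.comp_f, karoubi_tensorHom_f, karoubi_associator_hom_f]
      simp)
    (leftUnitor_naturality := fun {P Q} f => by
      ext
      change (𝟙 (𝟙_ E) ⊗ₘ f.f) ≫ (𝟙 (𝟙_ E) ⊗ₘ Q.p) ≫ (λ_ Q.X).hom =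
        ((𝟙 (𝟙_ E) ⊗ₘ P.p) ≫ (λ_ P.X).hom) ≫ f.f
      simp only [id_tensorHom, leftUnitor_naturality, Category.assoc, Karoubi.comp_p,
        Karoubi.p_comp, leftUnitor_naturality_assoc])
    (rightUnitor_naturality := fun {P Q} f => by
      ext
      change (f.f ⊗ₘ 𝟙 (𝟙_ E)) ≫ (Q.p ⊗ₘ 𝟙 (𝟙_ E)) ≫ (ρ_ Q.X).hom =
        ((P.p ⊗ₘ 𝟙 (𝟙_ E)) ≫ (ρ_ P.X).hom) ≫ f.f
      simp only [tensorHom_id, rightUnitor_naturality, Category.assoc, Karoubi.comp_p,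
        Karoubi.p_comp, rightUnitor_naturality_assoc])
    (pentagon := fun P Q R S => by
      ext
      exact karoubi_pentagon P.idem Q.idem R.idem S.idem)
    (triangle := fun P Q => by
      ext
      exact karoubi_triangle P.idem Q.idem)

variable [Discarding E]

instance : Discarding (Karoubi E) where
  discard P :=
    { f := P.p ≫ discard P.X
      comm := by
        change P.p ≫ (P.p ≫ discard P.X) ≫ 𝟙 _ = _
        simp }
  discard_unit := by
    ext
    change 𝟙 _ ≫ discard (𝟙_ E) = 𝟙 _
    rw [discard_unit, Category.id_comp]

/-- Discarding on a full monoidal subcategory. -/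
instance {D : Type u} [Category.{v} D] [MonoidalCategory D] [Discarding D]
    (P : ObjectProperty D) [P.IsMonoidal] : Discarding P.FullSubcategory where
  discard A := P.homMk (discard A.obj)
  discard_unit := by
    ext
    exact discard_unit

variable (E)

/-- The objects `(A, p)` of the Karoubi envelope with `p` causal. -/
def causalIdempotents : ObjectProperty (Karoubi E) := fun P => Causal P.p

instance [MonoidalDiscarding E] : (causalIdempotents E).IsMonoidal where
  prop_unit := causal_id _
  prop_tensor _ _ h h' := Causal.tensor h h'

variable [MonoidalDiscarding E]

/-- The category obtained by splitting the causal idempotents of `E`. -/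
abbrev SplitCausal := (causalIdempotents E).FullSubcategory

/-- The embedding `A ↦ (A, 𝟙 A)`. -/
def toSplitCausal : E ⥤ SplitCausal E :=
  (causalIdempotents E).lift (toKaroubi E) fun A => causal_id A

variable {E}

/-- A causal finite decomposition of `p`: it is a finite sum of split idempotents `e i ≫ m i`
which are mutually orthogonal, with every `m i` causal. -/
def HasCausalFiniteDecomposition [SemiAdditive E] {A : E} (p : A ⟶ A) : Prop :=
  ∃ (n : ℕ) (B : Fin n → E) (e : ∀ i, A ⟶ B i) (m : ∀ i, B i ⟶ A),
    (∀ i, m i ≫ e i = 𝟙 (B i)) ∧ (∀ i, Causal (m i)) ∧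
      (∀ i j, i ≠ j → (e i ≫ m i) ≫ e j ≫ m j = 0) ∧ p = ∑ i, e i ≫ m i

variable (E)

/-- Every causal idempotent has a causal finite decomposition. -/
def FiniteDecompositionProperty [SemiAdditive E] : Prop :=
  ∀ (A : E) (p : A ⟶ A), p ≫ p = p → Causal p → HasCausalFiniteDecomposition p

end Splitting

section Braiding

variable {C : Type u} [Category.{v} C] [MonoidalCategory C] [SymmetricCategory C]

theorem tensorμ_braiding (W X Y Z : C) :
    tensorμ W X Y Z ≫ (β_ (W ⊗ Y) (X ⊗ Z)).hom =
      ((β_ W X).hom ⊗ₘ (β_ Y Z).hom) ≫ tensorμ X W Z Y := by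
  simp [tensorμ, SymmetricCategory.braiding_swap_eq_inv_braiding Z W,
    MonoidalCategory.tensorHom_def]
  rw [← MonoidalCategory.whiskerLeft_comp_assoc W ((β_ X Y).hom ▷ Z), ← comp_whiskerRight,
    SymmetricCategory.symmetry]
  simp

theorem tensorδ_braiding (W X Y Z : C) :
    (β_ (W ⊗ Y) (X ⊗ Z)).hom ≫ tensorδ X W Z Y =
      tensorδ W X Y Z ≫ ((β_ W X).hom ⊗ₘ (β_ Y Z).hom) := by
  have h := congrArg (fun k => tensorδ W X Y Z ≫ k ≫ tensorδ X W Z Y) (tensorμ_braiding W X Y Z)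
  simpa using h

end Braiding

section Dagger

/-- An involutive identity-on-objects contravariant functor. -/
class DaggerCategory (C : Type u) [Category.{v} C] where
  dag : ∀ {A B : C}, (A ⟶ B) → (B ⟶ A)
  dag_id : ∀ A : C, dag (𝟙 A) = 𝟙 A
  dag_comp : ∀ {A B D : C} (f : A ⟶ B) (g : B ⟶ D), dag (f ≫ g) = dag g ≫ dag f
  dag_dag : ∀ {A B : C} (f : A ⟶ B), dag (dag f) = f

open DaggerCategory (dag dag_id dag_comp dag_dag)

/-- A morphism is positive when it has the form `h† ∘ h`. -/
def Positive {C : Type u} [Category.{v} C] [DaggerCategory C] {A : C} (f : A ⟶ A) : Prop :=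
  ∃ (B : C) (h : A ⟶ B), f = h ≫ dag h

/-- The dagger of a semi-additive category is additive on morphisms. -/
class DaggerSemiAdditive (C : Type u) [Category.{v} C] [DaggerCategory C] [SemiAdditive C] :
    Prop where
  dag_add : ∀ {A B : C} (f g : A ⟶ B), dag (f + g) = dag f + dag g

/-- Every finite family of objects has a biproduct whose projections are the daggers of its
injections. -/
class HasDaggerBiproducts (C : Type u) [Category.{v} C] [DaggerCategory C] [SemiAdditive C] :
    Prop where
  exists_biproduct : ∀ (n : ℕ) (A : Fin n → C), ∃ (B : C) (κ : ∀ i, A i ⟶ B),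
    (∀ i, κ i ≫ dag (κ i) = 𝟙 (A i)) ∧ (∀ i j, i ≠ j → κ i ≫ dag (κ j) = 0) ∧
      ∑ i, dag (κ i) ≫ κ i = 𝟙 B

/-- A dagger symmetric monoidal category: the dagger is compatible with the tensor product and the
coherence isomorphisms are unitary. -/
class DaggerSymmetricMonoidal (C : Type u) [Category.{v} C] [MonoidalCategory C]
    [SymmetricCategory C] [DaggerCategory C] : Prop where
  dag_tensor : ∀ {A B A' B' : C} (f : A ⟶ B) (g : A' ⟶ B'), dag (f ⊗ₘ g) = dag f ⊗ₘ dag g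
  dag_associator : ∀ A B D : C, dag (α_ A B D).hom = (α_ A B D).inv
  dag_leftUnitor : ∀ A : C, dag (λ_ A).hom = (λ_ A).inv
  dag_rightUnitor : ∀ A : C, dag (ρ_ A).hom = (ρ_ A).inv
  dag_braiding : ∀ A B : C, dag (β_ A B).hom = (β_ A B).inv

variable {C : Type u} [Category.{v} C] [MonoidalCategory C] [SymmetricCategory C]
  [DaggerCategory C]

/-- A dagger dual of `A`: an object `dual` with a cup `η : I ⟶ A ⊗ dual` and the
cap `ε = η† ∘ β : dual ⊗ A ⟶ I` satisfying the snake equations. -/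
structure DaggerDual (A : C) where
  dual : C
  η : 𝟙_ C ⟶ A ⊗ dual
  ε : dual ⊗ A ⟶ 𝟙_ C
  ε_eq : ε = (β_ dual A).hom ≫ dag η
  snake_left : η ▷ A ≫ (α_ A dual A).hom ≫ A ◁ ε = (λ_ A).hom ≫ (ρ_ A).inv
  snake_right : dual ◁ η ≫ (α_ dual A dual).inv ≫ ε ▷ dual = (ρ_ dual).hom ≫ (λ_ dual).inv

variable (C) in
/-- A dagger compact category: a dagger symmetric monoidal category in which every object has a
dagger dual. -/
class DaggerCompact : Prop extends DaggerSymmetricMonoidal C where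
  exists_dual : ∀ A : C, Nonempty (DaggerDual A)

variable (C) in
/-- For every object `A` there is a scalar `z` with `(z† ∘ z ∘ dim A) • id_A = id_A`. -/
def PositiveDimensional : Prop :=
  ∀ (A : C) (D : DaggerDual A), ∃ z : 𝟙_ C ⟶ 𝟙_ C,
    (λ_ A).inv ≫ (z ≫ dag z ≫ D.η ≫ dag D.η) ▷ A ≫ (λ_ A).hom = 𝟙 A

variable [DaggerSymmetricMonoidal C]

open DaggerSymmetricMonoidal

theorem dag_whiskerLeft (A : C) {B D : C} (f : B ⟶ D) : dag (A ◁ f) = A ◁ dag f := by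
  rw [← id_tensorHom, dag_tensor, dag_id, id_tensorHom]

theorem dag_whiskerRight {B D : C} (f : B ⟶ D) (A : C) : dag (f ▷ A) = dag f ▷ A := by
  rw [← tensorHom_id, dag_tensor, dag_id, tensorHom_id]

theorem dag_associator_inv (A B D : C) : dag (α_ A B D).inv = (α_ A B D).hom := by
  rw [← dag_associator, dag_dag]

theorem dag_leftUnitor_inv (A : C) : dag (λ_ A).inv = (λ_ A).hom := by
  rw [← dag_leftUnitor, dag_dag]

theorem dag_rightUnitor_inv (A : C) : dag (ρ_ A).inv = (ρ_ A).hom := by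
  rw [← dag_rightUnitor, dag_dag]

theorem dag_braiding_inv (A B : C) : dag (β_ A B).inv = (β_ A B).hom := by
  rw [← dag_braiding, dag_dag]

theorem dag_tensorμ (A B A' B' : C) : dag (tensorμ A B A' B') = tensorδ A B A' B' := by
  simp [tensorμ, tensorδ, dag_comp, dag_whiskerLeft, dag_whiskerRight, dag_associator,
    dag_associator_inv, dag_braiding]

theorem dag_tensorδ (A B A' B' : C) : dag (tensorδ A B A' B') = tensorμ A B A' B' := by
  rw [← dag_tensorμ, dag_dag]

end Dagger

section Choi

variable {C : Type u} [Category.{v} C] [MonoidalCategory C]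

/-- Given `c : S ⟶ S ⊗ K` and `m : L ⊗ T ⟶ T`, a morphism `f : K ⟶ L` is turned into the
endomorphism `(S ◁ m) ∘ (S ◁ f ▷ T) ∘ (c ▷ T)` of `S ⊗ T`. -/
def choi {S T K L : C} (c : S ⟶ S ⊗ K) (m : L ⊗ T ⟶ T) (f : K ⟶ L) : S ⊗ T ⟶ S ⊗ T :=
  c ▷ T ≫ (α_ S K T).hom ≫ S ◁ (f ▷ T ≫ m)

theorem choi_precomp {S T K L K' L' : C} (c : S ⟶ S ⊗ K) (m : L ⊗ T ⟶ T) (k : K ⟶ K')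
    (f : K' ⟶ L') (l : L' ⟶ L) :
    choi c m (k ≫ f ≫ l) = choi (c ≫ S ◁ k) (l ▷ T ≫ m) f := by
  simp [choi]

/-- The composition rule: if `c₂`, `m₂`, `u`, `u'` satisfy a snake equation, then
`choi c₁ m₃ (f ≫ g)` is obtained from `choi c₁ m₂ f ⊗ choi c₂ m₃ g` by inserting `u` and `u'`. -/
theorem choi_comp {S₁ S₂ T₂ T₃ K₁ K₂ K₃ : C} (c₁ : S₁ ⟶ S₁ ⊗ K₁) (c₂ : S₂ ⟶ S₂ ⊗ K₂)
    (m₂ : K₂ ⊗ T₂ ⟶ T₂) (m₃ : K₃ ⊗ T₃ ⟶ T₃) (u : 𝟙_ C ⟶ T₂ ⊗ S₂) (u' : T₂ ⊗ S₂ ⟶ 𝟙_ C)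
    (h : (ρ_ K₂).inv ≫ K₂ ◁ u ≫ (α_ K₂ T₂ S₂).inv ≫ m₂ ▷ S₂ ≫ T₂ ◁ c₂ ≫
      (α_ T₂ S₂ K₂).inv ≫ u' ▷ K₂ ≫ (λ_ K₂).hom = 𝟙 K₂) (f : K₁ ⟶ K₂) (g : K₂ ⟶ K₃) :
    choi c₁ m₃ (f ≫ g) =
      (S₁ ◁ ((λ_ T₃).inv ≫ u ▷ T₃ ≫ (α_ T₂ S₂ T₃).hom) ≫ (α_ S₁ T₂ (S₂ ⊗ T₃)).inv) ≫
        (choi c₁ m₂ f ⊗ₘ choi c₂ m₃ g) ≫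
          ((α_ S₁ T₂ (S₂ ⊗ T₃)).hom ≫
            S₁ ◁ ((α_ T₂ S₂ T₃).inv ≫ u' ▷ T₃ ≫ (λ_ T₃).hom)) := by
  symm
  calc
    _ = 𝟙 _ ⊗≫ S₁ ◁ u ▷ T₃ ⊗≫ (c₁ ≫ S₁ ◁ f) ▷ (T₂ ⊗ S₂) ▷ T₃ ⊗≫
          S₁ ◁ m₂ ▷ S₂ ▷ T₃ ⊗≫ S₁ ◁ T₂ ◁ c₂ ▷ T₃ ⊗≫
          S₁ ◁ ((T₂ ⊗ S₂) ◁ (g ▷ T₃ ≫ m₃) ≫ u' ▷ T₃) ⊗≫ 𝟙 _ := by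
      rw [MonoidalCategory.tensorHom_def]
      simp only [choi]
      monoidal
    _ = 𝟙 _ ⊗≫ (S₁ ◁ u ≫ (c₁ ≫ S₁ ◁ f) ▷ (T₂ ⊗ S₂)) ▷ T₃ ⊗≫
          S₁ ◁ m₂ ▷ S₂ ▷ T₃ ⊗≫ S₁ ◁ T₂ ◁ c₂ ▷ T₃ ⊗≫
          S₁ ◁ (u' ▷ (K₂ ⊗ T₃) ≫ 𝟙_ C ◁ (g ▷ T₃ ≫ m₃)) ⊗≫ 𝟙 _ := by
      rw [← whisker_exchange u']
      monoidal
    _ = 𝟙 _ ⊗≫ ((c₁ ≫ S₁ ◁ f) ▷ 𝟙_ C) ▷ T₃ ⊗≫ S₁ ◁ ((ρ_ K₂).inv ≫ K₂ ◁ u ≫ (α_ K₂ T₂ S₂).inv ≫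
          m₂ ▷ S₂ ≫ T₂ ◁ c₂ ≫ (α_ T₂ S₂ K₂).inv ≫ u' ▷ K₂ ≫ (λ_ K₂).hom) ▷ T₃ ⊗≫
          S₁ ◁ (g ▷ T₃ ≫ m₃) ⊗≫ 𝟙 _ := by
      rw [whisker_exchange]
      monoidal
    _ = _ := by
      rw [h]
      simp only [choi]
      monoidal

variable [SymmetricCategory C]

theorem tensorδ_natural {X₁ X₂ Y₁ Y₂ U₁ U₂ V₁ V₂ : C} (f₁ : X₁ ⟶ Y₁) (f₂ : X₂ ⟶ Y₂)
    (g₁ : U₁ ⟶ V₁) (g₂ : U₂ ⟶ V₂) :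
    ((f₁ ⊗ₘ g₁) ⊗ₘ f₂ ⊗ₘ g₂) ≫ tensorδ Y₁ Y₂ V₁ V₂ =
      tensorδ X₁ X₂ U₁ U₂ ≫ ((f₁ ⊗ₘ f₂) ⊗ₘ g₁ ⊗ₘ g₂) := by
  have h := congrArg (fun k => tensorδ X₁ X₂ U₁ U₂ ≫ k ≫ tensorδ Y₁ Y₂ V₁ V₂)
    (tensorμ_natural f₁ f₂ g₁ g₂)
  simp only [Category.assoc, tensorμ_tensorδ, tensorδ_tensorμ_assoc, Category.comp_id] at h
  exact h.symm

theorem choi_tensor {S S' T T' K K' L L' : C} (c : S ⟶ S ⊗ K) (c' : S' ⟶ S' ⊗ K')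
    (m : L ⊗ T ⟶ T) (m' : L' ⊗ T' ⟶ T') (f : K ⟶ L) (f' : K' ⟶ L') :
    choi ((c ⊗ₘ c') ≫ tensorμ S K S' K') (tensorδ L T L' T' ≫ (m ⊗ₘ m')) (f ⊗ₘ f') =
      tensorδ S T S' T' ≫ (choi c m f ⊗ₘ choi c' m' f') ≫ tensorμ S T S' T' := by
  have key : tensorμ S T S' T' ≫
      choi ((c ⊗ₘ c') ≫ tensorμ S K S' K') (tensorδ L T L' T' ≫ (m ⊗ₘ m')) (f ⊗ₘ f') =
      (choi c m f ⊗ₘ choi c' m' f') ≫ tensorμ S T S' T' := by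
    have h1 : tensorμ S T S' T' ≫ (c ⊗ₘ c') ▷ (T ⊗ T') =
        (c ▷ T ⊗ₘ c' ▷ T') ≫ tensorμ (S ⊗ K) T (S' ⊗ K') T' := by
      rw [← tensorHom_id, ← id_tensorHom_id, ← tensorμ_natural, tensorHom_id, tensorHom_id]
    have h2 : tensorμ K T K' T' ≫ (f ⊗ₘ f') ▷ (T ⊗ T') ≫ tensorδ L T L' T' ≫ (m ⊗ₘ m') =
        (f ▷ T ≫ m) ⊗ₘ (f' ▷ T' ≫ m') := by
      rw [← tensorHom_id, ← id_tensorHom_id, ← tensorμ_natural_assoc, tensorHom_id, tensorHom_id,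
        tensorμ_tensorδ_assoc, tensorHom_comp_tensorHom]
    have h3 : tensorμ S (K ⊗ T) S' (K' ⊗ T') ≫
        (S ⊗ S') ◁ ((f ▷ T ≫ m) ⊗ₘ (f' ▷ T' ≫ m')) =
        (S ◁ (f ▷ T ≫ m) ⊗ₘ S' ◁ (f' ▷ T' ≫ m')) ≫ tensorμ S T S' T' := by
      rw [← id_tensorHom, ← id_tensorHom_id, ← tensorμ_natural, id_tensorHom, id_tensorHom]
    simp only [choi, comp_whiskerRight, Category.assoc]
    rw [reassoc_of% h1, associator_monoidal_assoc, ← MonoidalCategory.whiskerLeft_comp, h2, h3]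
    simp only [← tensorHom_comp_tensorHom, Category.assoc]
  rw [← key, tensorδ_tensorμ_assoc]

end Choi

section Positive

open DaggerCategory (dag dag_id dag_comp dag_dag)
open DaggerSymmetricMonoidal

variable {C : Type u} [Category.{v} C] [DaggerCategory C]

theorem Positive.conj {A B : C} {f : A ⟶ A} (hf : Positive f) (k : B ⟶ A) :
    Positive (k ≫ f ≫ dag k) := by
  obtain ⟨D, h, rfl⟩ := hf
  exact ⟨D, k ≫ h, by simp [dag_comp]⟩

theorem positive_self_comp_dag {A B : C} (h : A ⟶ B) : Positive (h ≫ dag h) := ⟨B, h, rfl⟩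

theorem positive_id (A : C) : Positive (𝟙 A) := ⟨A, 𝟙 A, by simp [dag_id]⟩

variable [MonoidalCategory C] [SymmetricCategory C] [DaggerSymmetricMonoidal C]

theorem Positive.tensor {A B : C} {f : A ⟶ A} {g : B ⟶ B} (hf : Positive f) (hg : Positive g) :
    Positive (f ⊗ₘ g) := by
  obtain ⟨D, h, rfl⟩ := hf
  obtain ⟨D', h', rfl⟩ := hg
  exact ⟨D ⊗ D', h ⊗ₘ h', by simp [dag_tensor]⟩

theorem positive_choi_comp {S₁ S₂ T₂ T₃ K₁ K₂ K₃ : C} {c₁ : S₁ ⟶ S₁ ⊗ K₁} {c₂ : S₂ ⟶ S₂ ⊗ K₂}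
    {m₂ : K₂ ⊗ T₂ ⟶ T₂} {m₃ : K₃ ⊗ T₃ ⟶ T₃} (u : 𝟙_ C ⟶ T₂ ⊗ S₂)
    (h : (ρ_ K₂).inv ≫ K₂ ◁ u ≫ (α_ K₂ T₂ S₂).inv ≫ m₂ ▷ S₂ ≫ T₂ ◁ c₂ ≫
      (α_ T₂ S₂ K₂).inv ≫ dag u ▷ K₂ ≫ (λ_ K₂).hom = 𝟙 K₂) {f : K₁ ⟶ K₂} {g : K₂ ⟶ K₃}
    (hf : Positive (choi c₁ m₂ f)) (hg : Positive (choi c₂ m₃ g)) :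
    Positive (choi c₁ m₃ (f ≫ g)) := by
  rw [choi_comp c₁ c₂ m₂ m₃ u (dag u) h]
  have : (α_ S₁ T₂ (S₂ ⊗ T₃)).hom ≫ S₁ ◁ ((α_ T₂ S₂ T₃).inv ≫ dag u ▷ T₃ ≫ (λ_ T₃).hom) =
      dag (S₁ ◁ ((λ_ T₃).inv ≫ u ▷ T₃ ≫ (α_ T₂ S₂ T₃).hom) ≫ (α_ S₁ T₂ (S₂ ⊗ T₃)).inv) := by
    simp [dag_comp, dag_whiskerLeft, dag_whiskerRight, dag_associator, dag_associator_inv,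
      dag_leftUnitor_inv]
  rw [this]
  exact (hf.tensor hg).conj _

theorem positive_choi_tensor {S S' T T' K K' L L' : C} {c : S ⟶ S ⊗ K} {c' : S' ⟶ S' ⊗ K'}
    {m : L ⊗ T ⟶ T} {m' : L' ⊗ T' ⟶ T'} {f : K ⟶ L} {f' : K' ⟶ L'}
    (hf : Positive (choi c m f)) (hf' : Positive (choi c' m' f')) :
    Positive (choi ((c ⊗ₘ c') ≫ tensorμ S K S' K') (tensorδ L T L' T' ≫ (m ⊗ₘ m'))
      (f ⊗ₘ f')) := by
  rw [choi_tensor, ← dag_tensorδ]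
  exact (hf.tensor hf').conj _

end Positive

section Dual

open DaggerCategory (dag dag_id dag_comp dag_dag)
open DaggerSymmetricMonoidal

variable {C : Type u} [Category.{v} C] [MonoidalCategory C] [SymmetricCategory C]
  [DaggerCategory C]

namespace DaggerDual

/-- The map `A ⟶ A ⊗ (A* ⊗ A)` given by the cup of `A`. -/
def coact {A : C} (D : DaggerDual A) : A ⟶ A ⊗ (D.dual ⊗ A) :=
  (λ_ A).inv ≫ D.η ▷ A ≫ (α_ A D.dual A).hom

/-- The map `(A* ⊗ A) ⊗ A* ⟶ A*` given by the dagger of the cup of `A`. -/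
def act {A : C} (D : DaggerDual A) : (D.dual ⊗ A) ⊗ D.dual ⟶ D.dual :=
  (α_ D.dual A D.dual).hom ≫ D.dual ◁ dag D.η ≫ (ρ_ D.dual).hom

theorem coact_ε {A : C} (D : DaggerDual A) : D.coact ≫ A ◁ D.ε = (ρ_ A).inv := by
  simp [coact, D.snake_left]

variable [DaggerSymmetricMonoidal C]

theorem dag_ε_act {A : C} (D : DaggerDual A) :
    dag D.ε ▷ D.dual ≫ D.act = (λ_ D.dual).hom := by
  have h := congrArg dag D.snake_right
  simp only [dag_comp, dag_whiskerLeft, dag_whiskerRight, dag_associator_inv,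
    dag_rightUnitor, dag_leftUnitor_inv, Category.assoc] at h
  rw [act, reassoc_of% h]
  simp

theorem snake {A : C} (D : DaggerDual A) :
    (ρ_ (D.dual ⊗ A)).inv ≫ (D.dual ⊗ A) ◁ dag D.ε ≫ (α_ (D.dual ⊗ A) D.dual A).inv ≫
      D.act ▷ A ≫ D.dual ◁ D.coact ≫ (α_ D.dual A (D.dual ⊗ A)).inv ≫
        dag (dag D.ε) ▷ (D.dual ⊗ A) ≫ (λ_ (D.dual ⊗ A)).hom = 𝟙 (D.dual ⊗ A) := by
  have h1 : A ◁ dag D.ε ≫ (α_ A D.dual A).inv ≫ dag D.η ▷ A = (ρ_ A).hom ≫ (λ_ A).inv := by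
    have h := congrArg dag D.snake_left
    simpa only [dag_comp, dag_whiskerLeft, dag_whiskerRight, dag_associator,
      dag_rightUnitor_inv, dag_leftUnitor, Category.assoc] using h
  rw [dag_dag]
  calc
    _ = (ρ_ (D.dual ⊗ A)).inv ⊗≫ D.dual ◁ (A ◁ dag D.ε ≫ (α_ A D.dual A).inv ≫ dag D.η ▷ A) ⊗≫
          (D.dual ◁ D.η ≫ (α_ D.dual A D.dual).inv ≫ D.ε ▷ D.dual) ▷ A ⊗≫ 𝟙 _ := by
      simp only [act, coact]
      monoidal
    _ = _ := by
      rw [h1, D.snake_right]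
      monoidal

/-- The tensor unit is its own dual. -/
abbrev unit : DaggerDual (𝟙_ C) where
  dual := 𝟙_ C
  η := (λ_ (𝟙_ C)).inv
  ε := (λ_ (𝟙_ C)).hom
  ε_eq := by
    rw [dag_leftUnitor_inv, braiding_tensorUnit_left, unitors_equal]; simp
  snake_left := by monoidal
  snake_right := by monoidal

/-- The cup of a tensor product. -/
def tensorCup {A B : C} (D : DaggerDual A) (E : DaggerDual B) :
    𝟙_ C ⟶ (A ⊗ B) ⊗ (D.dual ⊗ E.dual) :=
  (λ_ (𝟙_ C)).inv ≫ (D.η ⊗ₘ E.η) ≫ tensorμ A D.dual B E.dual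

theorem tensorCup_coact {A B : C} (D : DaggerDual A) (E : DaggerDual B) :
    (λ_ (A ⊗ B)).inv ≫ tensorCup D E ▷ (A ⊗ B) ≫ (α_ (A ⊗ B) (D.dual ⊗ E.dual) (A ⊗ B)).hom =
      (D.coact ⊗ₘ E.coact) ≫ tensorμ A (D.dual ⊗ A) B (E.dual ⊗ B) ≫
        (A ⊗ B) ◁ tensorμ D.dual A E.dual B := by
  have h0 : (λ_ (A ⊗ B)).inv ≫ (λ_ (𝟙_ C)).inv ▷ (A ⊗ B) =
      ((λ_ A).inv ⊗ₘ (λ_ B).inv) ≫ tensorμ (𝟙_ C) A (𝟙_ C) B := by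
    rw [← cancel_mono ((λ_ (𝟙_ C)).hom ▷ (A ⊗ B) ≫ (λ_ (A ⊗ B)).hom), Category.assoc,
      Category.assoc, ← leftUnitor_monoidal]
    simp
  have h1 : tensorμ (𝟙_ C) A (𝟙_ C) B ≫ (D.η ⊗ₘ E.η) ▷ (A ⊗ B) =
      (D.η ▷ A ⊗ₘ E.η ▷ B) ≫ tensorμ (A ⊗ D.dual) A (B ⊗ E.dual) B := by
    rw [← tensorHom_id, ← id_tensorHom_id, ← tensorμ_natural, tensorHom_id, tensorHom_id]
  simp only [tensorCup, comp_whiskerRight, Category.assoc, coact]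
  rw [reassoc_of% h0, reassoc_of% h1, associator_monoidal]
  simp only [← tensorHom_comp_tensorHom, Category.assoc]

theorem tensorCup_act {A B : C} (D : DaggerDual A) (E : DaggerDual B) :
    (α_ (D.dual ⊗ E.dual) (A ⊗ B) (D.dual ⊗ E.dual)).hom ≫
        (D.dual ⊗ E.dual) ◁ dag (tensorCup D E) ≫ (ρ_ (D.dual ⊗ E.dual)).hom =
      tensorδ D.dual A E.dual B ▷ (D.dual ⊗ E.dual) ≫
        tensorδ (D.dual ⊗ A) D.dual (E.dual ⊗ B) E.dual ≫ (D.act ⊗ₘ E.act) := by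
  have key : tensorμ (D.dual ⊗ A) D.dual (E.dual ⊗ B) E.dual ≫
      tensorμ D.dual A E.dual B ▷ (D.dual ⊗ E.dual) ≫
      (α_ (D.dual ⊗ E.dual) (A ⊗ B) (D.dual ⊗ E.dual)).hom ≫
        (D.dual ⊗ E.dual) ◁ dag (tensorCup D E) ≫ (ρ_ (D.dual ⊗ E.dual)).hom =
      (D.act ⊗ₘ E.act) := by
    have h1 : tensorμ D.dual (A ⊗ D.dual) E.dual (B ⊗ E.dual) ≫
        (D.dual ⊗ E.dual) ◁ (dag D.η ⊗ₘ dag E.η) =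
        (D.dual ◁ dag D.η ⊗ₘ E.dual ◁ dag E.η) ≫ tensorμ D.dual (𝟙_ C) E.dual (𝟙_ C) := by
      rw [← id_tensorHom, ← id_tensorHom_id, ← tensorμ_natural, id_tensorHom, id_tensorHom]
    rw [associator_monoidal_assoc]
    simp only [tensorCup, dag_comp, dag_tensor, dag_tensorμ, dag_leftUnitor_inv, act,
      MonoidalCategory.whiskerLeft_comp, Category.assoc]
    rw [← MonoidalCategory.whiskerLeft_comp_assoc _ (tensorμ A D.dual B E.dual),
      tensorμ_tensorδ, MonoidalCategory.whiskerLeft_id, Category.id_comp, reassoc_of% h1,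
      ← rightUnitor_monoidal]
    simp only [← tensorHom_comp_tensorHom, Category.assoc]
  rw [← key, tensorδ_tensorμ_assoc, ← comp_whiskerRight_assoc, tensorδ_tensorμ]
  simp

/-- The tensor product of duals is a dual of the tensor product. -/
abbrev tensor {A B : C} (D : DaggerDual A) (E : DaggerDual B) : DaggerDual (A ⊗ B) where
  dual := D.dual ⊗ E.dual
  η := tensorCup D E
  ε := tensorδ D.dual A E.dual B ≫ (D.ε ⊗ₘ E.ε) ≫ (λ_ (𝟙_ C)).hom
  ε_eq := by
    simp only [tensorCup, dag_comp, dag_tensor, dag_tensorμ, dag_leftUnitor_inv, Category.assoc]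
    rw [← Category.assoc (β_ _ _).hom, tensorδ_braiding, D.ε_eq, E.ε_eq]
    simp
  snake_left := by
    have h := tensorCup_coact D E
    rw [Iso.inv_comp_eq] at h
    have h1 : tensorμ A (D.dual ⊗ A) B (E.dual ⊗ B) ≫ (A ⊗ B) ◁ (D.ε ⊗ₘ E.ε) =
        (A ◁ D.ε ⊗ₘ B ◁ E.ε) ≫ tensorμ A (𝟙_ C) B (𝟙_ C) := by
      rw [← id_tensorHom, ← id_tensorHom_id, ← tensorμ_natural, id_tensorHom, id_tensorHom]
    have h2 : tensorμ A (𝟙_ C) B (𝟙_ C) ≫ (A ⊗ B) ◁ (λ_ (𝟙_ C)).hom =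
        ((ρ_ A).hom ⊗ₘ (ρ_ B).hom) ≫ (ρ_ (A ⊗ B)).inv := by
      rw [rightUnitor_monoidal]; simp
    rw [reassoc_of% h, ← MonoidalCategory.whiskerLeft_comp, tensorμ_tensorδ_assoc,
      MonoidalCategory.whiskerLeft_comp, reassoc_of% h1, h2, tensorHom_comp_tensorHom_assoc,
      tensorHom_comp_tensorHom_assoc, D.coact_ε, E.coact_ε]
    simp
  snake_right := by
    have h := tensorCup_act D E
    have h1 : (dag D.ε ⊗ₘ dag E.ε) ▷ (D.dual ⊗ E.dual) ≫
        tensorδ (D.dual ⊗ A) D.dual (E.dual ⊗ B) E.dual =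
          tensorδ (𝟙_ C) D.dual (𝟙_ C) E.dual ≫ (dag D.ε ▷ D.dual ⊗ₘ dag E.ε ▷ E.dual) := by
      rw [← tensorHom_id, ← id_tensorHom_id, tensorδ_natural, tensorHom_id, tensorHom_id]
    have h2 : (λ_ (𝟙_ C)).inv ▷ (D.dual ⊗ E.dual) ≫ tensorδ (𝟙_ C) D.dual (𝟙_ C) E.dual ≫
        ((λ_ D.dual).hom ⊗ₘ (λ_ E.dual).hom) = (λ_ (D.dual ⊗ E.dual)).hom := by
      rw [leftUnitor_monoidal]; simp
    have key : (λ_ (𝟙_ C)).inv ▷ (D.dual ⊗ E.dual) ≫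
        (dag D.ε ⊗ₘ dag E.ε) ▷ (D.dual ⊗ E.dual) ≫
        tensorμ D.dual A E.dual B ▷ (D.dual ⊗ E.dual) ≫
        (α_ (D.dual ⊗ E.dual) (A ⊗ B) (D.dual ⊗ E.dual)).hom ≫
        (D.dual ⊗ E.dual) ◁ dag (tensorCup D E) ≫ (ρ_ (D.dual ⊗ E.dual)).hom =
          (λ_ (D.dual ⊗ E.dual)).hom := by
      rw [h, ← comp_whiskerRight_assoc (tensorμ _ _ _ _), tensorμ_tensorδ, id_whiskerRight,
        Category.id_comp, reassoc_of% h1, tensorHom_comp_tensorHom, D.dag_ε_act, E.dag_ε_act, h2]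
    have := congrArg dag key
    simp only [dag_comp, dag_whiskerLeft, dag_whiskerRight, dag_associator, dag_rightUnitor,
      dag_leftUnitor, dag_leftUnitor_inv, dag_tensor, dag_dag, dag_tensorμ, Category.assoc] at this
    rw [Iso.inv_comp_eq] at this
    simp only [comp_whiskerRight]
    exact this

end DaggerDual

end Dual

section CPM

open DaggerCategory (dag dag_id dag_comp dag_dag)
open DaggerSymmetricMonoidal

variable (C : Type u) [Category.{v} C] [MonoidalCategory C] [SymmetricCategory C]
  [DaggerCategory C]

/-- Objects of `CPM C`: objects of `C` with a chosen dagger dual. -/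
structure CPM where
  as : C
  dual : DaggerDual as

namespace CPM

variable {C}

/-- The doubled object `A* ⊗ A`. -/
abbrev double (A : CPM C) : C := A.dual.dual ⊗ A.as

/-- A morphism `f : A* ⊗ A ⟶ B* ⊗ B` is completely positive when the endomorphism of `A ⊗ B*`
obtained from it by bending wires is positive; equivalently, `f = (id ⊗ ε ⊗ id) ∘ (k_* ⊗ k)` for
some `k : A ⟶ X ⊗ B`. -/
def IsCP {A B : CPM C} (f : A.double ⟶ B.double) : Prop :=
  Positive (choi A.dual.coact B.dual.act f)

variable [DaggerSymmetricMonoidal C]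

theorem IsCP.comp {A B D : CPM C} {f : A.double ⟶ B.double} {g : B.double ⟶ D.double}
    (hf : IsCP f) (hg : IsCP g) : IsCP (f ≫ g) :=
  positive_choi_comp (dag B.dual.ε) B.dual.snake hf hg

theorem choi_pure {A B : CPM C} (g : A.as ⟶ B.as) (g' : A.dual.dual ⟶ B.dual.dual) :
    choi A.dual.coact B.dual.act (g' ⊗ₘ g) =
      (g ▷ B.dual.dual ≫ dag B.dual.η) ≫ A.dual.η ≫ A.as ◁ g' := by
  calc
    _ = 𝟙 _ ⊗≫ ((A.dual.η ≫ A.as ◁ g') ▷ (A.as ⊗ B.dual.dual) ≫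
          (A.as ⊗ B.dual.dual) ◁ (g ▷ B.dual.dual ≫ dag B.dual.η)) ⊗≫ 𝟙 _ := by
      simp only [choi, DaggerDual.coact, DaggerDual.act, MonoidalCategory.tensorHom_def]
      monoidal
    _ = _ := by
      rw [← whisker_exchange]
      monoidal

theorem isCP_pure {A B : CPM C} (g : A.as ⟶ B.as) (g' : A.dual.dual ⟶ B.dual.dual)
    (h : A.dual.η ≫ A.as ◁ g' = B.dual.η ≫ dag g ▷ B.dual.dual) : IsCP (g' ⊗ₘ g) := by
  unfold IsCP
  rw [choi_pure, h]
  exact ⟨_, g ▷ B.dual.dual ≫ dag B.dual.η, by simp [dag_comp, dag_whiskerRight, dag_dag]⟩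

theorem isCP_pure_of_iso {A B : CPM C} (g : A.as ≅ B.as) (g' : A.dual.dual ≅ B.dual.dual)
    (hg : dag g.hom = g.inv) (h : A.dual.η ≫ (g.hom ⊗ₘ g'.hom) = B.dual.η) :
    IsCP (g'.hom ⊗ₘ g.hom) ∧ IsCP (g'.inv ⊗ₘ g.inv) := by
  constructor
  · apply isCP_pure
    rw [hg, ← h, Category.assoc, tensorHom_def', Category.assoc, hom_inv_whiskerRight,
      Category.comp_id]
  · apply isCP_pure
    have : dag g.inv = g.hom := by rw [← hg, dag_dag]
    rw [this, ← h, Category.assoc, MonoidalCategory.tensorHom_def, Category.assoc,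
      whiskerLeft_hom_inv, Category.comp_id]

theorem isCP_id (A : CPM C) : IsCP (𝟙 A.double) := by
  rw [← id_tensorHom_id]
  exact isCP_pure _ _ (by rw [dag_id]; simp)

instance : Category.{v} (CPM C) where
  Hom A B := { f : A.double ⟶ B.double // IsCP f }
  id A := ⟨𝟙 A.double, isCP_id A⟩
  comp f g := ⟨f.1 ≫ g.1, f.2.comp g.2⟩

variable (C) in
/-- The functor `A ↦ A* ⊗ A`. -/
def doubling : CPM C ⥤ C where
  obj A := A.double
  map f := f.1

instance : (doubling C).Faithful where
  map_injective h := Subtype.ext h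

theorem hom_ext {A B : CPM C} {f g : A ⟶ B} (h : f.1 = g.1) : f = g := Subtype.ext h

/-- The tensor product of objects. -/
abbrev tensorObj (A B : CPM C) : CPM C := ⟨A.as ⊗ B.as, A.dual.tensor B.dual⟩

theorem IsCP.tensor {A B A' B' : CPM C} {f : A.double ⟶ B.double} {g : A'.double ⟶ B'.double}
    (hf : IsCP f) (hg : IsCP g) :
    IsCP (A := tensorObj A A') (B := tensorObj B B')
      (tensorδ A.dual.dual A.as A'.dual.dual A'.as ≫ (f ⊗ₘ g) ≫
        tensorμ B.dual.dual B.as B'.dual.dual B'.as) := by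
  have h := positive_choi_tensor hf hg
  have e := choi_precomp (tensorObj A A').dual.coact (tensorObj B B').dual.act
    (tensorδ A.dual.dual A.as A'.dual.dual A'.as) (f ⊗ₘ g)
    (tensorμ B.dual.dual B.as B'.dual.dual B'.as)
  have e1 : (tensorObj A A').dual.coact ≫
      (A.as ⊗ A'.as) ◁ tensorδ A.dual.dual A.as A'.dual.dual A'.as =
        (A.dual.coact ⊗ₘ A'.dual.coact) ≫ tensorμ _ _ _ _ := by
    refine (congrArg (· ≫ _) (DaggerDual.tensorCup_coact A.dual A'.dual)).trans ?_
    rw [Category.assoc, Category.assoc, ← MonoidalCategory.whiskerLeft_comp, tensorμ_tensorδ,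
      MonoidalCategory.whiskerLeft_id, Category.comp_id]
  have e2 : tensorμ B.dual.dual B.as B'.dual.dual B'.as ▷ (B.dual.dual ⊗ B'.dual.dual) ≫
      (tensorObj B B').dual.act = tensorδ _ _ _ _ ≫ (B.dual.act ⊗ₘ B'.dual.act) := by
    refine (congrArg (_ ≫ ·) (DaggerDual.tensorCup_act B.dual B'.dual)).trans ?_
    rw [← comp_whiskerRight_assoc, tensorμ_tensorδ, id_whiskerRight, Category.id_comp]
  rw [← e1, ← e2, ← e] at h
  exact h

theorem cup_associator {A B D : C} (E : DaggerDual A) (F : DaggerDual B) (G : DaggerDual D) :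
    ((E.tensor F).tensor G).η ≫ ((α_ A B D).hom ⊗ₘ (α_ E.dual F.dual G.dual).hom) =
      (E.tensor (F.tensor G)).η := by
  change ((λ_ (𝟙_ C)).inv ≫ (((λ_ (𝟙_ C)).inv ≫ (E.η ⊗ₘ F.η) ≫ tensorμ A E.dual B F.dual) ⊗ₘ G.η)
    ≫ tensorμ (A ⊗ B) (E.dual ⊗ F.dual) D G.dual) ≫ _ = (λ_ (𝟙_ C)).inv ≫
      (E.η ⊗ₘ ((λ_ (𝟙_ C)).inv ≫ (F.η ⊗ₘ G.η) ≫ tensorμ B F.dual D G.dual)) ≫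
        tensorμ A E.dual (B ⊗ D) (F.dual ⊗ G.dual)
  have h1 : (((λ_ (𝟙_ C)).inv ≫ (E.η ⊗ₘ F.η) ≫ tensorμ A E.dual B F.dual) ⊗ₘ G.η) =
      (λ_ (𝟙_ C)).inv ▷ 𝟙_ C ≫ ((E.η ⊗ₘ F.η) ⊗ₘ G.η) ≫
        tensorμ A E.dual B F.dual ▷ (D ⊗ G.dual) := by
    simp only [← tensorHom_id, tensorHom_comp_tensorHom, Category.id_comp, Category.comp_id]
  have h2 : (E.η ⊗ₘ ((λ_ (𝟙_ C)).inv ≫ (F.η ⊗ₘ G.η) ≫ tensorμ B F.dual D G.dual)) =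
      𝟙_ C ◁ (λ_ (𝟙_ C)).inv ≫ (E.η ⊗ₘ F.η ⊗ₘ G.η) ≫
        (A ⊗ E.dual) ◁ tensorμ B F.dual D G.dual := by
    simp only [← id_tensorHom, tensorHom_comp_tensorHom, Category.id_comp, Category.comp_id]
  rw [h1, h2]
  simp only [Category.assoc]
  rw [tensor_associativity, associator_naturality_assoc]
  monoidal

theorem cup_leftUnitor {A : C} (E : DaggerDual A) :
    ((DaggerDual.unit (C := C)).tensor E).η ≫ ((λ_ A).hom ⊗ₘ (λ_ E.dual).hom) = E.η := by
  change ((λ_ (𝟙_ C)).inv ≫ ((λ_ (𝟙_ C)).inv ⊗ₘ E.η) ≫ tensorμ (𝟙_ C) (𝟙_ C) A E.dual) ≫ _ = _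
  have h := tensor_left_unitality A E.dual
  rw [Category.assoc, Category.assoc, tensorHom_def', Category.assoc, ← h]
  simp

theorem cup_rightUnitor {A : C} (E : DaggerDual A) :
    (E.tensor (DaggerDual.unit (C := C))).η ≫ ((ρ_ A).hom ⊗ₘ (ρ_ E.dual).hom) = E.η := by
  change ((λ_ (𝟙_ C)).inv ≫ (E.η ⊗ₘ (λ_ (𝟙_ C)).inv) ≫ tensorμ A E.dual (𝟙_ C) (𝟙_ C)) ≫ _ = _
  have h := tensor_right_unitality A E.dual
  have hh : (λ_ (𝟙_ C)).inv ≫ (ρ_ (𝟙_ C)).hom = 𝟙 _ := by rw [← unitors_equal]; simp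
  rw [Category.assoc, Category.assoc, MonoidalCategory.tensorHom_def, Category.assoc, ← h,
    rightUnitor_naturality, reassoc_of% hh]

instance : MonoidalCategoryStruct (CPM C) where
  tensorObj A B := tensorObj A B
  tensorHom f g := ⟨_, f.2.tensor g.2⟩
  whiskerLeft A _ _ g := ⟨_, (isCP_id A).tensor g.2⟩
  whiskerRight f B := ⟨_, f.2.tensor (isCP_id B)⟩
  tensorUnit := ⟨𝟙_ C, DaggerDual.unit⟩
  associator A B D :=
    have h := isCP_pure_of_iso (A := tensorObj (tensorObj A B) D)
      (B := tensorObj A (tensorObj B D)) (α_ A.as B.as D.as)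
      (α_ A.dual.dual B.dual.dual D.dual.dual) (dag_associator _ _ _) (cup_associator _ _ _)
    { hom := ⟨_, h.1⟩
      inv := ⟨_, h.2⟩
      hom_inv_id := hom_ext (Iso.hom_inv_id (α_ _ _ _ ⊗ᵢ α_ _ _ _))
      inv_hom_id := hom_ext (Iso.inv_hom_id (α_ _ _ _ ⊗ᵢ α_ _ _ _)) }
  leftUnitor A :=
    have h := isCP_pure_of_iso (A := tensorObj ⟨𝟙_ C, DaggerDual.unit⟩ A) (B := A) (λ_ A.as)
      (λ_ A.dual.dual) (dag_leftUnitor _) (cup_leftUnitor _)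
    { hom := ⟨_, h.1⟩
      inv := ⟨_, h.2⟩
      hom_inv_id := hom_ext (Iso.hom_inv_id (λ_ _ ⊗ᵢ λ_ _))
      inv_hom_id := hom_ext (Iso.inv_hom_id (λ_ _ ⊗ᵢ λ_ _)) }
  rightUnitor A :=
    have h := isCP_pure_of_iso (A := tensorObj A ⟨𝟙_ C, DaggerDual.unit⟩) (B := A) (ρ_ A.as)
      (ρ_ A.dual.dual) (dag_rightUnitor _) (cup_rightUnitor _)
    { hom := ⟨_, h.1⟩
      inv := ⟨_, h.2⟩
      hom_inv_id := hom_ext (Iso.hom_inv_id (ρ_ _ ⊗ᵢ ρ_ _))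
      inv_hom_id := hom_ext (Iso.inv_hom_id (ρ_ _ ⊗ᵢ ρ_ _)) }

theorem double_associator (A A' B B' D D' : C) :
    ((α_ A B D).hom ⊗ₘ (α_ A' B' D').hom) =
      tensorδ (A ⊗ B) (A' ⊗ B') D D' ≫ tensorδ A A' B B' ▷ (D ⊗ D') ≫
        (α_ (A ⊗ A') (B ⊗ B') (D ⊗ D')).hom ≫
          (A ⊗ A') ◁ tensorμ B B' D D' ≫ tensorμ A A' (B ⊗ D) (B' ⊗ D') := by
  rw [← tensor_associativity, ← comp_whiskerRight_assoc (tensorδ _ _ _ _), tensorδ_tensorμ,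
    id_whiskerRight, Category.id_comp, tensorδ_tensorμ_assoc]

theorem double_leftUnitor (A A' : C) :
    ((λ_ A).hom ⊗ₘ (λ_ A').hom) =
      tensorδ (𝟙_ C) (𝟙_ C) A A' ≫ (λ_ (𝟙_ C)).hom ▷ (A ⊗ A') ≫ (λ_ (A ⊗ A')).hom := by
  rw [tensor_left_unitality, ← comp_whiskerRight_assoc, Iso.hom_inv_id, id_whiskerRight,
    Category.id_comp, tensorδ_tensorμ_assoc]

theorem double_rightUnitor (A A' : C) :
    ((ρ_ A).hom ⊗ₘ (ρ_ A').hom) =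
      tensorδ A A' (𝟙_ C) (𝟙_ C) ≫ (A ⊗ A') ◁ (λ_ (𝟙_ C)).hom ≫ (ρ_ (A ⊗ A')).hom := by
  rw [tensor_right_unitality, ← MonoidalCategory.whiskerLeft_comp_assoc, Iso.hom_inv_id,
    MonoidalCategory.whiskerLeft_id, Category.id_comp, tensorδ_tensorμ_assoc]

/-- The isomorphism `(A* ⊗ A) ⊗ (B* ⊗ B) ≅ (A ⊗ B)* ⊗ (A ⊗ B)`. -/
def doublingIso (A B : CPM C) : A.double ⊗ B.double ≅ (A ⊗ B).double where
  hom := tensorμ _ _ _ _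
  inv := tensorδ _ _ _ _
  hom_inv_id := tensorμ_tensorδ _ _ _ _
  inv_hom_id := tensorδ_tensorμ _ _ _ _

instance : MonoidalCategory (CPM C) :=
  Monoidal.induced (doubling C)
    { μIso := doublingIso
      whiskerLeft_eq := fun A _ _ f => by
        rw [← id_tensorHom]; rfl
      whiskerRight_eq := fun f B => by
        rw [← tensorHom_id]; rfl
      tensorHom_eq := fun f g => rfl
      εIso := (λ_ (𝟙_ C)).symm
      associator_eq := fun A B D => by
        refine (double_associator _ _ _ _ _ _).trans ?_
        simp [doublingIso, doubling]
        try rfl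
      leftUnitor_eq := fun A => by
        refine (double_leftUnitor _ _).trans ?_
        simp only [Iso.trans_hom, Iso.symm_hom, tensorIso_hom, Iso.refl_hom, tensorHom_id,
          Category.assoc]
        rfl
      rightUnitor_eq := fun A => by
        refine (double_rightUnitor _ _).trans ?_
        simp [doublingIso, doubling]
        try rfl }

end CPM
end CPM

section CPMAdditive

open DaggerCategory (dag dag_id dag_comp dag_dag)
open DaggerSymmetricMonoidal
open Discarding (discard discard_unit)

section

variable {C : Type u} [Category.{v} C] [DaggerCategory C] [SemiAdditive C]
  [DaggerSemiAdditive C]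

theorem dag_zero (A B : C) : dag (0 : A ⟶ B) = 0 := by
  have h := DaggerSemiAdditive.dag_add (dag (0 : B ⟶ A)) (0 : A ⟶ B)
  rwa [add_zero, dag_dag, zero_add, eq_comm] at h

theorem positive_zero (A : C) : Positive (0 : A ⟶ A) :=
  ⟨A, 0, (SemiAdditive.zero_comp _).symm⟩

theorem Positive.add [HasDaggerBiproducts C] {A : C} {f g : A ⟶ A} (hf : Positive f)
    (hg : Positive g) : Positive (f + g) := by
  obtain ⟨B, h, rfl⟩ := hf
  obtain ⟨B', h', rfl⟩ := hg
  obtain ⟨S, κ, h1, h0, -⟩ := HasDaggerBiproducts.exists_biproduct 2 ![B, B']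
  have e0 : κ 0 ≫ dag (κ 0) = 𝟙 B := h1 0
  have e1 : κ 1 ≫ dag (κ 1) = 𝟙 B' := h1 1
  have e01 : κ 0 ≫ dag (κ 1) = 0 := h0 0 1 (by simp)
  have e10 : κ 1 ≫ dag (κ 0) = 0 := h0 1 0 (by simp)
  have key : ∀ (k : B ⟶ S) (k' : B' ⟶ S), k ≫ dag k = 𝟙 B → k' ≫ dag k' = 𝟙 B' →
      k ≫ dag k' = 0 → k' ≫ dag k = 0 →
      (h ≫ k + h' ≫ k') ≫ dag (h ≫ k + h' ≫ k') = h ≫ dag h + h' ≫ dag h' := by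
    intro k k' e0 e1 e01 e10
    simp only [DaggerSemiAdditive.dag_add, dag_comp, SemiAdditive.add_comp,
      SemiAdditive.comp_add, Category.assoc]
    rw [← Category.assoc k, ← Category.assoc k, ← Category.assoc k', ← Category.assoc k', e0, e1,
      e01, e10, SemiAdditive.zero_comp, SemiAdditive.zero_comp, SemiAdditive.comp_zero,
      SemiAdditive.comp_zero, Category.id_comp, Category.id_comp, add_zero, zero_add]
  exact ⟨S, _, (key (κ 0) (κ 1) e0 e1 e01 e10).symm⟩

end

section

variable {C : Type u} [Category.{v} C] [MonoidalCategory C] [SemiAdditive C]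
  [SemiAdditiveMonoidal C]

theorem choi_add {S T K L : C} (c : S ⟶ S ⊗ K) (m : L ⊗ T ⟶ T) (f g : K ⟶ L) :
    choi c m (f + g) = choi c m f + choi c m g := by
  simp only [choi]
  rw [← tensorHom_id (f + g), SemiAdditiveMonoidal.add_tensor, SemiAdditive.add_comp,
    ← id_tensorHom, SemiAdditiveMonoidal.tensor_add, SemiAdditive.comp_add,
    SemiAdditive.comp_add]
  simp only [tensorHom_id, id_tensorHom]

theorem choi_zero {S T K L : C} (c : S ⟶ S ⊗ K) (m : L ⊗ T ⟶ T) :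
    choi c m (0 : K ⟶ L) = 0 := by
  simp only [choi]
  rw [← tensorHom_id (0 : K ⟶ L), SemiAdditiveMonoidal.zero_tensor, SemiAdditive.zero_comp,
    ← id_tensorHom, SemiAdditiveMonoidal.tensor_zero, SemiAdditive.comp_zero,
    SemiAdditive.comp_zero]

end

namespace CPM

variable {C : Type u} [Category.{v} C] [MonoidalCategory C] [SymmetricCategory C]
  [DaggerCategory C] [DaggerSymmetricMonoidal C]

/-- Discarding in `CPM C` is given by the caps. -/
instance : Discarding (CPM C) where
  discard A := ⟨A.dual.ε ≫ (λ_ (𝟙_ C)).inv, by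
    have h : choi A.dual.coact (DaggerDual.unit (C := C)).act (A.dual.ε ≫ (λ_ (𝟙_ C)).inv) =
        𝟙 (A.as ⊗ 𝟙_ C) := by
      have h1 := A.dual.coact_ε
      have h2 : (λ_ (𝟙_ C)).inv ▷ 𝟙_ C ≫ (DaggerDual.unit (C := C)).act = (ρ_ (𝟙_ C)).hom := by
        simp only [DaggerDual.act, dag_leftUnitor_inv]
        monoidal
      have h3 := choi_precomp A.dual.coact (DaggerDual.unit (C := C)).act A.dual.ε (𝟙 _)
        (λ_ (𝟙_ C)).inv
      rw [Category.id_comp, h1, h2] at h3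
      rw [h3, choi]
      monoidal
    exact (congrArg Positive h).mpr (positive_id _)⟩
  discard_unit := hom_ext (Iso.hom_inv_id (λ_ (𝟙_ C)))

theorem discard_val (A : CPM C) : (discard A).1 = A.dual.ε ≫ (λ_ (𝟙_ C)).inv := rfl

instance : MonoidalDiscarding (CPM C) where
  discard_tensor A B := by
    apply hom_ext
    change (tensorδ A.dual.dual A.as B.dual.dual B.as ≫ (A.dual.ε ⊗ₘ B.dual.ε) ≫
      (λ_ (𝟙_ C)).hom) ≫ (λ_ (𝟙_ C)).inv =
      (tensorδ A.dual.dual A.as B.dual.dual B.as ≫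
        ((A.dual.ε ≫ (λ_ (𝟙_ C)).inv) ⊗ₘ (B.dual.ε ≫ (λ_ (𝟙_ C)).inv)) ≫
          tensorμ (𝟙_ C) (𝟙_ C) (𝟙_ C) (𝟙_ C)) ≫ ((λ_ (𝟙_ C)).hom ⊗ₘ (λ_ (𝟙_ C)).hom)
    have h := tensor_left_unitality (𝟙_ C) (𝟙_ C)
    have h1 : ((A.dual.ε ≫ (λ_ (𝟙_ C)).inv) ⊗ₘ (B.dual.ε ≫ (λ_ (𝟙_ C)).inv)) =
        (A.dual.ε ⊗ₘ B.dual.ε) ≫ 𝟙_ C ◁ (λ_ (𝟙_ C)).inv ≫ (λ_ (𝟙_ C)).inv ▷ _ := by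
      rw [← tensorHom_def', tensorHom_comp_tensorHom]
    rw [h1]
    simp only [Category.assoc]
    rw [← h]
    monoidal

section

variable [SemiAdditive C] [SemiAdditiveMonoidal C] [DaggerSemiAdditive C] [HasDaggerBiproducts C]

/-- Completely positive morphisms are closed under addition. -/
instance : SemiAdditive (CPM C) where
  homAddCommMonoid A B := inferInstanceAs (AddCommMonoid
    ({ carrier := { f : A.double ⟶ B.double | IsCP f }
       zero_mem' := by
        change Positive _
        rw [choi_zero]
        exact positive_zero _
       add_mem' := fun {f g} hf hg => by
        change Positive _
        rw [choi_add]
        exact Positive.add hf hg } : AddSubmonoid (A.double ⟶ B.double)))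
  add_comp f g h := hom_ext (SemiAdditive.add_comp _ _ _)
  comp_add f g h := hom_ext (SemiAdditive.comp_add _ _ _)
  zero_comp h := hom_ext (SemiAdditive.zero_comp _)
  comp_zero h := hom_ext (SemiAdditive.comp_zero _)

theorem add_val {A B : CPM C} (f g : A ⟶ B) : (f + g).1 = f.1 + g.1 := rfl

theorem zero_val (A B : CPM C) : (0 : A ⟶ B).1 = 0 := rfl

instance : SemiAdditiveMonoidal (CPM C) where
  tensor_add f g h := hom_ext (by
    change tensorδ _ _ _ _ ≫ (f.1 ⊗ₘ (g.1 + h.1)) ≫ tensorμ _ _ _ _ =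
      tensorδ _ _ _ _ ≫ (f.1 ⊗ₘ g.1) ≫ tensorμ _ _ _ _ +
        tensorδ _ _ _ _ ≫ (f.1 ⊗ₘ h.1) ≫ tensorμ _ _ _ _
    rw [SemiAdditiveMonoidal.tensor_add, SemiAdditive.add_comp, SemiAdditive.comp_add])
  add_tensor f g h := hom_ext (by
    change tensorδ _ _ _ _ ≫ ((f.1 + g.1) ⊗ₘ h.1) ≫ tensorμ _ _ _ _ =
      tensorδ _ _ _ _ ≫ (f.1 ⊗ₘ h.1) ≫ tensorμ _ _ _ _ +
        tensorδ _ _ _ _ ≫ (g.1 ⊗ₘ h.1) ≫ tensorμ _ _ _ _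
    rw [SemiAdditiveMonoidal.add_tensor, SemiAdditive.add_comp, SemiAdditive.comp_add])
  tensor_zero f := hom_ext (by
    change tensorδ _ _ _ _ ≫ (f.1 ⊗ₘ 0) ≫ tensorμ _ _ _ _ = 0
    rw [SemiAdditiveMonoidal.tensor_zero, SemiAdditive.zero_comp, SemiAdditive.comp_zero])
  zero_tensor f := hom_ext (by
    change tensorδ _ _ _ _ ≫ (0 ⊗ₘ f.1) ≫ tensorμ _ _ _ _ = 0
    rw [SemiAdditiveMonoidal.zero_tensor, SemiAdditive.zero_comp, SemiAdditive.comp_zero])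

end

end CPM

section SplitDagger

variable (C : Type u) [Category.{v} C] [MonoidalCategory C] [SymmetricCategory C]
  [DaggerCategory C] [DaggerSymmetricMonoidal C]

/-- The objects `(A, p)` with `p` a dagger idempotent; the dagger of `CPM C` is that of `C`. -/
def daggerIdempotents : ObjectProperty (SplitCausal (CPM C)) := fun P => dag P.obj.p.1 = P.obj.p.1

instance : (daggerIdempotents C).IsMonoidal where
  prop_unit := dag_id _
  prop_tensor P Q hP hQ := by
    change dag (tensorδ _ _ _ _ ≫ (P.obj.p.1 ⊗ₘ Q.obj.p.1) ≫ tensorμ _ _ _ _) =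
      tensorδ _ _ _ _ ≫ (P.obj.p.1 ⊗ₘ Q.obj.p.1) ≫ tensorμ _ _ _ _
    have hP' : dag P.obj.p.1 = P.obj.p.1 := hP
    have hQ' : dag Q.obj.p.1 = Q.obj.p.1 := hQ
    rw [dag_comp, dag_comp, dag_tensorδ, dag_tensorμ, dag_tensor, hP', hQ', Category.assoc]

/-- The category obtained by splitting the causal dagger idempotents of `CPM C`. -/
abbrev SplitDaggerCausal := (daggerIdempotents C).FullSubcategory

end SplitDagger

end CPMAdditive

section CPStar

open DaggerCategory (dag dag_id dag_comp dag_dag)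
open DaggerSymmetricMonoidal
open Discarding (discard discard_unit)

variable (C : Type u) [Category.{v} C] [MonoidalCategory C] [SymmetricCategory C]
  [DaggerCategory C]

/-- Objects of `CP* C`: symmetric special dagger Frobenius structures `δ : A ⟶ A ⊗ A`. -/
structure CPStar where
  as : C
  [comon : ComonObj as]
  frobenius : ComonObj.comul ▷ as ≫ (α_ as as as).hom ≫ as ◁ dag ComonObj.comul =
    as ◁ ComonObj.comul ≫ (α_ as as as).inv ≫ dag ComonObj.comul ▷ as
  special : ComonObj.comul ≫ dag ComonObj.comul = 𝟙 as
  symmetric : (β_ as as).hom ≫ dag ComonObj.comul ≫ ComonObj.counit =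
    dag ComonObj.comul ≫ ComonObj.counit

namespace CPStar

attribute [instance] CPStar.comon

variable {C}

/-- The comultiplication. -/
abbrev δ (A : CPStar C) : A.as ⟶ A.as ⊗ A.as := ComonObj.comul

/-- The counit. -/
abbrev ε (A : CPStar C) : A.as ⟶ 𝟙_ C := ComonObj.counit

/-- The multiplication `δ†`. -/
abbrev μ (A : CPStar C) : A.as ⊗ A.as ⟶ A.as := dag A.δ

/-- The condition on the morphisms of `CP* C`: the morphism
`(id ⊗ μ) ∘ (id ⊗ f ⊗ id) ∘ (δ ⊗ id)` is positive. -/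
def IsCP {A B : CPStar C} (f : A.as ⟶ B.as) : Prop := Positive (choi A.δ B.μ f)

variable [DaggerSymmetricMonoidal C]

theorem unit_μ (A : CPStar C) : A.as ◁ dag A.ε ≫ A.μ = (ρ_ A.as).hom := by
  have h := congrArg dag (ComonObj.comul_counit A.as)
  rwa [dag_comp, dag_whiskerLeft, dag_rightUnitor_inv] at h

theorem frobenius_left (A : CPStar C) :
    A.δ ▷ A.as ≫ (α_ A.as A.as A.as).hom ≫ A.as ◁ A.μ = A.μ ≫ A.δ := by
  have h1 : A.μ = (A.δ ▷ A.as ≫ (α_ A.as A.as A.as).hom ≫ A.as ◁ A.μ) ≫ A.as ◁ A.ε ≫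
      (ρ_ A.as).hom := by
    rw [A.frobenius]
    have := ComonObj.comul_counit A.as
    calc
      A.μ = A.as ◁ (A.δ ≫ A.as ◁ A.ε) ≫ (α_ _ _ _).inv ≫ (ρ_ _).hom ≫ A.μ := by
        rw [this]; monoidal
      _ = A.as ◁ A.δ ≫ (α_ _ _ _).inv ≫ ((A.as ⊗ A.as) ◁ A.ε ≫ A.μ ▷ _) ≫ (ρ_ _).hom := by
        monoidal
      _ = _ := by
        rw [whisker_exchange]; simp
  symm
  calc
    A.μ ≫ A.δ = A.δ ▷ A.as ≫ (α_ _ _ _).hom ≫ A.as ◁ (A.μ ≫ A.ε) ≫ (ρ_ _).hom ≫ A.δ := by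
      conv_lhs => rw [h1]
      monoidal
    _ = A.δ ▷ A.as ≫ (α_ _ _ _).hom ≫ (A.as ◁ (A.μ ≫ A.ε) ≫ A.δ ▷ _) ≫ (ρ_ _).hom := by
      monoidal
    _ = (A.δ ≫ A.δ ▷ A.as ≫ (α_ _ _ _).hom) ▷ A.as ≫ 𝟙 _ ⊗≫ A.as ◁ A.as ◁ (A.μ ≫ A.ε) ⊗≫
          𝟙 _ := by
      rw [whisker_exchange]; monoidal
    _ = A.δ ▷ A.as ≫ (α_ _ _ _).hom ≫ A.as ◁ ((A.δ ▷ A.as ≫ (α_ A.as A.as A.as).hom ≫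
          A.as ◁ A.μ) ≫ A.as ◁ A.ε ≫ (ρ_ A.as).hom) := by
      rw [← ComonObj.comul_assoc]
      monoidal
    _ = _ := by rw [← h1]

theorem frobenius_right (A : CPStar C) :
    A.as ◁ A.δ ≫ (α_ A.as A.as A.as).inv ≫ A.μ ▷ A.as = A.μ ≫ A.δ := by
  rw [← A.frobenius_left]; exact A.frobenius.symm

theorem choi_id (A : CPStar C) : choi A.δ A.μ (𝟙 A.as) = A.μ ≫ A.δ := by
  rw [← A.frobenius_left]; simp [choi]

theorem isCP_id (A : CPStar C) : IsCP (𝟙 A.as) := by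
  unfold IsCP
  rw [choi_id]
  exact ⟨_, A.μ, by rw [dag_dag]⟩

theorem snake (A : CPStar C) :
    (ρ_ A.as).inv ≫ A.as ◁ (dag A.ε ≫ A.δ) ≫ (α_ A.as A.as A.as).inv ≫ A.μ ▷ A.as ≫
      A.as ◁ A.δ ≫ (α_ A.as A.as A.as).inv ≫ dag (dag A.ε ≫ A.δ) ▷ A.as ≫ (λ_ A.as).hom =
        𝟙 A.as := by
  have h1 := A.frobenius_right
  have h2 : A.δ ≫ A.ε ▷ A.as = (λ_ A.as).inv := ComonObj.counit_comul A.as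
  rw [dag_comp, dag_dag]
  simp only [MonoidalCategory.whiskerLeft_comp, comp_whiskerRight, Category.assoc]
  rw [reassoc_of% h1, reassoc_of% h1, reassoc_of% A.unit_μ, reassoc_of% A.special, reassoc_of% h2]
  simp

theorem IsCP.comp {A B D : CPStar C} {f : A.as ⟶ B.as} {g : B.as ⟶ D.as} (hf : IsCP f)
    (hg : IsCP g) : IsCP (f ≫ g) :=
  positive_choi_comp (dag B.ε ≫ B.δ) B.snake hf hg

theorem isCP_of_unitary {A B : CPStar C} (φ : A.as ≅ B.as) (h : dag φ.hom = φ.inv)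
    (hδ : A.δ ≫ (φ.hom ⊗ₘ φ.hom) = φ.hom ≫ B.δ) : IsCP φ.hom := by
  have h1 : A.δ ≫ A.as ◁ φ.hom = φ.hom ≫ B.δ ≫ φ.inv ▷ B.as := by
    rw [← reassoc_of% hδ, MonoidalCategory.tensorHom_def', Category.assoc, hom_inv_whiskerRight,
      Category.comp_id]
  have h2 : choi A.δ B.μ φ.hom = φ.hom ▷ B.as ≫ choi B.δ B.μ (𝟙 B.as) ≫ dag (φ.hom ▷ B.as) := by
    rw [dag_whiskerRight, h]
    calc
      choi A.δ B.μ φ.hom = (A.δ ≫ A.as ◁ φ.hom) ▷ B.as ≫ (α_ _ _ _).hom ≫ A.as ◁ B.μ := by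
        simp [choi]
      _ = φ.hom ▷ B.as ≫ B.δ ▷ B.as ≫ 𝟙 _ ⊗≫ (φ.inv ▷ (B.as ⊗ B.as) ≫ A.as ◁ B.μ) := by
        rw [h1]; monoidal
      _ = _ := by
        rw [← whisker_exchange]; simp only [choi]; monoidal
  unfold IsCP
  rw [h2]
  exact Positive.conj B.isCP_id _

theorem isCP_inv_of_unitary {A B : CPStar C} (φ : A.as ≅ B.as) (h : dag φ.hom = φ.inv)
    (hδ : A.δ ≫ (φ.hom ⊗ₘ φ.hom) = φ.hom ≫ B.δ) : IsCP φ.inv := by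
  refine isCP_of_unitary φ.symm (by simp [← h, dag_dag]) ?_
  change B.δ ≫ (φ.inv ⊗ₘ φ.inv) = φ.inv ≫ A.δ
  rw [Iso.eq_inv_comp, ← reassoc_of% hδ, tensorHom_comp_tensorHom]
  simp

instance : Category.{v} (CPStar C) where
  Hom A B := { f : A.as ⟶ B.as // IsCP f }
  id A := ⟨𝟙 A.as, isCP_id A⟩
  comp f g := ⟨f.1 ≫ g.1, f.2.comp g.2⟩

variable (C) in
/-- The underlying object. -/
def forget : CPStar C ⥤ C where
  obj A := A.as
  map f := f.1

instance : (forget C).Faithful where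
  map_injective h := Subtype.ext h

theorem hom_ext {A B : CPStar C} {f g : A ⟶ B} (h : f.1 = g.1) : f = g := Subtype.ext h

theorem dag_comul_tensor (A B : CPStar C) :
    dag (ComonObj.comul (X := A.as ⊗ B.as)) =
      tensorδ A.as A.as B.as B.as ≫ (A.μ ⊗ₘ B.μ) := by
  rw [Comon.tensorObj_comul, dag_comp, dag_tensorμ, dag_tensor]

theorem choi_id_tensor (A B : CPStar C) :
    choi (ComonObj.comul (X := A.as ⊗ B.as)) (dag (ComonObj.comul (X := A.as ⊗ B.as))) (𝟙 _) =
      dag (ComonObj.comul (X := A.as ⊗ B.as)) ≫ ComonObj.comul (X := A.as ⊗ B.as) := by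
  rw [dag_comul_tensor, Comon.tensorObj_comul, ← id_tensorHom_id, choi_tensor, choi_id, choi_id]
  simp

theorem frobenius_of_choi_id {A : C} [ComonObj A]
    (h : choi (ComonObj.comul (X := A)) (dag ComonObj.comul) (𝟙 A) =
      dag ComonObj.comul ≫ ComonObj.comul) :
    (ComonObj.comul (X := A)) ▷ A ≫ (α_ A A A).hom ≫ A ◁ dag ComonObj.comul =
      A ◁ ComonObj.comul ≫ (α_ A A A).inv ≫ dag ComonObj.comul ▷ A := by
  simp only [choi, id_whiskerRight, Category.id_comp] at h
  have h' := congrArg dag h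
  simp only [dag_comp, dag_whiskerLeft, dag_whiskerRight, dag_associator, dag_dag,
    Category.assoc] at h'
  rw [h, h']

theorem dag_comul_comp_counit_tensor (A B : CPStar C) :
    dag (ComonObj.comul (X := A.as ⊗ B.as)) ≫ ComonObj.counit (X := A.as ⊗ B.as) =
      tensorδ A.as A.as B.as B.as ≫ ((A.μ ≫ A.ε) ⊗ₘ (B.μ ≫ B.ε)) ≫ (λ_ (𝟙_ C)).hom := by
  rw [dag_comul_tensor, Comon.tensorObj_counit]
  simp

/-- The tensor product of Frobenius structures. -/
abbrev tensorObj (A B : CPStar C) : CPStar C where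
  as := A.as ⊗ B.as
  frobenius := frobenius_of_choi_id (choi_id_tensor A B)
  special := by
    rw [dag_comul_tensor, Comon.tensorObj_comul, Category.assoc, tensorμ_tensorδ_assoc,
      tensorHom_comp_tensorHom, A.special, B.special, id_tensorHom_id]
  symmetric := by
    rw [dag_comul_comp_counit_tensor, ← Category.assoc, tensorδ_braiding, Category.assoc,
      tensorHom_comp_tensorHom_assoc, A.symmetric, B.symmetric]

theorem δ_tensor (A B : CPStar C) :
    (tensorObj A B).δ = (A.δ ⊗ₘ B.δ) ≫ tensorμ A.as A.as B.as B.as :=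
  Comon.tensorObj_comul _ _

variable (C) in
/-- The trivial Frobenius structure on the tensor unit. -/
abbrev unit : CPStar C :=
  letI := ComonObj.instTensorUnit C
  { as := 𝟙_ C
    frobenius := by
      apply frobenius_of_choi_id
      rw [ComonObj.instTensorUnit_comul, dag_leftUnitor_inv, choi]
      monoidal
    special := by
      rw [ComonObj.instTensorUnit_comul, dag_leftUnitor_inv]
      simp
    symmetric := by
      rw [ComonObj.instTensorUnit_comul, dag_leftUnitor_inv, braiding_tensorUnit_left,
        unitors_equal]
      simp }

theorem IsCP.tensor {A B A' B' : CPStar C} {f : A.as ⟶ B.as} {g : A'.as ⟶ B'.as}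
    (hf : IsCP f) (hg : IsCP g) :
    IsCP (A := tensorObj A A') (B := tensorObj B B') (f ⊗ₘ g) := by
  have h := positive_choi_tensor hf hg
  rw [← δ_tensor, ← dag_comul_tensor] at h
  exact h

theorem δ_associator (A B D : CPStar C) :
    (tensorObj (tensorObj A B) D).δ ≫ ((α_ A.as B.as D.as).hom ⊗ₘ (α_ A.as B.as D.as).hom) =
      (α_ A.as B.as D.as).hom ≫ (tensorObj A (tensorObj B D)).δ := by
  rw [δ_tensor, δ_tensor, δ_tensor, δ_tensor]
  have h1 : (((A.δ ⊗ₘ B.δ) ≫ tensorμ A.as A.as B.as B.as) ⊗ₘ D.δ) =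
      ((A.δ ⊗ₘ B.δ) ⊗ₘ D.δ) ≫ tensorμ A.as A.as B.as B.as ▷ (D.as ⊗ D.as) := by
    simp only [← tensorHom_id, tensorHom_comp_tensorHom, Category.comp_id]
  have h2 : (A.δ ⊗ₘ ((B.δ ⊗ₘ D.δ) ≫ tensorμ B.as B.as D.as D.as)) =
      (A.δ ⊗ₘ B.δ ⊗ₘ D.δ) ≫ (A.as ⊗ A.as) ◁ tensorμ B.as B.as D.as D.as := by
    simp only [← id_tensorHom, tensorHom_comp_tensorHom, Category.comp_id]
  rw [h1, h2, Category.assoc, Category.assoc, tensor_associativity, associator_naturality_assoc,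
    Category.assoc]

theorem δ_leftUnitor (A : CPStar C) :
    (tensorObj (unit C) A).δ ≫ ((λ_ A.as).hom ⊗ₘ (λ_ A.as).hom) = (λ_ A.as).hom ≫ A.δ := by
  have h := tensor_left_unitality A.as A.as
  rw [δ_tensor]
  change (((λ_ (𝟙_ C)).inv ⊗ₘ A.δ) ≫ tensorμ (𝟙_ C) (𝟙_ C) A.as A.as) ≫ _ = _
  rw [tensorHom_def', Category.assoc, Category.assoc, ← h, leftUnitor_naturality]

theorem δ_rightUnitor (A : CPStar C) :
    (tensorObj A (unit C)).δ ≫ ((ρ_ A.as).hom ⊗ₘ (ρ_ A.as).hom) = (ρ_ A.as).hom ≫ A.δ := by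
  have h := tensor_right_unitality A.as A.as
  rw [δ_tensor]
  change ((A.δ ⊗ₘ (λ_ (𝟙_ C)).inv) ≫ tensorμ A.as A.as (𝟙_ C) (𝟙_ C)) ≫ _ = _
  rw [MonoidalCategory.tensorHom_def, Category.assoc, Category.assoc, ← h, rightUnitor_naturality]

/-- An isomorphism of `CP* C` from a unitary isomorphism of comonoids. -/
abbrev isoOfUnitary {A B : CPStar C} (φ : A.as ≅ B.as) (h : dag φ.hom = φ.inv)
    (hδ : A.δ ≫ (φ.hom ⊗ₘ φ.hom) = φ.hom ≫ B.δ) : A ≅ B where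
  hom := ⟨φ.hom, isCP_of_unitary φ h hδ⟩
  inv := ⟨φ.inv, isCP_inv_of_unitary φ h hδ⟩
  hom_inv_id := hom_ext φ.hom_inv_id
  inv_hom_id := hom_ext φ.inv_hom_id

instance : MonoidalCategoryStruct (CPStar C) where
  tensorObj A B := tensorObj A B
  tensorHom f g := ⟨f.1 ⊗ₘ g.1, f.2.tensor g.2⟩
  whiskerLeft A _ _ g := ⟨𝟙 A.as ⊗ₘ g.1, (isCP_id A).tensor g.2⟩
  whiskerRight f B := ⟨f.1 ⊗ₘ 𝟙 B.as, f.2.tensor (isCP_id B)⟩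
  tensorUnit := unit C
  associator A B D := isoOfUnitary (A := tensorObj (tensorObj A B) D)
    (B := tensorObj A (tensorObj B D)) (α_ A.as B.as D.as) (dag_associator _ _ _)
    (δ_associator A B D)
  leftUnitor A := isoOfUnitary (A := tensorObj (unit C) A) (B := A) (λ_ A.as)
    (dag_leftUnitor _) (δ_leftUnitor A)
  rightUnitor A := isoOfUnitary (A := tensorObj A (unit C)) (B := A) (ρ_ A.as)
    (dag_rightUnitor _) (δ_rightUnitor A)

instance : MonoidalCategory (CPStar C) :=
  Monoidal.induced (forget C)
    { μIso := fun A B => Iso.refl (A.as ⊗ B.as)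
      whiskerLeft_eq := fun A B D f => by
        change 𝟙 A.as ⊗ₘ f.1 = 𝟙 (A.as ⊗ B.as) ≫ A.as ◁ f.1 ≫ 𝟙 (A.as ⊗ D.as)
        simp
      whiskerRight_eq := fun {B D} f A => by
        change f.1 ⊗ₘ 𝟙 A.as = 𝟙 (B.as ⊗ A.as) ≫ f.1 ▷ A.as ≫ 𝟙 (D.as ⊗ A.as)
        simp
      tensorHom_eq := fun {A B A' B'} f g => by
        change f.1 ⊗ₘ g.1 = 𝟙 (A.as ⊗ A'.as) ≫ (f.1 ⊗ₘ g.1) ≫ 𝟙 (B.as ⊗ B'.as)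
        simp
      εIso := Iso.refl (𝟙_ C)
      associator_eq := fun A B D => by
        change (α_ A.as B.as D.as).hom = (𝟙 ((A.as ⊗ B.as) ⊗ D.as) ≫
          (𝟙 (A.as ⊗ B.as) ⊗ₘ 𝟙 D.as)) ≫ (α_ A.as B.as D.as).hom ≫
            (𝟙 A.as ⊗ₘ 𝟙 (B.as ⊗ D.as)) ≫ 𝟙 (A.as ⊗ B.as ⊗ D.as)
        simp
      leftUnitor_eq := fun A => by
        change (λ_ A.as).hom = (𝟙 (𝟙_ C ⊗ A.as) ≫ (𝟙 (𝟙_ C) ⊗ₘ 𝟙 A.as)) ≫ (λ_ A.as).hom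
        simp
      rightUnitor_eq := fun A => by
        change (ρ_ A.as).hom = (𝟙 (A.as ⊗ 𝟙_ C) ≫ (𝟙 A.as ⊗ₘ 𝟙 (𝟙_ C))) ≫ (ρ_ A.as).hom
        simp }

theorem choi_counit (A : CPStar C) : choi A.δ (unit C).μ A.ε = 𝟙 (A.as ⊗ 𝟙_ C) := by
  have h1 : A.δ ≫ A.as ◁ A.ε = (ρ_ A.as).inv := ComonObj.comul_counit A.as
  have h2 : (unit C).μ = (λ_ (𝟙_ C)).hom := dag_leftUnitor_inv _
  have h3 := choi_precomp A.δ (unit C).μ A.ε (𝟙 _) (𝟙 _)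
  rw [Category.id_comp, Category.comp_id, h1, id_whiskerRight, Category.id_comp] at h3
  rw [h3, h2, choi]
  monoidal

/-- Discarding in `CP* C` is given by the counits. -/
instance : Discarding (CPStar C) where
  discard A := ⟨A.ε, (congrArg Positive A.choi_counit).mpr (positive_id _)⟩
  discard_unit := rfl

theorem discard_val (A : CPStar C) : (discard A).1 = A.ε := rfl

instance : MonoidalDiscarding (CPStar C) where
  discard_tensor A B := hom_ext (Comon.tensorObj_counit A.as B.as)

end CPStar
end CPStar

section CPStarToSplit

open DaggerCategory (dag dag_id dag_comp dag_dag)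
open DaggerSymmetricMonoidal
open Discarding (discard discard_unit)

namespace CPStar

variable {C : Type u} [Category.{v} C] [MonoidalCategory C] [SymmetricCategory C]
  [DaggerCategory C] [DaggerSymmetricMonoidal C]

theorem μ_unit (A : CPStar C) : dag A.ε ▷ A.as ≫ A.μ = (λ_ A.as).hom := by
  have h := congrArg dag (ComonObj.counit_comul A.as)
  rwa [dag_comp, dag_whiskerRight, dag_leftUnitor_inv] at h

theorem cup_μ (A : CPStar C) :
    (dag A.ε ≫ A.δ) ▷ A.as ≫ (α_ A.as A.as A.as).hom ≫ A.as ◁ A.μ = (λ_ A.as).hom ≫ A.δ := by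
  rw [comp_whiskerRight, Category.assoc, A.frobenius_left, reassoc_of% A.μ_unit]

theorem cup_δ (A : CPStar C) :
    A.as ◁ (dag A.ε ≫ A.δ) ≫ (α_ A.as A.as A.as).inv ≫ A.μ ▷ A.as = (ρ_ A.as).hom ≫ A.δ := by
  rw [MonoidalCategory.whiskerLeft_comp, Category.assoc, A.frobenius_right,
    reassoc_of% A.unit_μ]

/-- A Frobenius structure makes `A` its own dagger dual. -/
abbrev selfDual (A : CPStar C) : DaggerDual A.as where
  dual := A.as
  η := dag A.ε ≫ A.δ
  ε := A.μ ≫ A.ε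
  ε_eq := by rw [dag_comp, dag_dag]; exact A.symmetric.symm
  snake_left := by
    have h1 := A.cup_μ
    have h2 : A.δ ≫ A.as ◁ A.ε = (ρ_ A.as).inv := ComonObj.comul_counit A.as
    rw [MonoidalCategory.whiskerLeft_comp, reassoc_of% h1, h2]
  snake_right := by
    have h1 := A.cup_δ
    have h2 : A.δ ≫ A.ε ▷ A.as = (λ_ A.as).inv := ComonObj.counit_comul A.as
    rw [comp_whiskerRight, reassoc_of% h1, h2]

/-- The underlying object, as an object of `CPM C`. -/
abbrev toCPM (A : CPStar C) : CPM C := ⟨A.as, A.selfDual⟩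

theorem isCP_sandwich {A B : CPStar C} {f : A.as ⟶ B.as} (hf : IsCP f) :
    CPM.IsCP (A := A.toCPM) (B := B.toCPM) (A.μ ≫ f ≫ B.δ) := by
  have h1 : A.selfDual.coact ≫ A.as ◁ A.μ = A.δ := by
    have h := A.cup_μ
    simp only [DaggerDual.coact, Category.assoc]
    rw [h, Iso.inv_hom_id_assoc]
  have h2 : B.δ ▷ B.as ≫ B.selfDual.act = B.μ := by
    have h := congrArg dag B.cup_δ
    simp only [dag_comp, dag_whiskerLeft, dag_whiskerRight, dag_associator_inv, dag_dag,
      dag_rightUnitor, Category.assoc] at h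
    simp only [DaggerDual.act, dag_comp, dag_dag]
    rw [reassoc_of% h]
    simp
  have h := choi_precomp A.selfDual.coact B.selfDual.act A.μ f B.δ
  rw [h1, h2] at h
  exact (congrArg Positive h).mpr hf

variable (C) in
/-- The functor sending `(A, δ)` to the idempotent `δ ∘ μ` on `A` and `f` to `δ ∘ f ∘ μ`. -/
def toKaroubi : CPStar C ⥤ Idempotents.Karoubi (CPM C) where
  obj A :=
    { X := A.toCPM
      p := ⟨A.μ ≫ 𝟙 A.as ≫ A.δ, isCP_sandwich A.isCP_id⟩
      idem := CPM.hom_ext (by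
        change (A.μ ≫ 𝟙 A.as ≫ A.δ) ≫ A.μ ≫ 𝟙 A.as ≫ A.δ = A.μ ≫ 𝟙 A.as ≫ A.δ
        simp [reassoc_of% A.special]) }
  map {A B} f :=
    { f := ⟨A.μ ≫ f.1 ≫ B.δ, isCP_sandwich f.2⟩
      comm := CPM.hom_ext (by
        change (A.μ ≫ 𝟙 A.as ≫ A.δ) ≫ (A.μ ≫ f.1 ≫ B.δ) ≫ B.μ ≫ 𝟙 B.as ≫ B.δ =
          A.μ ≫ f.1 ≫ B.δ
        simp [reassoc_of% A.special, reassoc_of% B.special]) }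
  map_comp {A B D} f g := Idempotents.Karoubi.hom_ext _ _ (CPM.hom_ext (by
    change A.μ ≫ (f.1 ≫ g.1) ≫ D.δ = (A.μ ≫ f.1 ≫ B.δ) ≫ B.μ ≫ g.1 ≫ D.δ
    simp [reassoc_of% B.special]))

variable (C) in
/-- The embedding of `CP* C` in the category of causal dagger idempotents of `CPM C`. -/
def toSplitDagger : CPStar C ⥤ SplitDaggerCausal C :=
  (daggerIdempotents C).lift
    ((causalIdempotents (CPM C)).lift (toKaroubi C) fun A => CPM.hom_ext (by
      change (A.μ ≫ 𝟙 A.as ≫ A.δ) ≫ (A.μ ≫ A.ε) ≫ (λ_ (𝟙_ C)).inv =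
        (A.μ ≫ A.ε) ≫ (λ_ (𝟙_ C)).inv
      simp [reassoc_of% A.special]))
    fun A => by
      change dag (A.μ ≫ 𝟙 A.as ≫ A.δ) = A.μ ≫ 𝟙 A.as ≫ A.δ
      simp [dag_comp, dag_dag]

end CPStar

end CPStarToSplit

open scoped ComplexOrder TensorProduct CStarAlgebra

section Trace

variable {A : Type*} [CStarAlgebra A]

theorem spectrum_star_mul_self_complex_nonneg (y : A) {z : ℂ} (hz : z ∈ spectrum ℂ (star y * y)) :
    0 ≤ z := by
  have h := (IsSelfAdjoint.star_mul_self y).mem_spectrum_eq_re hz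
  have h2 : z.re ∈ spectrum ℝ (star y * y) := by
    rw [h] at hz
    exact spectrum.of_algebraMap_mem ℂ hz
  rw [h]
  exact_mod_cast spectrum_star_mul_self_nonneg _ h2

variable {V : Type*} [AddCommGroup V] [Module ℂ V] [FiniteDimensional ℂ V]

theorem roots_charpoly_nonneg (π : A →ₐ[ℂ] Module.End ℂ V) (y : A) {z : ℂ}
    (hz : z ∈ (π (star y * y)).charpoly.roots) : 0 ≤ z := by
  have h : z ∈ spectrum ℂ (π (star y * y)) := by
    rw [← Module.End.hasEigenvalue_iff_mem_spectrum, Module.End.hasEigenvalue_iff_isRoot_charpoly]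
    exact (Polynomial.mem_roots'.1 hz).2
  exact spectrum_star_mul_self_complex_nonneg y (AlgHom.spectrum_apply_subset π _ h)

theorem trace_rep_nonneg (π : A →ₐ[ℂ] Module.End ℂ V) (y : A) :
    0 ≤ LinearMap.trace ℂ V (π (star y * y)) := by
  rw [Module.End.trace_eq_sum_roots_charpoly_of_splits (IsAlgClosed.splits _)]
  exact Multiset.sum_nonneg fun z hz => roots_charpoly_nonneg π y hz

theorem isNilpotent_of_trace_rep_eq_zero (π : A →ₐ[ℂ] Module.End ℂ V) (y : A)
    (h : LinearMap.trace ℂ V (π (star y * y)) = 0) : IsNilpotent (π (star y * y)) := by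
  rw [Module.End.trace_eq_sum_roots_charpoly_of_splits (IsAlgClosed.splits _)] at h
  have h0 : ∀ z ∈ (π (star y * y)).charpoly.roots, z = 0 := by
    have key : ∀ s : Multiset ℂ, (∀ z ∈ s, 0 ≤ z) → s.sum = 0 → ∀ z ∈ s, z = 0 := by
      intro s hs h z hz
      obtain ⟨t, rfl⟩ := Multiset.exists_cons_of_mem hz
      rw [Multiset.sum_cons] at h
      have h1 := hs z (Multiset.mem_cons_self z t)
      have h2 : 0 ≤ t.sum := Multiset.sum_nonneg fun w hw => hs w (Multiset.mem_cons_of_mem hw)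
      exact ((add_eq_zero_iff_of_nonneg h1 h2).1 h).1
    exact key _ (fun z hz => roots_charpoly_nonneg π y hz) h
  have h1 : ∃ n : ℕ, (π (star y * y)).charpoly = Polynomial.X ^ n := by
    have h2 := (IsAlgClosed.splits (π (star y * y)).charpoly).eq_prod_roots_of_monic
      (LinearMap.charpoly_monic _)
    rw [Multiset.eq_replicate_of_mem h0] at h2
    exact ⟨_, by simpa using h2⟩
  obtain ⟨n, h1⟩ := h1
  have h2 := LinearMap.aeval_self_charpoly (π (star y * y))
  rw [h1, map_pow, Polynomial.aeval_X] at h2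
  exact ⟨n, h2⟩

theorem eq_zero_of_isNilpotent_star_mul_self {y : A} (h : IsNilpotent (star y * y)) : y = 0 := by
  obtain ⟨n, hn⟩ := h
  have h1 : (star y * y) ^ (2 ^ n) = 0 := pow_eq_zero_of_le (Nat.lt_two_pow_self).le hn
  have h2 := (IsSelfAdjoint.star_mul_self y).nnnorm_pow_two_pow n
  rw [h1, nnnorm_zero] at h2
  have h3 : star y * y = 0 := by
    have := pow_eq_zero_iff (by positivity) |>.1 h2.symm
    simpa using this
  exact CStarRing.star_mul_self_eq_zero_iff y |>.1 h3

variable (A) in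
theorem isSemisimpleRing_of_finiteDimensional [FiniteDimensional ℂ A] : IsSemisimpleRing A := by
  have : IsArtinianRing A := IsArtinianRing.of_finite ℂ A
  rw [IsArtinianRing.isSemisimpleRing_iff_jacobson, eq_bot_iff]
  intro y hy
  obtain ⟨n, hn⟩ := IsSemiprimaryRing.isNilpotent (R := A)
  refine eq_zero_of_isNilpotent_star_mul_self ⟨n, ?_⟩
  have h1 : (star y * y) ^ n ∈ Ring.jacobson A ^ n :=
    Ideal.pow_mem_pow (Ideal.mul_mem_left _ _ hy) n
  rw [hn] at h1
  exact h1

end Trace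

section Functional

variable {A : Type*} [CStarAlgebra A]

theorem isSelfAdjoint_map_of_positive {φ : A →ₗ[ℂ] ℂ} (hφ : ∀ y, 0 ≤ φ (star y * y)) {z : A}
    (hz : IsSelfAdjoint z) : starRingEnd ℂ (φ z) = φ z := by
  have h1 : (4 : ℂ) * φ z = φ (star (z + 1) * (z + 1)) - φ (star (z - 1) * (z - 1)) := by
    rw [← map_sub, ← smul_eq_mul, ← map_smul]
    congr 1
    have : (4 : ℂ) • z = (4 : ℕ) • z := by rw [← Nat.cast_smul_eq_nsmul ℂ]; norm_num
    simp only [star_add, star_sub, star_one, hz.star_eq, this]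
    noncomm_ring
  have h2 : ∀ y, starRingEnd ℂ (φ (star y * y)) = φ (star y * y) := fun y =>
    (IsSelfAdjoint.of_nonneg (hφ y)).star_eq
  have h3 := congrArg (starRingEnd ℂ) h1
  rw [map_sub, h2, h2, ← h1, map_mul, map_ofNat] at h3
  exact mul_left_cancel₀ (by norm_num) h3

theorem map_star_of_positive {φ : A →ₗ[ℂ] ℂ} (hφ : ∀ y, 0 ≤ φ (star y * y)) (z : A) :
    φ (star z) = starRingEnd ℂ (φ z) := by
  have hz := realPart_add_I_smul_imaginaryPart z
  conv_rhs => rw [← hz]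
  conv_lhs => rw [← hz]
  have h1 := isSelfAdjoint_map_of_positive hφ (realPart z).2
  have h2 := isSelfAdjoint_map_of_positive hφ (imaginaryPart z).2
  simp [h1, h2, (realPart z).2.star_eq, (imaginaryPart z).2.star_eq]

end Functional

section RegularTrace

variable (A : Type*) [CStarAlgebra A] [FiniteDimensional ℂ A]

/-- The trace of the left regular representation. -/
noncomputable def regularTrace : A →ₗ[ℂ] ℂ :=
  LinearMap.trace ℂ A ∘ₗ (Algebra.lmul ℂ A).toLinearMap

variable {A}

theorem regularTrace_nonneg (y : A) : 0 ≤ regularTrace A (star y * y) :=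
  trace_rep_nonneg (Algebra.lmul ℂ A) y

theorem regularTrace_definite {y : A} (h : regularTrace A (star y * y) = 0) : y = 0 := by
  apply eq_zero_of_isNilpotent_star_mul_self
  obtain ⟨n, hn⟩ := isNilpotent_of_trace_rep_eq_zero (Algebra.lmul ℂ A) y h
  refine ⟨n, ?_⟩
  rw [← map_pow] at hn
  simpa using congrArg (fun f : Module.End ℂ A => f 1) hn

variable (A) in
/-- The algebra `A` as a Hilbert space, with inner product `⟪a, b⟫ = tr (a* b)`. -/
def RegularHilbert := A

noncomputable instance : AddCommGroup (RegularHilbert A) := inferInstanceAs (AddCommGroup A)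
noncomputable instance : Module ℂ (RegularHilbert A) := inferInstanceAs (Module ℂ A)
instance : FiniteDimensional ℂ (RegularHilbert A) := inferInstanceAs (FiniteDimensional ℂ A)

variable (A) in
noncomputable abbrev regularCore : InnerProductSpace.Core ℂ (RegularHilbert A) where
  inner a b := regularTrace A (star (show A from a) * (show A from b))
  conj_inner_symm a b := by
    rw [← map_star_of_positive regularTrace_nonneg, star_mul, star_star]
  re_inner_nonneg a := (Complex.nonneg_iff.1 (regularTrace_nonneg (show A from a))).1
  add_left a b c := by
    change regularTrace A (star ((show A from a) + (show A from b)) * (show A from c)) = _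
    rw [star_add, add_mul, map_add]
  smul_left a b r := by
    change regularTrace A (star (r • (show A from a)) * (show A from b)) = _
    rw [star_smul, smul_mul_assoc, map_smul]; rfl
  definite a h := regularTrace_definite (A := A) h

noncomputable instance : NormedAddCommGroup (RegularHilbert A) :=
  letI := regularCore A
  InnerProductSpace.Core.toNormedAddCommGroup (𝕜 := ℂ)

noncomputable instance : InnerProductSpace ℂ (RegularHilbert A) :=
  letI := regularCore A
  InnerProductSpace.ofCore this.toCore

theorem regularHilbert_inner (a b : RegularHilbert A) :
    inner ℂ a b = regularTrace A (star (show A from a) * (show A from b)) := rfl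

end RegularTrace

section Induced

/-- A finite-dimensional *-algebra with a faithful representation on a Hilbert space is a
C*-algebra. -/
noncomputable abbrev cstarAlgebraOfRep {R : Type*} [Ring R] [StarRing R] [Algebra ℂ R]
    [StarModule ℂ R] [FiniteDimensional ℂ R] {H : Type*} [NormedAddCommGroup H]
    [InnerProductSpace ℂ H] [CompleteSpace H] (π : R →⋆ₐ[ℂ] (H →L[ℂ] H))
    (hπ : Function.Injective π) : CStarAlgebra R :=
  letI : NormedRing R := NormedRing.induced R (H →L[ℂ] H) π hπ
  letI : NormedAlgebra ℂ R := NormedAlgebra.induced ℂ R (H →L[ℂ] H) π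
  { complete := (FiniteDimensional.complete ℂ R).complete
    norm_mul_self_le := fun x => by
      change ‖π x‖ * ‖π x‖ ≤ ‖π (star x * x)‖
      rw [map_mul, map_star]
      exact CStarRing.norm_mul_self_le (π x) }

end Induced

section TensorCStar

variable {A B : Type*} [CStarAlgebra A] [FiniteDimensional ℂ A] [CStarAlgebra B]
  [FiniteDimensional ℂ B]

variable (A B) in
/-- The Hilbert space on which `A ⊗ B` acts by left multiplication. -/
abbrev TensorHilbert := RegularHilbert A ⊗[ℂ] RegularHilbert B

/-- Left multiplication by an element of `A ⊗ B`. -/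
noncomputable def tensorLeftMul (x : A ⊗[ℂ] B) : TensorHilbert A B →ₗ[ℂ] TensorHilbert A B :=
  (LinearMap.mulLeft ℂ x : A ⊗[ℂ] B →ₗ[ℂ] A ⊗[ℂ] B)

theorem regularHilbert_inner_mul {A : Type*} [CStarAlgebra A] [FiniteDimensional ℂ A] (a : A)
    (c e : RegularHilbert A) :
    inner ℂ (show RegularHilbert A from a * (show A from c)) e =
      inner ℂ c (show RegularHilbert A from star a * (show A from e)) := by
  change regularTrace A (star (a * (show A from c)) * (show A from e)) =
    regularTrace A (star (show A from c) * (star a * (show A from e)))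
  rw [star_mul, mul_assoc]

theorem tensorLeftMul_inner (x : A ⊗[ℂ] B) (y z : TensorHilbert A B) :
    inner ℂ (tensorLeftMul x y) z = inner ℂ y (tensorLeftMul (star x) z) := by
  have hadd : ∀ x x' : A ⊗[ℂ] B, ∀ y, tensorLeftMul (x + x') y =
      tensorLeftMul x y + tensorLeftMul x' y := fun x x' y => add_mul x x' (show A ⊗[ℂ] B from y)
  induction x using TensorProduct.induction_on with
  | zero =>
    have h : ∀ y, tensorLeftMul (0 : A ⊗[ℂ] B) y = 0 := fun y => zero_mul (show A ⊗[ℂ] B from y)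
    rw [star_zero, h, h]; simp
  | add x x' hx hx' => rw [star_add, hadd, hadd, inner_add_left, inner_add_right, hx, hx']
  | tmul a b =>
    induction y using TensorProduct.induction_on with
    | zero => simp
    | add y y' hy hy' => rw [map_add, inner_add_left, inner_add_left, hy, hy']
    | tmul c d =>
      induction z using TensorProduct.induction_on with
      | zero => simp
      | add z z' hz hz' => rw [map_add, inner_add_right, inner_add_right, hz, hz']
      | tmul e f =>
        have h : ∀ (a : A) (b : B) (c : RegularHilbert A) (d : RegularHilbert B),
            tensorLeftMul (a ⊗ₜ[ℂ] b) (c ⊗ₜ[ℂ] d) =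
              (show RegularHilbert A from a * (show A from c)) ⊗ₜ[ℂ]
                (show RegularHilbert B from b * (show B from d)) := fun a b c d =>
          Algebra.TensorProduct.tmul_mul_tmul a (show A from c) b (show B from d)
        rw [TensorProduct.star_tmul, h, h, TensorProduct.inner_tmul, TensorProduct.inner_tmul]
        exact congrArg₂ (· * ·) (regularHilbert_inner_mul a c e) (regularHilbert_inner_mul b d f)

variable (A B) in
/-- The representation of `A ⊗ B` on itself by left multiplication. -/
noncomputable def tensorRep : A ⊗[ℂ] B →⋆ₐ[ℂ] (TensorHilbert A B →L[ℂ] TensorHilbert A B) where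
  toFun x := LinearMap.toContinuousLinearMap (tensorLeftMul x)
  map_one' := by
    ext1 y
    exact one_mul (show A ⊗[ℂ] B from y)
  map_mul' x x' := by
    ext1 y
    exact mul_assoc x x' (show A ⊗[ℂ] B from y)
  map_zero' := by
    ext1 y
    exact zero_mul (show A ⊗[ℂ] B from y)
  map_add' x x' := by
    ext1 y
    exact add_mul x x' (show A ⊗[ℂ] B from y)
  commutes' r := by
    ext1 y
    exact (Algebra.smul_def r (show A ⊗[ℂ] B from y)).symm
  map_star' x := by
    rw [ContinuousLinearMap.star_eq_adjoint, ContinuousLinearMap.eq_adjoint_iff]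
    intro y z
    change inner ℂ (tensorLeftMul (star x) y) z = inner ℂ y (tensorLeftMul x z)
    rw [tensorLeftMul_inner, star_star]

theorem tensorRep_injective : Function.Injective (tensorRep A B) := fun x x' h => by
  have h1 := congrArg (fun f => f (show TensorHilbert A B from (1 : A ⊗[ℂ] B))) h
  exact (mul_one x).symm.trans (Eq.trans h1 (mul_one x'))

variable (A B) in
/-- The tensor product of finite-dimensional C*-algebras, with its C*-norm. -/
noncomputable abbrev tensorCStarAlgebra : CStarAlgebra (A ⊗[ℂ] B) :=
  cstarAlgebraOfRep (tensorRep A B) tensorRep_injective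

end TensorCStar

section Gram

theorem exists_eq_star_mul_self {R : Type*} [NonUnitalCStarAlgebra R] [PartialOrder R]
    [StarOrderedRing R] {x : R} (h : 0 ≤ x) : ∃ y : R, x = star y * y :=
  CStarAlgebra.nonneg_iff_eq_star_mul_self.1 h

variable {A : Type*} [CStarAlgebra A] [PartialOrder A] [StarOrderedRing A]

theorem rankOne_nonneg {n : Type*} [Fintype n] (M : CStarMatrix n n A) (v : n → A)
    (h : ∀ i j, M i j = star (v i) * v j) : 0 ≤ M := by
  classical
  rcases isEmpty_or_nonempty n with hn | ⟨⟨i₀⟩⟩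
  · exact (CStarMatrix.ext fun i => (hn.false i).elim : (0 : CStarMatrix n n A) = M).le
  · let Y : CStarMatrix n n A :=
      CStarMatrix.ofMatrix (Matrix.of fun i j => if i = i₀ then v j else 0)
    suffices hM : M = star Y * Y by rw [hM]; exact star_mul_self_nonneg Y
    refine CStarMatrix.ext fun i j => ?_
    rw [CStarMatrix.mul_apply, h, Finset.sum_eq_single i₀]
    · simp [CStarMatrix.star_apply, Y]
    · intro r _ hr
      simp [hr, Y]
    · simp

theorem gram_nonneg {n m : Type*} [Fintype n] [Fintype m] (M : CStarMatrix n n A) (v : m → n → A)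
    (h : ∀ i j, M i j = ∑ r, star (v r i) * v r j) : 0 ≤ M := by
  have : M = ∑ r, CStarMatrix.ofMatrix (Matrix.of fun i j => star (v r i) * v r j) := by
    refine CStarMatrix.ext fun i j => ?_
    rw [h]
    have hs : ∀ (s : Finset m) (F : m → CStarMatrix n n A), (∑ r ∈ s, F r) i j = ∑ r ∈ s, F r i j :=
      fun s F => by
        classical
        induction s using Finset.induction_on with
        | empty => simp
        | insert a s ha ih => rw [Finset.sum_insert ha, Finset.sum_insert ha, ← ih]; simp
    rw [hs]
    simp
  rw [this]
  exact Finset.sum_nonneg fun r _ => rankOne_nonneg _ (v r) fun i j => by simp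

theorem exists_gram {n : Type*} [Fintype n] {M : CStarMatrix n n A} (h : 0 ≤ M) :
    ∃ v : n → n → A, ∀ i j, M i j = ∑ r, star (v r i) * v r j := by
  obtain ⟨X, rfl⟩ := exists_eq_star_mul_self h
  exact ⟨fun r i => X r i, fun i j => by simp [CStarMatrix.mul_apply, CStarMatrix.star_apply]⟩

end Gram

section TensorCP

variable {A A' B R R' : Type*} [CStarAlgebra A] [PartialOrder A] [StarOrderedRing A]
  [CStarAlgebra A'] [PartialOrder A'] [StarOrderedRing A']
  [CStarAlgebra R] [PartialOrder R] [StarOrderedRing R]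
  [CStarAlgebra R'] [PartialOrder R'] [StarOrderedRing R']
  [CStarAlgebra B]

theorem tensor_cp_aux (f : A →CP A') (τ : A →ₗ[ℂ] B →ₗ[ℂ] R) (τ' : A' →ₗ[ℂ] B →ₗ[ℂ] R')
    (hτ : ∀ a a' b b', star (τ a b) * τ a' b' = τ (star a * a') (star b * b'))
    (hτ' : ∀ a a' b b', star (τ' a b) * τ' a' b' = τ' (star a * a') (star b * b'))
    {ι : Type*} [Fintype ι] (b : ι → B) (hb : ∀ x : R, ∃ a : ι → A, x = ∑ s, τ (a s) (b s))
    (g : R →ₗ[ℂ] R') (hg : ∀ a b, g (τ a b) = τ' (f a) b) (k : ℕ)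
    (M : CStarMatrix (Fin k) (Fin k) R) (hM : 0 ≤ M) : 0 ≤ M.map g := by
  obtain ⟨X, hX⟩ := exists_gram hM
  choose a ha using hb
  let N : CStarMatrix (Fin k × ι) (Fin k × ι) A := CStarMatrix.ofMatrix (Matrix.of fun p q =>
    ∑ r, star (a (X r p.1) p.2) * a (X r q.1) q.2)
  have hN : 0 ≤ N := gram_nonneg N (fun r p => a (X r p.1) p.2) fun i j => by simp [N]
  obtain ⟨Z, hZ⟩ := exists_gram (f.map_cstarMatrix_nonneg N hN)
  refine gram_nonneg _ (fun q i => ∑ s, τ' (Z q (i, s)) (b s)) fun i j => ?_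
  have hZ' : ∀ s t, f (∑ r, star (a (X r i) s) * a (X r j) t) =
      ∑ q, star (Z q (i, s)) * Z q (j, t) := fun s t => hZ (i, s) (j, t)
  calc
    (M.map g) i j = g (∑ r, star (X r i) * X r j) := by rw [CStarMatrix.map_apply, hX]
    _ = g (∑ r, ∑ s, ∑ t, τ (star (a (X r i) s) * a (X r j) t) (star (b s) * b t)) := by
      congr 1
      refine Finset.sum_congr rfl fun r _ => ?_
      conv_lhs => rw [ha (X r i), ha (X r j)]
      rw [star_sum, Finset.sum_mul_sum]
      simp only [hτ]
    _ = ∑ s, ∑ t, τ' (f (∑ r, star (a (X r i) s) * a (X r j) t)) (star (b s) * b t) := by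
      simp only [map_sum, hg, LinearMap.sum_apply]
      rw [Finset.sum_comm]
      refine Finset.sum_congr rfl fun s _ => ?_
      rw [Finset.sum_comm]
    _ = ∑ s, ∑ t, ∑ q, star (τ' (Z q (i, s)) (b s)) * τ' (Z q (j, t)) (b t) := by
      simp only [hZ', map_sum, LinearMap.sum_apply, hτ']
    _ = _ := by
      simp only [star_sum, Finset.sum_mul_sum]
      rw [Finset.sum_comm (s := (Finset.univ : Finset (Fin k × ι)))]
      exact Finset.sum_congr rfl fun s _ => Finset.sum_comm

end TensorCP

section CStar

theorem exists_tensor_basis {A B : Type*} [AddCommGroup A] [Module ℂ A] [AddCommGroup B]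
    [Module ℂ B] {ι : Type*} [Fintype ι] (b : Module.Basis ι ℂ B) (x : A ⊗[ℂ] B) :
    ∃ a : ι → A, x = ∑ s, a s ⊗ₜ[ℂ] b s := by
  induction x using TensorProduct.induction_on with
  | zero => exact ⟨0, by simp⟩
  | add x y hx hy =>
    obtain ⟨a, rfl⟩ := hx
    obtain ⟨a', rfl⟩ := hy
    exact ⟨a + a', by simp [TensorProduct.add_tmul, Finset.sum_add_distrib]⟩
  | tmul a c =>
    refine ⟨fun s => b.repr c s • a, ?_⟩
    conv_lhs => rw [← b.sum_repr c]
    rw [TensorProduct.tmul_sum]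
    exact Finset.sum_congr rfl fun s _ => (TensorProduct.smul_tmul _ _ _).symm

/-- Finite-dimensional C*-algebras (with their canonical partial order). -/
structure CStar where
  carrier : Type
  [cstarAlgebra : CStarAlgebra carrier]
  [partialOrder : PartialOrder carrier]
  [starOrderedRing : StarOrderedRing carrier]
  [finiteDimensional : FiniteDimensional ℂ carrier]

namespace CStar

attribute [instance] CStar.cstarAlgebra CStar.partialOrder CStar.starOrderedRing
  CStar.finiteDimensional

theorem cp_ext {A B : CStar} {f g : A.carrier →CP B.carrier}
    (h : f.toLinearMap = g.toLinearMap) : f = g := by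
  cases f; cases g; cases h; rfl

/-- Morphisms are the completely positive linear maps. -/
noncomputable instance : Category CStar where
  Hom A B := A.carrier →CP B.carrier
  id A :=
    { LinearMap.id with
      map_cstarMatrix_nonneg' := fun _ _ h => h }
  comp f g :=
    { g.toLinearMap ∘ₗ f.toLinearMap with
      map_cstarMatrix_nonneg' := fun k M h =>
        g.map_cstarMatrix_nonneg' k _ (f.map_cstarMatrix_nonneg' k M h) }

theorem hom_ext {A B : CStar} {f g : A ⟶ B} (h : f.toLinearMap = g.toLinearMap) : f = g :=
  cp_ext h

/-- The underlying vector space. -/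
noncomputable def forget : CStar ⥤ ModuleCat.{0} ℂ where
  obj A := ModuleCat.of ℂ A.carrier
  map f := ModuleCat.ofHom f.toLinearMap

instance : forget.Faithful where
  map_injective h := hom_ext (congrArg ModuleCat.Hom.hom h)

/-- A *-isomorphism is an isomorphism of `CStar`. -/
noncomputable def isoOfStarAlgEquiv {A B : CStar} (e : A.carrier ≃⋆ₐ[ℂ] B.carrier) : A ≅ B where
  hom :=
    { (e : A.carrier →⋆ₐ[ℂ] B.carrier).toAlgHom.toLinearMap with
      map_cstarMatrix_nonneg' :=
        CompletelyPositiveMapClass.map_cstarMatrix_nonneg' (e : A.carrier →⋆ₐ[ℂ] B.carrier) }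
  inv :=
    { (e.symm : B.carrier →⋆ₐ[ℂ] A.carrier).toAlgHom.toLinearMap with
      map_cstarMatrix_nonneg' :=
        CompletelyPositiveMapClass.map_cstarMatrix_nonneg' (e.symm : B.carrier →⋆ₐ[ℂ] A.carrier) }
  hom_inv_id := hom_ext (LinearMap.ext fun x => e.symm_apply_apply x)
  inv_hom_id := hom_ext (LinearMap.ext fun x => e.apply_symm_apply x)

/-- The tensor product of C*-algebras. -/
noncomputable def tensorObj (A B : CStar) : CStar :=
  letI := tensorCStarAlgebra A.carrier B.carrier
  { carrier := A.carrier ⊗[ℂ] B.carrier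
    partialOrder := CStarAlgebra.spectralOrder _
    starOrderedRing := CStarAlgebra.spectralOrderedRing _
    finiteDimensional := inferInstanceAs (FiniteDimensional ℂ (A.carrier ⊗[ℂ] B.carrier)) }

/-- The tensor unit `ℂ`. -/
noncomputable def unit : CStar where
  carrier := ℂ

/-- The map `f ⊗ id`. -/
noncomputable def rTensor {A A' : CStar} (f : A ⟶ A') (B : CStar) :
    tensorObj A B ⟶ tensorObj A' B :=
  { f.toLinearMap.rTensor B.carrier with
    map_cstarMatrix_nonneg' := by
      refine tensor_cp_aux (R := (tensorObj A B).carrier) (R' := (tensorObj A' B).carrier) f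
        (TensorProduct.mk ℂ A.carrier B.carrier)
        (TensorProduct.mk ℂ A'.carrier B.carrier) ?_ ?_ (Module.finBasis ℂ B.carrier) ?_
          (f.toLinearMap.rTensor B.carrier) ?_
      · intro a a' b b'
        exact Algebra.TensorProduct.tmul_mul_tmul _ _ _ _
      · intro a a' b b'
        exact Algebra.TensorProduct.tmul_mul_tmul _ _ _ _
      · exact exists_tensor_basis (Module.finBasis ℂ B.carrier)
      · intro a b
        rfl }

theorem star_algEquiv {A B R : Type*} [Ring A] [StarRing A] [Algebra ℂ A] [StarModule ℂ A]
    [Ring B] [StarRing B] [Algebra ℂ B] [StarModule ℂ B] [Ring R] [StarRing R] [Algebra ℂ R] (e : A ⊗[ℂ] B →ₐ[ℂ] R)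
    (h : ∀ a b, e (star a ⊗ₜ[ℂ] star b) = star (e (a ⊗ₜ[ℂ] b))) (x : A ⊗[ℂ] B) :
    e (star x) = star (e x) := by
  induction x using TensorProduct.induction_on with
  | zero => simp
  | add x y hx hy => rw [star_add, map_add, hx, hy, map_add, star_add]
  | tmul a b => exact h a b

/-- The symmetry. -/
noncomputable def comm (A B : CStar) : tensorObj A B ≅ tensorObj B A :=
  isoOfStarAlgEquiv (A := tensorObj A B) (B := tensorObj B A)
    (StarAlgEquiv.ofAlgEquiv (Algebra.TensorProduct.comm ℂ A.carrier B.carrier)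
      (star_algEquiv (Algebra.TensorProduct.comm ℂ A.carrier B.carrier).toAlgHom
        fun _ _ => rfl))

/-- The map `id ⊗ f`. -/
noncomputable def lTensor (B : CStar) {A A' : CStar} (f : A ⟶ A') :
    tensorObj B A ⟶ tensorObj B A' :=
  (comm B A).hom ≫ rTensor f B ≫ (comm A' B).hom

/-- The tensor product of completely positive maps. -/
noncomputable def tensorHom {A A' B B' : CStar} (f : A ⟶ A') (g : B ⟶ B') :
    tensorObj A B ⟶ tensorObj A' B' :=
  rTensor f B ≫ lTensor A' g

theorem tensorHom_toLinearMap {A A' B B' : CStar} (f : A ⟶ A') (g : B ⟶ B') :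
    (tensorHom f g).toLinearMap = TensorProduct.map f.toLinearMap g.toLinearMap :=
  TensorProduct.ext' fun _ _ => rfl

noncomputable instance : MonoidalCategoryStruct CStar where
  tensorObj := tensorObj
  tensorHom f g := tensorHom f g
  whiskerLeft A _ _ g := tensorHom (𝟙 A) g
  whiskerRight f B := tensorHom f (𝟙 B)
  tensorUnit := unit
  associator A B D :=
    isoOfStarAlgEquiv (A := tensorObj (tensorObj A B) D) (B := tensorObj A (tensorObj B D))
      (StarAlgEquiv.ofAlgEquiv
        (Algebra.TensorProduct.assoc ℂ ℂ ℂ A.carrier B.carrier D.carrier)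
        (star_algEquiv
          (Algebra.TensorProduct.assoc ℂ ℂ ℂ A.carrier B.carrier D.carrier).toAlgHom
          fun x d => by
            induction x using TensorProduct.induction_on with
            | zero => simp
            | add x y hx hy =>
              rw [star_add, TensorProduct.add_tmul, TensorProduct.add_tmul, map_add, map_add,
                star_add, hx, hy]
            | tmul a b => rfl))
  leftUnitor A :=
    isoOfStarAlgEquiv (A := tensorObj unit A) (B := A)
      (StarAlgEquiv.ofAlgEquiv (Algebra.TensorProduct.lid ℂ A.carrier)
        (star_algEquiv (Algebra.TensorProduct.lid ℂ A.carrier).toAlgHom fun z a => by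
          simp))
  rightUnitor A :=
    isoOfStarAlgEquiv (A := tensorObj A unit) (B := A)
      (StarAlgEquiv.ofAlgEquiv (Algebra.TensorProduct.rid ℂ ℂ A.carrier)
        (star_algEquiv (Algebra.TensorProduct.rid ℂ ℂ A.carrier).toAlgHom fun a z => by
          simp))

noncomputable instance : MonoidalCategory CStar :=
  Monoidal.induced forget
    { μIso := fun A B => Iso.refl (ModuleCat.of ℂ (A.carrier ⊗[ℂ] B.carrier))
      whiskerLeft_eq := fun A _ _ f => ModuleCat.hom_ext (tensorHom_toLinearMap (𝟙 A) f)
      whiskerRight_eq := fun f A => ModuleCat.hom_ext (tensorHom_toLinearMap f (𝟙 A))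
      tensorHom_eq := fun f g => ModuleCat.hom_ext (tensorHom_toLinearMap f g)
      εIso := Iso.refl (ModuleCat.of ℂ ℂ)
      associator_eq := fun _ _ _ => ModuleCat.hom_ext (TensorProduct.ext_threefold fun _ _ _ => rfl)
      leftUnitor_eq := fun _ => ModuleCat.hom_ext (TensorProduct.ext' fun _ _ => rfl)
      rightUnitor_eq := fun _ => ModuleCat.hom_ext (TensorProduct.ext' fun _ _ => rfl) }

end CStar

end CStar

section CanonicalTrace

variable {A : Type*} [CStarAlgebra A]

/-- `τ` is the matrix trace: under an isomorphism of `A` with a product of matrix algebras, `τ x` is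
the sum of the traces of the blocks of `x`. -/
def IsMatrixTrace (τ : A →ₗ[ℂ] ℂ) : Prop :=
  ∃ (n : ℕ) (d : Fin n → ℕ) (e : A ≃ₐ[ℂ] ((i : Fin n) → Matrix (Fin (d i)) (Fin (d i)) ℂ)),
    ∀ x, τ x = ∑ i, (e x i).trace

theorem exists_isMatrixTrace [FiniteDimensional ℂ A] : ∃ τ : A →ₗ[ℂ] ℂ, IsMatrixTrace τ := by
  have := isSemisimpleRing_of_finiteDimensional A
  obtain ⟨n, d, -, ⟨e⟩⟩ := IsSemisimpleRing.exists_algEquiv_pi_matrix_of_isAlgClosed ℂ A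
  exact ⟨{ toFun := fun x => ∑ i, (e x i).trace
           map_add' := fun x y => by simp [Finset.sum_add_distrib]
           map_smul' := fun r x => by simp [Finset.mul_sum] }, n, d, e, fun _ => rfl⟩

variable (A) in
/-- The matrix trace of a finite-dimensional C*-algebra. -/
noncomputable def matrixTrace [FiniteDimensional ℂ A] : A →ₗ[ℂ] ℂ :=
  Classical.choose (exists_isMatrixTrace (A := A))

theorem isMatrixTrace_matrixTrace [FiniteDimensional ℂ A] : IsMatrixTrace (matrixTrace A) :=
  Classical.choose_spec (exists_isMatrixTrace (A := A))

theorem IsMatrixTrace.nonneg {τ : A →ₗ[ℂ] ℂ} (h : IsMatrixTrace τ) (y : A) :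
    0 ≤ τ (star y * y) := by
  obtain ⟨n, d, e, h⟩ := h
  rw [h]
  refine Finset.sum_nonneg fun i _ => ?_
  have := trace_rep_nonneg ((Matrix.toLinAlgEquiv' (R := ℂ) (n := Fin (d i))).toAlgHom.comp
    ((Pi.evalAlgHom ℂ (fun i => Matrix (Fin (d i)) (Fin (d i)) ℂ) i).comp e.toAlgHom)) y
  rw [← Matrix.trace_toLin'_eq]
  exact this

theorem IsMatrixTrace.eq_self {τ : ℂ →ₗ[ℂ] ℂ} (h : IsMatrixTrace τ) (z : ℂ) : τ z = z := by
  obtain ⟨n, d, e, h⟩ := h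
  have h1 : ∑ i, d i * d i = 1 := by
    have := e.toLinearEquiv.finrank_eq
    rw [Module.finrank_self, Module.finrank_pi_fintype] at this
    simpa [Module.finrank_matrix] using this.symm
  have h2 : ∀ i, d i * d i = d i := fun i => by
    have h3 : d i * d i ≤ 1 := by
      rw [← h1]
      exact Finset.single_le_sum (f := fun i => d i * d i) (fun _ _ => Nat.zero_le _)
        (Finset.mem_univ i)
    have h4 : d i ≤ 1 := by nlinarith
    interval_cases d i <;> rfl
  simp only [h2] at h1
  have h5 : τ 1 = 1 := by
    rw [h]
    simp only [map_one, Pi.one_apply, Matrix.trace_one, Fintype.card_fin]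
    exact_mod_cast h1
  calc τ z = τ (z • 1) := by simp
    _ = z := by rw [map_smul, h5]; simp

theorem cp_of_nonneg [PartialOrder A] [StarOrderedRing A] (φ : A →ₗ[ℂ] ℂ)
    (hφ : ∀ y, 0 ≤ φ (star y * y)) (k : ℕ) (M : CStarMatrix (Fin k) (Fin k) A) (hM : 0 ≤ M) :
    0 ≤ M.map φ := by
  obtain ⟨v, hv⟩ := exists_gram hM
  have h1 : (Matrix.of fun i j => φ (M i j)).PosSemidef := by
    refine Matrix.PosSemidef.of_dotProduct_mulVec_nonneg ?_ fun c => ?_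
    · ext i j
      rw [Matrix.conjTranspose_apply, Matrix.of_apply, Matrix.of_apply, hv, hv]
      simp only [map_sum, star_sum]
      refine Finset.sum_congr rfl fun r _ => ?_
      refine (map_star_of_positive hφ _).symm.trans ?_
      rw [star_mul, star_star]
    · have : star c ⬝ᵥ (Matrix.of fun i j => φ (M i j)).mulVec c =
          ∑ r, φ (star (∑ i, c i • v r i) * ∑ j, c j • v r j) := by
        simp only [dotProduct, Matrix.mulVec, Matrix.of_apply, hv, star_sum, star_smul,
          Finset.sum_mul_sum, map_sum, smul_mul_smul_comm, map_smul, Pi.star_apply, smul_eq_mul]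
        rw [Finset.sum_comm]
        refine Finset.sum_congr rfl fun i _ => ?_
        rw [Finset.sum_comm, Finset.mul_sum]
        refine Finset.sum_congr rfl fun j _ => ?_
        rw [Finset.sum_mul, Finset.mul_sum]
        exact Finset.sum_congr rfl fun r _ => by ring
      rw [this]
      exact Finset.sum_nonneg fun r _ => hφ _
  obtain ⟨B, hB⟩ : ∃ B : Matrix (Fin k) (Fin k) ℂ,
      (Matrix.of fun i j => φ (M i j)) = star B * B := by
    open scoped MatrixOrder in
    exact CStarAlgebra.nonneg_iff_eq_star_mul_self.1 h1.nonneg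
  refine gram_nonneg _ (fun r i => B r i) fun i j => ?_
  have := congrFun (congrFun hB i) j
  rw [CStarMatrix.map_apply]
  exact this.trans (by simp [Matrix.mul_apply])

end CanonicalTrace

namespace CStar

/-- Discarding in `CStar` is given by the trace. -/
noncomputable instance : Discarding CStar where
  discard A :=
    { matrixTrace A.carrier with
      map_cstarMatrix_nonneg' := cp_of_nonneg _ isMatrixTrace_matrixTrace.nonneg }
  discard_unit := hom_ext (LinearMap.ext (isMatrixTrace_matrixTrace (A := ℂ)).eq_self)

/-- Completely positive maps are closed under addition. -/
noncomputable instance : SemiAdditive CStar where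
  homAddCommMonoid A B :=
    letI : Zero (A.carrier →CP B.carrier) := ⟨{ (0 : A.carrier →ₗ[ℂ] B.carrier) with
      map_cstarMatrix_nonneg' := fun k M _ => le_of_eq (CStarMatrix.ext fun _ _ => rfl) }⟩
    letI : Add (A.carrier →CP B.carrier) := ⟨fun f g => { f.toLinearMap + g.toLinearMap with
      map_cstarMatrix_nonneg' := fun k M h =>
        le_of_le_of_eq (add_nonneg (f.map_cstarMatrix_nonneg' k M h) (g.map_cstarMatrix_nonneg' k M h))
          (CStarMatrix.ext fun _ _ => rfl) }⟩
    { add_assoc := fun f g h => cp_ext (add_assoc _ _ _)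
      zero_add := fun f => cp_ext (zero_add _)
      add_zero := fun f => cp_ext (add_zero _)
      add_comm := fun f g => cp_ext (add_comm _ _)
      nsmul := nsmulRec }
  add_comp f g h := hom_ext (LinearMap.comp_add _ _ _)
  comp_add f g h := hom_ext (LinearMap.add_comp _ _ _)
  zero_comp h := hom_ext (LinearMap.comp_zero _)
  comp_zero h := hom_ext (LinearMap.zero_comp _)

theorem add_toLinearMap {A B : CStar} (f g : A ⟶ B) :
    (f + g).toLinearMap = f.toLinearMap + g.toLinearMap := rfl

theorem zero_toLinearMap (A B : CStar) : (0 : A ⟶ B).toLinearMap = 0 := rfl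

instance : SemiAdditiveMonoidal CStar where
  tensor_add f g h := hom_ext <|
    (tensorHom_toLinearMap f (g + h)).trans <| (TensorProduct.map_add_right _ _ _).trans <|
      congrArg₂ (· + ·) (tensorHom_toLinearMap f g).symm (tensorHom_toLinearMap f h).symm
  add_tensor f g h := hom_ext <|
    (tensorHom_toLinearMap (f + g) h).trans <| (TensorProduct.map_add_left _ _ _).trans <|
      congrArg₂ (· + ·) (tensorHom_toLinearMap f h).symm (tensorHom_toLinearMap g h).symm
  tensor_zero f := hom_ext <|
    (tensorHom_toLinearMap f 0).trans (TensorProduct.map_zero_right _)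
  zero_tensor f := hom_ext <|
    (tensorHom_toLinearMap 0 f).trans (TensorProduct.map_zero_left _)

end CStar

/-- Finite-dimensional Hilbert spaces, as the objects of the category of quantum processes. -/
structure Quant where
  carrier : Type
  [normedAddCommGroup : NormedAddCommGroup carrier]
  [innerProductSpace : InnerProductSpace ℂ carrier]
  [finiteDimensional : FiniteDimensional ℂ carrier]

namespace Quant

attribute [instance] Quant.normedAddCommGroup Quant.innerProductSpace Quant.finiteDimensional

instance (H : Quant) : CompleteSpace H.carrier := FiniteDimensional.complete ℂ H.carrier

/-- The C*-algebra of operators of a Hilbert space. -/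
noncomputable def operators (H : Quant) : CStar where
  carrier := H.carrier →L[ℂ] H.carrier

/-- Morphisms `H ⟶ K` are the completely positive maps from `B(H)` to `B(K)`. -/
noncomputable instance : Category Quant where
  Hom H K := operators H ⟶ operators K
  id H := 𝟙 (operators H)
  comp f g := CategoryStruct.comp (obj := CStar) f g
  id_comp f := Category.id_comp (obj := CStar) f
  comp_id f := Category.comp_id (obj := CStar) f
  assoc f g h := Category.assoc (obj := CStar) f g h

/-- The functor sending a Hilbert space to its algebra of operators. -/
noncomputable def toCStar : Quant ⥤ CStar where
  obj := operators
  map f := f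

instance : toCStar.Faithful where
  map_injective h := h

/-- The linear map underlying a morphism. -/
noncomputable def toLin {H K : Quant} (f : H ⟶ K) :
    (H.carrier →L[ℂ] H.carrier) →ₗ[ℂ] (K.carrier →L[ℂ] K.carrier) :=
  (toCStar.map f).toLinearMap

noncomputable def isoMk {H K : Quant} (e : operators H ≅ operators K) : H ≅ K where
  hom := e.hom
  inv := e.inv
  hom_inv_id := e.hom_inv_id
  inv_hom_id := e.inv_hom_id

/-- The tensor product of Hilbert spaces. -/
noncomputable def tensorObj (H K : Quant) : Quant where
  carrier := H.carrier ⊗[ℂ] K.carrier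

/-- The one-dimensional Hilbert space. -/
noncomputable def unit : Quant where
  carrier := ℂ

section

variable (H K : Type*) [NormedAddCommGroup H] [InnerProductSpace ℂ H] [FiniteDimensional ℂ H]
  [NormedAddCommGroup K] [InnerProductSpace ℂ K] [FiniteDimensional ℂ K]

/-- `B(H) ⊗ B(K) ≅ B(H ⊗ K)`. -/
noncomputable def tensorAlgEquiv :
    ((H →L[ℂ] H) ⊗[ℂ] (K →L[ℂ] K)) ≃ₐ[ℂ] (H ⊗[ℂ] K →L[ℂ] H ⊗[ℂ] K) :=
  ((Algebra.TensorProduct.congr (Module.End.toContinuousLinearMap (𝕜 := ℂ) H).symm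
      (Module.End.toContinuousLinearMap (𝕜 := ℂ) K).symm).trans
    (AlgEquiv.ofBijective (Module.endTensorEndAlgHom (R := ℂ) (S := ℂ) (A := ℂ) (M := H) (N := K))
      (by
        have h := (homTensorHomEquiv ℂ H K H K).bijective
        rwa [← LinearEquiv.coe_coe, homTensorHomEquiv_toLinearMap] at h))).trans
    (Module.End.toContinuousLinearMap (𝕜 := ℂ) (H ⊗[ℂ] K))

theorem tensorAlgEquiv_tmul (X : H →L[ℂ] H) (Y : K →L[ℂ] K) :
    tensorAlgEquiv H K (X ⊗ₜ Y) = TensorProduct.mapL X Y :=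
  ContinuousLinearMap.ext fun z => (TensorProduct.mapL_apply X Y z).symm

end

/-- The *-isomorphism `B(H) ⊗ B(K) ≅ B(H ⊗ K)`. -/
noncomputable def μIso (H K : Quant) : operators H ⊗ operators K ≅ operators (tensorObj H K) :=
  CStar.isoOfStarAlgEquiv (A := CStar.tensorObj (operators H) (operators K))
    (StarAlgEquiv.ofAlgEquiv (tensorAlgEquiv H.carrier K.carrier)
      (CStar.star_algEquiv (tensorAlgEquiv H.carrier K.carrier).toAlgHom fun X Y => by
        refine (tensorAlgEquiv_tmul _ _ _ _).trans ?_
        refine Eq.trans ?_ (congrArg star (tensorAlgEquiv_tmul _ _ X Y).symm)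
        exact (TensorProduct.adjoint_mapL X Y).symm))

/-- `ℂ ≅ B(ℂ)`. -/
noncomputable def unitAlgEquiv : ℂ ≃ₐ[ℂ] (ℂ →L[ℂ] ℂ) :=
  AlgEquiv.ofBijective (Algebra.ofId ℂ (ℂ →L[ℂ] ℂ)) (by
    have h : ∀ z w : ℂ, Algebra.ofId ℂ (ℂ →L[ℂ] ℂ) z w = z * w := fun z w => rfl
    constructor
    · intro z z' e
      have := congrArg (fun X : ℂ →L[ℂ] ℂ => X 1) e
      simpa [h] using this
    · intro X
      refine ⟨X 1, ContinuousLinearMap.ext fun w => ?_⟩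
      rw [h, mul_comm, ← smul_eq_mul, ← map_smul, smul_eq_mul, mul_one])

theorem unitAlgEquiv_star (z : ℂ) : unitAlgEquiv (star z) = star (unitAlgEquiv z) :=
  algebraMap_star_comm (A := ℂ →L[ℂ] ℂ) z

/-- The *-isomorphism `ℂ ≅ B(ℂ)`. -/
noncomputable def εIso : 𝟙_ CStar ≅ operators unit :=
  CStar.isoOfStarAlgEquiv (A := CStar.unit) (B := operators unit)
    (StarAlgEquiv.ofAlgEquiv unitAlgEquiv unitAlgEquiv_star)

/-- The monoidal structure is that of `CStar`, along the *-isomorphisms `B(H) ⊗ B(K) ≅ B(H ⊗ K)`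
and `ℂ ≅ B(ℂ)`. -/
noncomputable instance : MonoidalCategoryStruct Quant where
  tensorObj := tensorObj
  tensorHom {H K H' K'} f g :=
    ((μIso H H').inv ≫ (toCStar.map f ⊗ₘ toCStar.map g) ≫ (μIso K K').hom :
      operators _ ⟶ operators _)
  whiskerLeft H K K' g :=
    ((μIso H K).inv ≫ operators H ◁ toCStar.map g ≫ (μIso H K').hom : operators _ ⟶ operators _)
  whiskerRight {H H'} f K :=
    ((μIso H K).inv ≫ toCStar.map f ▷ operators K ≫ (μIso H' K).hom : operators _ ⟶ operators _)
  tensorUnit := unit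
  associator H K L := isoMk ((μIso (tensorObj H K) L).symm ≪≫
    ((μIso H K).symm ⊗ᵢ Iso.refl (operators L)) ≪≫
    α_ (operators H) (operators K) (operators L) ≪≫
    (Iso.refl (operators H) ⊗ᵢ μIso K L) ≪≫ μIso H (tensorObj K L))
  leftUnitor H := isoMk ((μIso unit H).symm ≪≫ (εIso.symm ⊗ᵢ Iso.refl (operators H)) ≪≫
    λ_ (operators H))
  rightUnitor H := isoMk ((μIso H unit).symm ≪≫ (Iso.refl (operators H) ⊗ᵢ εIso.symm) ≪≫
    ρ_ (operators H))

noncomputable instance : MonoidalCategory Quant :=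
  Monoidal.induced toCStar
    { μIso := μIso
      whiskerLeft_eq := fun _ _ _ _ => rfl
      whiskerRight_eq := fun _ _ => rfl
      tensorHom_eq := fun _ _ => rfl
      εIso := εIso
      associator_eq := fun _ _ _ => rfl
      leftUnitor_eq := fun _ => rfl
      rightUnitor_eq := fun _ => rfl }

/-- Sums of completely positive maps. -/
noncomputable instance : SemiAdditive Quant where
  homAddCommMonoid H K := SemiAdditive.homAddCommMonoid (operators H) (operators K)
  add_comp f g h := SemiAdditive.add_comp (C := CStar) f g h
  comp_add f g h := SemiAdditive.comp_add (C := CStar) f g h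
  zero_comp h := SemiAdditive.zero_comp (C := CStar) h
  comp_zero h := SemiAdditive.comp_zero (C := CStar) h

theorem tensor_eq {H K H' K' : Quant} (f : H ⟶ K) (g : H' ⟶ K') :
    f ⊗ₘ g = ((μIso H H').inv ≫ (toCStar.map f ⊗ₘ toCStar.map g) ≫ (μIso K K').hom :
      operators _ ⟶ operators _) := rfl

section

variable {A A' B B' D E : CStar} (u : D ⟶ A ⊗ A') (v : B ⊗ B' ⟶ E)

theorem sandwich_tensor_add (f : A ⟶ B) (g h : A' ⟶ B') :
    u ≫ (f ⊗ₘ (g + h)) ≫ v = u ≫ (f ⊗ₘ g) ≫ v + u ≫ (f ⊗ₘ h) ≫ v := by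
  rw [SemiAdditiveMonoidal.tensor_add, SemiAdditive.add_comp, SemiAdditive.comp_add]

theorem sandwich_add_tensor (f g : A ⟶ B) (h : A' ⟶ B') :
    u ≫ ((f + g) ⊗ₘ h) ≫ v = u ≫ (f ⊗ₘ h) ≫ v + u ≫ (g ⊗ₘ h) ≫ v := by
  rw [SemiAdditiveMonoidal.add_tensor, SemiAdditive.add_comp, SemiAdditive.comp_add]

theorem sandwich_tensor_zero (f : A ⟶ B) : u ≫ (f ⊗ₘ (0 : A' ⟶ B')) ≫ v = 0 := by
  rw [SemiAdditiveMonoidal.tensor_zero, SemiAdditive.zero_comp, SemiAdditive.comp_zero]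

theorem sandwich_zero_tensor (f : A' ⟶ B') : u ≫ ((0 : A ⟶ B) ⊗ₘ f) ≫ v = 0 := by
  rw [SemiAdditiveMonoidal.zero_tensor, SemiAdditive.zero_comp, SemiAdditive.comp_zero]

end

instance : SemiAdditiveMonoidal Quant where
  tensor_add f g h := sandwich_tensor_add (μIso _ _).inv (μIso _ _).hom f g h
  add_tensor f g h := sandwich_add_tensor (μIso _ _).inv (μIso _ _).hom f g h
  tensor_zero f := sandwich_tensor_zero (μIso _ _).inv (μIso _ _).hom f
  zero_tensor f := sandwich_zero_tensor (μIso _ _).inv (μIso _ _).hom f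

/-- The trace, as a linear map on `B(H)`. -/
noncomputable def trace (H : Type*) [NormedAddCommGroup H] [InnerProductSpace ℂ H]
    [FiniteDimensional ℂ H] : (H →L[ℂ] H) →ₗ[ℂ] ℂ :=
  LinearMap.trace ℂ H ∘ₗ (LinearMap.toContinuousLinearMap (𝕜 := ℂ) (E := H) (F' := H)).symm

theorem trace_unitAlgEquiv (z : ℂ) : trace ℂ (unitAlgEquiv z) = z := by
  have h : trace ℂ (unitAlgEquiv (z • 1)) = z := by
    rw [map_smul, map_one, map_smul]
    refine (congrArg (z • ·) ((LinearMap.trace_one ℂ ℂ).trans ?_)).trans (mul_one z)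
    simp
  rwa [smul_eq_mul, mul_one] at h

theorem trace_nonneg {H : Type*} [NormedAddCommGroup H] [InnerProductSpace ℂ H]
    [FiniteDimensional ℂ H] [CompleteSpace H] (X : H →L[ℂ] H) : 0 ≤ trace H (star X * X) :=
  trace_rep_nonneg (Module.End.toContinuousLinearMap (𝕜 := ℂ) H).symm.toAlgHom X

/-- The trace, as a completely positive map. -/
noncomputable def traceHom (H : Quant) : operators H ⟶ 𝟙_ CStar :=
  { trace H.carrier with
    map_cstarMatrix_nonneg' := cp_of_nonneg (A := H.carrier →L[ℂ] H.carrier) _ trace_nonneg }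

theorem μIso_traceHom (H K : Quant) :
    (μIso H K).hom ≫ traceHom (tensorObj H K) = (traceHom H ⊗ₘ traceHom K) ≫ (λ_ (𝟙_ CStar)).hom :=
  CStar.hom_ext (TensorProduct.ext' fun X Y =>
    (congrArg (trace (H.carrier ⊗[ℂ] K.carrier)) (tensorAlgEquiv_tmul _ _ X Y)).trans
      ((congrArg (LinearMap.trace ℂ _) (TensorProduct.toLinearMap_mapL X Y)).trans
        (LinearMap.trace_tensorProduct' _ _)))

/-- Discarding in `Quant` is given by the trace. -/
noncomputable instance : Discarding Quant where
  discard H := (traceHom H ≫ εIso.hom : operators H ⟶ operators unit)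
  discard_unit := by
    change traceHom unit ≫ εIso.hom = 𝟙 (operators unit)
    have h : traceHom unit = εIso.inv := by
      rw [← cancel_epi εIso.hom, Iso.hom_inv_id]
      refine CStar.hom_ext (LinearMap.ext fun z => ?_)
      exact trace_unitAlgEquiv z
    rw [h, Iso.inv_hom_id]

instance : MonoidalDiscarding Quant where
  discard_tensor H K := by
    change traceHom (tensorObj H K) ≫ εIso.hom =
      ((μIso H K).inv ≫ ((traceHom H ≫ εIso.hom) ⊗ₘ (traceHom K ≫ εIso.hom)) ≫
        (μIso unit unit).hom) ≫ (μIso unit unit).inv ≫ (εIso.inv ⊗ₘ 𝟙 (operators unit)) ≫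
          (λ_ (operators unit)).hom
    rw [← cancel_epi (μIso H K).hom, reassoc_of% μIso_traceHom]
    simp only [Category.assoc, Iso.hom_inv_id_assoc, tensorHom_comp_tensorHom_assoc,
      Iso.hom_inv_id, Category.comp_id]
    rw [← leftUnitor_naturality, ← id_tensorHom, tensorHom_comp_tensorHom_assoc, Category.comp_id]

/-- `p` is self-adjoint for the Hilbert-Schmidt inner products. -/
def IsSelfAdjointMap {H : Quant} (p : H ⟶ H) : Prop :=
  ∀ X Y : H.carrier →L[ℂ] H.carrier,
    trace H.carrier (star X * toLin p Y) = trace H.carrier (star (toLin p X) * Y)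

theorem toLin_tensor {H H' : Quant} (p : H ⟶ H) (q : H' ⟶ H')
    (y : (H.carrier →L[ℂ] H.carrier) ⊗[ℂ] (H'.carrier →L[ℂ] H'.carrier)) :
    toLin (p ⊗ₘ q) (tensorAlgEquiv H.carrier H'.carrier y) =
      tensorAlgEquiv H.carrier H'.carrier (TensorProduct.map (toLin p) (toLin q) y) := by
  have h1 : (μIso H H').hom ≫ toCStar.map (p ⊗ₘ q) =
      (toCStar.map p ⊗ₘ toCStar.map q) ≫ (μIso H H').hom :=
    Iso.hom_inv_id_assoc _ _
  exact (congrArg (fun f : (operators H ⊗ operators H' ⟶ operators (tensorObj H H')) =>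
      f.toLinearMap y) h1).trans
    (congrArg (fun f : (operators H ⊗ operators H').carrier →ₗ[ℂ] (operators H ⊗ operators H').carrier =>
      tensorAlgEquiv H.carrier H'.carrier (f y)) (CStar.tensorHom_toLinearMap p q))

theorem star_tensorAlgEquiv {H K : Type*} [NormedAddCommGroup H] [InnerProductSpace ℂ H]
    [FiniteDimensional ℂ H] [NormedAddCommGroup K] [InnerProductSpace ℂ K] [FiniteDimensional ℂ K]
    [CompleteSpace H] [CompleteSpace K] [CompleteSpace (H ⊗[ℂ] K)]
    (x : (H →L[ℂ] H) ⊗[ℂ] (K →L[ℂ] K)) :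
    tensorAlgEquiv H K (star x) = star (tensorAlgEquiv H K x) :=
  CStar.star_algEquiv (tensorAlgEquiv H K).toAlgHom (fun X Y => by
    refine (tensorAlgEquiv_tmul _ _ _ _).trans ?_
    refine Eq.trans ?_ (congrArg star (tensorAlgEquiv_tmul _ _ X Y).symm)
    exact (TensorProduct.adjoint_mapL X Y).symm) x

theorem trace_tensorAlgEquiv {H K : Type*} [NormedAddCommGroup H] [InnerProductSpace ℂ H]
    [FiniteDimensional ℂ H] [NormedAddCommGroup K] [InnerProductSpace ℂ K] [FiniteDimensional ℂ K]
    (X : H →L[ℂ] H) (Y : K →L[ℂ] K) :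
    trace (H ⊗[ℂ] K) (tensorAlgEquiv H K (X ⊗ₜ Y)) = trace H X * trace K Y :=
  (congrArg (trace (H ⊗[ℂ] K)) (tensorAlgEquiv_tmul _ _ X Y)).trans
    ((congrArg (LinearMap.trace ℂ _) (TensorProduct.toLinearMap_mapL X Y)).trans
      (LinearMap.trace_tensorProduct' _ _))

theorem IsSelfAdjointMap.tensor {H H' : Quant} {p : H ⟶ H} {q : H' ⟶ H'}
    (hp : IsSelfAdjointMap p) (hq : IsSelfAdjointMap q) : IsSelfAdjointMap (p ⊗ₘ q) := by
  have key : ∀ x y : (H.carrier →L[ℂ] H.carrier) ⊗[ℂ] (H'.carrier →L[ℂ] H'.carrier),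
      trace (H.carrier ⊗[ℂ] H'.carrier) (tensorAlgEquiv H.carrier H'.carrier
        (star x * TensorProduct.map (toLin p) (toLin q) y)) =
      trace (H.carrier ⊗[ℂ] H'.carrier) (tensorAlgEquiv H.carrier H'.carrier
        (star (TensorProduct.map (toLin p) (toLin q) x) * y)) := by
    intro x y
    induction x using TensorProduct.induction_on with
    | zero => simp
    | add x x' hx hx' =>
      rw [star_add, add_mul, map_add, map_add, hx, hx', map_add, star_add, add_mul, map_add,
        map_add]
    | tmul a b =>
      induction y using TensorProduct.induction_on with
      | zero => simp
      | add y y' hy hy' =>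
        rw [map_add, mul_add, map_add, map_add, hy, hy', mul_add, map_add, map_add]
      | tmul c d =>
        rw [TensorProduct.map_tmul, TensorProduct.map_tmul, TensorProduct.star_tmul,
          TensorProduct.star_tmul, Algebra.TensorProduct.tmul_mul_tmul,
          Algebra.TensorProduct.tmul_mul_tmul, trace_tensorAlgEquiv, trace_tensorAlgEquiv,
          hp a c, hq b d]
  intro X Y
  obtain ⟨x, rfl⟩ := (tensorAlgEquiv H.carrier H'.carrier).surjective X
  obtain ⟨y, rfl⟩ := (tensorAlgEquiv H.carrier H'.carrier).surjective Y
  have h := key x y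
  have e : ∀ x y, tensorAlgEquiv H.carrier H'.carrier (star x * y) =
      star (tensorAlgEquiv H.carrier H'.carrier x) * tensorAlgEquiv H.carrier H'.carrier y :=
    fun x y => (map_mul _ _ _).trans (congrArg (· * _) (star_tensorAlgEquiv x))
  rw [e, e, ← toLin_tensor, ← toLin_tensor] at h
  exact h

/-- The objects `(H, p)` with `p` self-adjoint. -/
def daggerIdempotents : ObjectProperty (SplitCausal Quant) := fun P => IsSelfAdjointMap P.obj.p

instance : daggerIdempotents.IsMonoidal where
  prop_unit := fun _ _ => rfl
  prop_tensor _ _ h h' := h.tensor h'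

/-- The category obtained by splitting the causal self-adjoint idempotents of `Quant`. -/
abbrev SplitDaggerCausal := daggerIdempotents.FullSubcategory

end Quant

end TwoRoads

open TwoRoads

/-!
# Biproduct completions, Frobenius structures and splittings of causal idempotents

A causal functor that is fully faithful, monoidal with causal structure isomorphisms, and
essentially surjective up to causal isomorphism is a causal monoidal equivalence
(`IsCausalMonoidalEquivalence.of_fullyFaithful`): an inverse built from causal isomorphisms is
automatically causal. Moreover, a fully faithful additive causal monoidal functor `F : E ⥤ T`
extends to a causal monoidal equivalence `E^⊕ ≃ T` as soon as every finite family in the image of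
`F` has a biproduct in `T` with causal injections (a `CausalSum`), and every object of `T` is such
a biproduct (`exists_extension`). All the equivalences below come from these two criteria.

**Splittings.** An equation `p = ∑ mᵢ ∘ eᵢ` witnessing that a causal idempotent on `A` decomposes
says exactly that `(A, p)` is the causal sum of the objects `(Bᵢ, id)` in `Split^c`
(`causalSumOfSplitting`). So for a category `E` with finite decompositions, every object of
`Split^c(E)` is a causal sum of objects of `E`, and causal sums of the same family are causally
isomorphic. A full monoidal subcategory of `Split^c(E)` that contains `E` and in which every
family from `E` has a causal sum is therefore equivalent to all of `Split^c(E)`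
(`isCausalMonoidalEquivalence_ι`) and to `E^⊕` (`exists_biprodCompletion_equivalence`). What has
to be found in each of the two cases are causal sums carried by self-adjoint idempotents.

**Dagger compact categories.** The functor `CP*(C) ⥤ Split^c_†(CPM(C))` is fully faithful: bending
wires identifies the two conditions of complete positivity (`CPStar.isCP_sandwich_iff`), and
specialness makes `k ↦ μ ∘ k ∘ δ` inverse to `f ↦ δ ∘ f ∘ μ`. The sums are images of Frobenius
structures. The cup and cap of `A` make `A* ⊗ A` a symmetric dagger Frobenius structure that is
special up to `dim A`, and positive-dimensionality provides the scalars that normalise it. In the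
splitting the result is causally isomorphic to `(A, id)` (`exists_pants`). Frobenius structures
are closed under dagger biproducts (`exists_directSum`), whence `exists_causalSum_toSplitDagger`.

**Finite-dimensional C*-algebras.** A finite-dimensional C*-algebra is *-isomorphic to a product
of algebras `B(H)` (`CStar.exists_starAlgEquiv_pi`): Wedderburn's theorem gives the blocks, and
the Hilbert spaces are minimal left ideals with the inner product `tr (x* y)`. The matrix trace is
the only tracial functional with value `1` on every minimal idempotent (`IsMatrixTrace.eq_smul`),
so it is preserved by isomorphisms, additive over products and multiplicative over tensor
products. Hence `H ↦ B(H)` satisfies the second criterion and `Quant^⊕ ≃ CStar`.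

That `Quant` has finite decompositions is a statement about the image of a trace-preserving
completely positive idempotent. The transpose for the bilinear form `tr (a b)` exchanges
trace-preserving maps with unital ones. The range of a unital completely positive idempotent `φ`
is a C*-algebra for the Choi-Effros product `a ∘ b = φ (a b)`, and `φ` splits through it by
completely positive unital maps (`CStar.exists_splitting_of_unital`). For the projection onto the
range, complete positivity is tested against a faithful positive functional
(`nonneg_of_functional_nonneg`). The range is itself a product of algebras of operators, which
gives the decomposition (`Quant.finiteDecompositionProperty`). The causal sum of a family `H i` is
carried by the self-adjoint idempotent that maps an operator on the orthogonal sum of the `H i` to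
its block-diagonal part (`CStar.Corners.expectation`, `Quant.exists_causalSum_toSplitCausal`).
-/

open CategoryTheory MonoidalCategory
open scoped ComplexOrder TensorProduct CStarAlgebra
open TwoRoads
set_option linter.unusedSectionVars false

namespace TwoRoads

open TwoRoads.Discarding (discard discard_unit)

/-! ### Causal monoidal equivalences -/

section CausalEquivalence

variable {C : Type*} [Category* C] [MonoidalCategory C] [Discarding C]
  {D : Type*} [Category* D] [MonoidalCategory D] [Discarding D]
  {E : Type*} [Category* E] [MonoidalCategory E] [Discarding E]

theorem Causal.iso_inv {A B : C} {e : A ≅ B} (h : Causal e.hom) : Causal e.inv := by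
  unfold Causal at *
  rw [← h, Iso.inv_hom_id_assoc]

theorem Causal.iso_hom {A B : C} {e : A ≅ B} (h : Causal e.inv) : Causal e.hom :=
  Causal.iso_inv (e := e.symm) h

namespace IsCausalFunctor

theorem map {F : C ⥤ D} (hF : IsCausalFunctor F) {A B : C} {f : A ⟶ B} (hf : Causal f) :
    Causal (F.map f) := by
  unfold Causal at *
  rw [hF.map_discard B, hF.map_discard A, ← F.map_comp_assoc, hf]

theorem of_map {F : C ⥤ D} [F.Faithful] (hF : IsCausalFunctor F) {A B : C} {f : A ⟶ B}
    (hf : Causal (F.map f)) : Causal f := by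
  have := hF.isIso_discard
  unfold Causal at *
  rw [hF.map_discard B, hF.map_discard A, ← F.map_comp_assoc, cancel_mono] at hf
  exact F.map_injective hf

theorem comp {F : C ⥤ D} {G : D ⥤ E} (hF : IsCausalFunctor F) (hG : IsCausalFunctor G) :
    IsCausalFunctor (F ⋙ G) where
  isIso_discard := by
    have := hF.isIso_discard
    have := hG.isIso_discard
    rw [Functor.comp_obj, hG.map_discard]
    infer_instance
  map_discard A := by
    simp only [Functor.comp_obj, Functor.comp_map]
    rw [hG.map_discard, hF.map_discard, G.map_comp, Category.assoc, ← hG.map_discard]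

end IsCausalFunctor

/-- A fully faithful causal functor that is essentially surjective up to causal isomorphism is an
equivalence with causal unit, counit and inverse: the counit consists of the given isomorphisms, and
`F` reflects causality. -/
theorem exists_causal_inverse {F : C ⥤ D} [F.Full] [F.Faithful] (hF : IsCausalFunctor F)
    (h : ∀ B : D, ∃ (A : C) (e : F.obj A ≅ B), Causal e.hom) :
    ∃ e : C ≌ D, e.functor = F ∧ IsCausalFunctor e.inverse ∧
      (∀ A, Causal (e.unit.app A)) ∧ ∀ B, Causal (e.counit.app B) := by
  choose g φ hφ using h
  have hφ' : ∀ B, Causal (φ B).inv := fun B => (hφ B).iso_inv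
  let G : D ⥤ C :=
    { obj := g
      map := fun {B B'} f => F.preimage ((φ B).hom ≫ f ≫ (φ B').inv)
      map_id := fun B => F.map_injective (by simp)
      map_comp := fun f f' => F.map_injective (by simp) }
  have hG : ∀ {B B' : D} (f : B ⟶ B'), F.map (G.map f) = (φ B).hom ≫ f ≫ (φ B').inv :=
    fun f => F.map_preimage _
  let e : C ≌ D :=
    { functor := F
      inverse := G
      unitIso := NatIso.ofComponents (fun A => F.preimageIso (φ (F.obj A)).symm)
        fun f => F.map_injective (by
          simp only [Functor.id_map, Functor.map_comp, Functor.comp_map, hG]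
          simp)
      counitIso := NatIso.ofComponents (fun B => φ B) fun f => by
        simp only [Functor.comp_map, hG]
        simp
      functor_unitIso_comp := fun A => by simp }
  have hiso : IsIso (discard (g (𝟙_ D))) := by
    have := hF.isIso_discard
    have h1 : F.map (discard (g (𝟙_ D))) =
        (φ (𝟙_ D)).hom ≫ inv (discard (F.obj (𝟙_ C))) := by
      rw [IsIso.eq_comp_inv, ← hF.map_discard]
      have := hφ (𝟙_ D)
      rw [Causal, discard_unit, Category.comp_id] at this
      exact this.symm
    have : IsIso (F.map (discard (g (𝟙_ D)))) := by rw [h1]; infer_instance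
    exact isIso_of_reflects_iso _ F
  refine ⟨e, rfl, ⟨hiso, fun B => ?_⟩, fun A => hF.of_map ?_, hφ⟩
  · have hc : Causal (G.map (discard B)) ↔
        discard (G.obj B) = G.map (discard B) ≫ discard (G.obj (𝟙_ D)) := eq_comm
    refine hc.1 (hF.of_map ?_)
    rw [hG]
    refine (hφ B).comp (Causal.comp ?_ (hφ' _))
    rw [Causal, discard_unit, Category.comp_id]
  · have : F.map (e.unit.app A) = (φ (F.obj A)).inv := F.map_preimage _
    rw [this]
    exact hφ' _

theorem IsCausalMonoidalEquivalence.of_fullyFaithful {F : C ⥤ D} [F.Full] [F.Faithful]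
    (hF : IsCausalFunctor F)
    (hm : ∃ _ : F.Monoidal,
      Causal (Functor.LaxMonoidal.ε F) ∧ ∀ A B : C, Causal (Functor.LaxMonoidal.μ F A B))
    (h : ∀ B : D, ∃ (A : C) (e : F.obj A ≅ B), Causal e.hom) :
    IsCausalMonoidalEquivalence F := by
  refine ⟨hF, hm, ?_⟩
  obtain ⟨e, rfl, h1, h2, h3⟩ := exists_causal_inverse hF h
  exact ⟨e.inverse, e.unitIso, e.counitIso, h1, h2, h3⟩

namespace IsCausalMonoidalEquivalence

theorem isEquivalence {F : C ⥤ D} (h : IsCausalMonoidalEquivalence F) : F.IsEquivalence := by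
  obtain ⟨G, η, ε, -⟩ := h.equivalence
  exact (CategoryTheory.Equivalence.mk F G η ε).isEquivalence_functor

theorem exists_causal_iso {F : C ⥤ D} (h : IsCausalMonoidalEquivalence F) (B : D) :
    ∃ (A : C) (e : F.obj A ≅ B), Causal e.hom := by
  obtain ⟨G, η, ε, -, -, hε⟩ := h.equivalence
  exact ⟨G.obj B, ε.app B, hε B⟩

theorem comp [MonoidalDiscarding E] {F : C ⥤ D} {G : D ⥤ E}
    (hF : IsCausalMonoidalEquivalence F)
    (hG : IsCausalMonoidalEquivalence G) : IsCausalMonoidalEquivalence (F ⋙ G) := by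
  have := hF.isEquivalence
  have := hG.isEquivalence
  refine of_fullyFaithful (hF.causal.comp hG.causal) ?_ fun Z => ?_
  · obtain ⟨_, h1, h2⟩ := hF.monoidal
    obtain ⟨_, h3, h4⟩ := hG.monoidal
    refine ⟨inferInstance, ?_, fun A B => ?_⟩
    · rw [Functor.LaxMonoidal.comp_ε]
      exact h3.comp (hG.causal.map h1)
    · rw [Functor.LaxMonoidal.comp_μ]
      exact (h4 _ _).comp (hG.causal.map (h2 _ _))
  · obtain ⟨B, e, he⟩ := hG.exists_causal_iso Z
    obtain ⟨A, f, hf⟩ := hF.exists_causal_iso B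
    exact ⟨A, G.mapIso f ≪≫ e, (hG.causal.map hf).comp he⟩

/-- The inverse of a causal monoidal equivalence is one, and the unit and the counit are causal. -/
theorem exists_inverse [MonoidalDiscarding D] {F : C ⥤ D} (hF : IsCausalMonoidalEquivalence F) :
    ∃ G : D ⥤ C, IsCausalMonoidalEquivalence G ∧ CausallyIsomorphic (G ⋙ F) (𝟭 D) ∧
      CausallyIsomorphic (F ⋙ G) (𝟭 C) := by
  have := hF.isEquivalence
  obtain ⟨e, rfl, h1, h2, h3⟩ := exists_causal_inverse hF.causal hF.exists_causal_iso
  obtain ⟨_, h4, h5⟩ := hF.monoidal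
  have hη : Causal (Functor.OplaxMonoidal.η e.functor) :=
    Causal.iso_inv (e := Functor.Monoidal.εIso e.functor) h4
  have hδ : ∀ A B, Causal (Functor.OplaxMonoidal.δ e.functor A B) := fun A B =>
    Causal.iso_inv (e := Functor.Monoidal.μIso e.functor A B) (h5 A B)
  refine ⟨e.inverse, of_fullyFaithful h1 ⟨e.inverseMonoidal, ?_, fun A B => ?_⟩ fun A =>
    ⟨e.functor.obj A, e.unitIso.symm.app A, Causal.iso_hom (h2 A)⟩, ⟨e.counitIso, h3⟩,
    ⟨e.unitIso.symm, fun A => Causal.iso_inv (e := e.unitIso.app A) (h2 A)⟩⟩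
  · exact (h2 _).comp (h1.map hη)
  · exact (h2 _).comp (h1.map ((hδ _ _).comp ((h3 _).tensor (h3 _))))

end IsCausalMonoidalEquivalence

theorem CausallyIsomorphic.trans {B : Type*} [Category* B] {F G H : B ⥤ D}
    (h : CausallyIsomorphic F G) (h' : CausallyIsomorphic G H) : CausallyIsomorphic F H := by
  obtain ⟨φ, hφ⟩ := h
  obtain ⟨ψ, hψ⟩ := h'
  exact ⟨φ ≪≫ ψ, fun A => (hφ A).comp (hψ A)⟩

theorem CausallyIsomorphic.whiskerRight {B : Type*} [Category* B] {F G : B ⥤ D}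
    (h : CausallyIsomorphic F G) {H : D ⥤ E} (hH : IsCausalFunctor H) :
    CausallyIsomorphic (F ⋙ H) (G ⋙ H) := by
  obtain ⟨φ, hφ⟩ := h
  exact ⟨Functor.isoWhiskerRight φ H, fun A => hH.map (hφ A)⟩

theorem CausallyIsomorphic.whiskerLeft {A B : Type*} [Category* A] [Category* B] {F G : B ⥤ D}
    (h : CausallyIsomorphic F G) (H : A ⥤ B) : CausallyIsomorphic (H ⋙ F) (H ⋙ G) := by
  obtain ⟨φ, hφ⟩ := h
  exact ⟨Functor.isoWhiskerLeft H φ, fun A => hφ _⟩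

end CausalEquivalence

/-! ### Sums of morphisms in full subcategories and in the Karoubi envelope -/

section FullSubcategory

variable {E : Type*} [Category* E] (P : ObjectProperty E)

noncomputable instance [SemiAdditive E] : SemiAdditive P.FullSubcategory where
  homAddCommMonoid _ _ := InducedCategory.homEquiv.addCommMonoid
  add_comp f g h := P.hom_ext (SemiAdditive.add_comp f.hom g.hom h.hom)
  comp_add f g h := P.hom_ext (SemiAdditive.comp_add f.hom g.hom h.hom)
  zero_comp h := P.hom_ext (SemiAdditive.zero_comp h.hom)
  comp_zero h := P.hom_ext (SemiAdditive.comp_zero h.hom)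

theorem fullSubcategory_sum_hom [SemiAdditive E] {A B : P.FullSubcategory} {ι : Type*}
    (s : Finset ι) (f : ι → (A ⟶ B)) : (∑ i ∈ s, f i).hom = ∑ i ∈ s, (f i).hom :=
  map_sum (⟨⟨fun f => f.hom, rfl⟩, fun _ _ => rfl⟩ : (A ⟶ B) →+ (A.obj ⟶ B.obj)) f s

variable [MonoidalCategory E] [P.IsMonoidal]

instance [SemiAdditive E] [SemiAdditiveMonoidal E] : SemiAdditiveMonoidal P.FullSubcategory where
  tensor_add f g h := P.hom_ext (SemiAdditiveMonoidal.tensor_add f.hom g.hom h.hom)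
  add_tensor f g h := P.hom_ext (SemiAdditiveMonoidal.add_tensor f.hom g.hom h.hom)
  tensor_zero f := P.hom_ext (SemiAdditiveMonoidal.tensor_zero f.hom)
  zero_tensor f := P.hom_ext (SemiAdditiveMonoidal.zero_tensor f.hom)

instance [Discarding E] [MonoidalDiscarding E] : MonoidalDiscarding P.FullSubcategory where
  discard_tensor A B := P.hom_ext (MonoidalDiscarding.discard_tensor A.obj B.obj)

theorem causal_fullSubcategory_iff [Discarding E] {A B : P.FullSubcategory} (f : A ⟶ B) :
    Causal f ↔ Causal f.hom :=
  ⟨fun h => congrArg InducedCategory.Hom.hom h, fun h => P.hom_ext h⟩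

end FullSubcategory

section Karoubi

open Idempotents

variable {E : Type*} [Category* E]

section

variable [SemiAdditive E]

instance (P Q : Karoubi E) : Zero (P ⟶ Q) :=
  ⟨⟨0, by rw [SemiAdditive.zero_comp, SemiAdditive.comp_zero]⟩⟩

instance (P Q : Karoubi E) : Add (P ⟶ Q) :=
  ⟨fun f g => ⟨f.f + g.f, by
    rw [SemiAdditive.add_comp, SemiAdditive.comp_add, f.comm, g.comm]⟩⟩

instance : SemiAdditive (Karoubi E) where
  homAddCommMonoid P Q :=
    { add_assoc := fun f g h => Karoubi.hom_ext _ _ (add_assoc f.f g.f h.f)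
      zero_add := fun f => Karoubi.hom_ext _ _ (zero_add f.f)
      add_zero := fun f => Karoubi.hom_ext _ _ (add_zero f.f)
      add_comm := fun f g => Karoubi.hom_ext _ _ (add_comm f.f g.f)
      nsmul := nsmulRec }
  add_comp f g h := Karoubi.hom_ext _ _ (SemiAdditive.add_comp f.f g.f h.f)
  comp_add f g h := Karoubi.hom_ext _ _ (SemiAdditive.comp_add f.f g.f h.f)
  zero_comp h := Karoubi.hom_ext _ _ (SemiAdditive.zero_comp h.f)
  comp_zero h := Karoubi.hom_ext _ _ (SemiAdditive.comp_zero h.f)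

theorem karoubi_sum_f {P Q : Karoubi E} {ι : Type*} (s : Finset ι) (f : ι → (P ⟶ Q)) :
    (∑ i ∈ s, f i).f = ∑ i ∈ s, (f i).f :=
  map_sum (⟨⟨fun f => f.f, rfl⟩, fun _ _ => rfl⟩ : (P ⟶ Q) →+ (P.X ⟶ Q.X)) f s

end

variable [MonoidalCategory E]

instance [SemiAdditive E] [SemiAdditiveMonoidal E] : SemiAdditiveMonoidal (Karoubi E) where
  tensor_add f g h := Karoubi.hom_ext _ _ (SemiAdditiveMonoidal.tensor_add f.f g.f h.f)
  add_tensor f g h := Karoubi.hom_ext _ _ (SemiAdditiveMonoidal.add_tensor f.f g.f h.f)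
  tensor_zero f := Karoubi.hom_ext _ _ (SemiAdditiveMonoidal.tensor_zero f.f)
  zero_tensor f := Karoubi.hom_ext _ _ (SemiAdditiveMonoidal.zero_tensor f.f)

variable [Discarding E]

theorem karoubi_discard_f (P : Karoubi E) : (discard P).f = P.p ≫ discard P.X := rfl

theorem causal_karoubi_iff {P Q : Karoubi E} (hQ : Causal Q.p) (hP : Causal P.p) (f : P ⟶ Q) :
    Causal f ↔ Causal f.f := by
  unfold Causal at *
  rw [Karoubi.hom_ext_iff, Karoubi.comp_f, karoubi_discard_f, karoubi_discard_f, hQ, hP]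

variable [MonoidalDiscarding E]

instance : MonoidalDiscarding (Karoubi E) where
  discard_tensor P Q := by
    apply Karoubi.hom_ext
    change (P.p ⊗ₘ Q.p) ≫ discard (P.X ⊗ Q.X) = ((P.p ≫ discard P.X) ⊗ₘ (Q.p ≫ discard Q.X)) ≫
      (𝟙 (𝟙_ E) ⊗ₘ 𝟙 (𝟙_ E)) ≫ (λ_ (𝟙_ E)).hom
    rw [MonoidalDiscarding.discard_tensor, id_tensorHom_id, Category.id_comp,
      tensorHom_comp_tensorHom_assoc]

/-- The functor `A ↦ (A, 𝟙 A)` is monoidal. -/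
def toKaroubiCoreMonoidal : (toKaroubi E).CoreMonoidal where
  εIso := Iso.refl _
  μIso A B :=
    { hom := ⟨𝟙 (A ⊗ B), by simp [karoubi_tensorObj_p]; exact Category.id_comp _⟩
      inv := ⟨𝟙 (A ⊗ B), by simp [karoubi_tensorObj_p]⟩
      hom_inv_id := by
        ext
        exact (Category.id_comp _).trans (id_tensorHom_id A B).symm
      inv_hom_id := by ext; simp }
  μIso_hom_natural_left {A B} f D := by
    ext
    change (f ⊗ₘ 𝟙 D) ≫ 𝟙 _ = 𝟙 _ ≫ f ▷ D
    simp
  μIso_hom_natural_right {A B} D f := by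
    ext
    change (𝟙 D ⊗ₘ f) ≫ 𝟙 _ = 𝟙 _ ≫ D ◁ f
    simp
  associativity A B D := by
    ext
    change (𝟙 (A ⊗ B) ⊗ₘ 𝟙 D) ≫ 𝟙 _ ≫ (α_ A B D).hom =
      (((𝟙 A ⊗ₘ 𝟙 B) ⊗ₘ 𝟙 D) ≫ (α_ A B D).hom) ≫ (𝟙 A ⊗ₘ 𝟙 (B ⊗ D)) ≫ 𝟙 _
    simp
  left_unitality A := by
    ext
    change (𝟙 (𝟙_ E) ⊗ₘ 𝟙 A) ≫ (λ_ A).hom = (𝟙 (𝟙_ E) ⊗ₘ 𝟙 A) ≫ 𝟙 _ ≫ (λ_ A).hom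
    simp
  right_unitality A := by
    ext
    change (𝟙 A ⊗ₘ 𝟙 (𝟙_ E)) ≫ (ρ_ A).hom = (𝟙 A ⊗ₘ 𝟙 (𝟙_ E)) ≫ 𝟙 _ ≫ (ρ_ A).hom
    simp

end Karoubi

/-- The data that make a functor into a full subcategory monoidal, lifted from the ambient
category. -/
def liftCoreMonoidal {E D : Type*} [Category* E] [Category* D] [MonoidalCategory E]
    [MonoidalCategory D] (P : ObjectProperty D) [P.IsMonoidal] (F : E ⥤ D)
    (hF : ∀ A, P (F.obj A)) (m : F.CoreMonoidal) : (P.lift F hF).CoreMonoidal where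
  εIso := P.isoMk m.εIso
  μIso A B := P.isoMk (m.μIso A B)
  μIso_hom_natural_left f A := P.hom_ext (m.μIso_hom_natural_left f A)
  μIso_hom_natural_right A f := P.hom_ext (m.μIso_hom_natural_right A f)
  associativity A B D := P.hom_ext (m.associativity A B D)
  left_unitality A := P.hom_ext (m.left_unitality A)
  right_unitality A := P.hom_ext (m.right_unitality A)

/-! ### Causal sums and functors out of the biproduct completion -/

section CausalSum

variable {E : Type*} [Category* E] [SemiAdditive E]
  {T : Type*} [Category* T] [SemiAdditive T] [MonoidalCategory T] [Discarding T]

/-- `Z` is the biproduct of the images under `F` of the members of the family `M`, by means of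
causal injections. -/
structure CausalSum (F : E ⥤ T) (M : BiprodCompletion E) (Z : T) where
  /-- The injections. -/
  inj : ∀ i, F.obj (M.X i) ⟶ Z
  /-- The projections. -/
  proj : ∀ i, Z ⟶ F.obj (M.X i)
  inj_proj : ∀ i, inj i ≫ proj i = 𝟙 _
  inj_proj_of_ne : ∀ i j, i ≠ j → inj i ≫ proj j = 0
  sum_proj_inj : ∑ i, proj i ≫ inj i = 𝟙 Z
  causal_inj : ∀ i, Causal (inj i)

namespace CausalSum

variable {F : E ⥤ T} {M : BiprodCompletion E} {Z : T}

theorem hom_ext (c : CausalSum F M Z) {W : T} {f g : Z ⟶ W}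
    (h : ∀ i, c.inj i ≫ f = c.inj i ≫ g) : f = g := by
  rw [← Category.id_comp f, ← Category.id_comp g, ← c.sum_proj_inj, sum_comp, sum_comp]
  exact Finset.sum_congr rfl fun i _ => by rw [Category.assoc, Category.assoc, h]

theorem causal_of_inj (c : CausalSum F M Z) {W : T} {f : Z ⟶ W}
    (h : ∀ i, Causal (c.inj i ≫ f)) : Causal f := by
  refine c.hom_ext fun i => ?_
  have h1 := h i
  have h2 := c.causal_inj i
  unfold Causal at h1 h2
  rw [h2, ← h1, Category.assoc]

theorem inj_sum (c : CausalSum F M Z) {W : T} (g : ∀ i, F.obj (M.X i) ⟶ W) (i : M.ι) :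
    c.inj i ≫ ∑ j, c.proj j ≫ g j = g i := by
  rw [comp_sum, Finset.sum_eq_single i]
  · rw [← Category.assoc, c.inj_proj, Category.id_comp]
  · intro j _ hj
    rw [← Category.assoc, c.inj_proj_of_ne i j hj.symm, SemiAdditive.zero_comp]
  · simp

/-- The comparison of two sums of the same family. -/
def iso {Z' : T} (c : CausalSum F M Z) (c' : CausalSum F M Z') : Z ≅ Z' where
  hom := ∑ i, c.proj i ≫ c'.inj i
  inv := ∑ i, c'.proj i ≫ c.inj i
  hom_inv_id := c.hom_ext fun i => by
    rw [← Category.assoc, c.inj_sum, c'.inj_sum, Category.comp_id]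
  inv_hom_id := c'.hom_ext fun i => by
    rw [← Category.assoc, c'.inj_sum, c.inj_sum, Category.comp_id]

theorem causal_iso {Z' : T} (c : CausalSum F M Z) (c' : CausalSum F M Z') :
    Causal (c.iso c').hom :=
  c.causal_of_inj fun i => by
    rw [iso, c.inj_sum]
    exact c'.causal_inj i

/-- A sum stays a sum along a causal isomorphism. -/
def ofIso {Z' : T} (c : CausalSum F M Z) (e : Z ≅ Z') (he : Causal e.hom) : CausalSum F M Z' where
  inj i := c.inj i ≫ e.hom
  proj i := e.inv ≫ c.proj i
  inj_proj i := by simp [c.inj_proj]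
  inj_proj_of_ne i j h := by simp [c.inj_proj_of_ne i j h]
  sum_proj_inj := by
    have h : ∀ i, (e.inv ≫ c.proj i) ≫ c.inj i ≫ e.hom = e.inv ≫ (c.proj i ≫ c.inj i) ≫ e.hom :=
      fun i => by simp
    simp only [h]
    rw [← comp_sum, ← sum_comp, c.sum_proj_inj, Category.id_comp, e.inv_hom_id]
  causal_inj i := (c.causal_inj i).comp he

end CausalSum

section Functor

variable {F : E ⥤ T} {S : BiprodCompletion E → T} (c : ∀ M, CausalSum F M (S M))
  (h0 : ∀ A B, F.map (0 : A ⟶ B) = 0)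
  (hadd : ∀ {A B} (f g : A ⟶ B), F.map (f + g) = F.map f + F.map g)

include h0 hadd in
theorem map_sum_of_additive {ι : Type*} (s : Finset ι) {A B : E} (f : ι → (A ⟶ B)) :
    F.map (∑ i ∈ s, f i) = ∑ i ∈ s, F.map (f i) :=
  map_sum (⟨⟨fun f => F.map f, h0 A B⟩, hadd⟩ : (A ⟶ B) →+ (F.obj A ⟶ F.obj B)) f s

/-- The action on morphisms of the extension of `F` to the biproduct completion. -/
def sumMap {M N : BiprodCompletion E} (f : M ⟶ N) : S M ⟶ S N :=
  ∑ i, (c M).proj i ≫ ∑ j, F.map (f i j) ≫ (c N).inj j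

theorem inj_sumMap {M N : BiprodCompletion E} (f : M ⟶ N) (i : M.ι) :
    (c M).inj i ≫ sumMap c f = ∑ j, F.map (f i j) ≫ (c N).inj j :=
  (c M).inj_sum _ i

include h0 in
theorem inj_sumMap_of_single {M N : BiprodCompletion E} (f : M ⟶ N) (i : M.ι) (j : N.ι)
    (h : ∀ k, k ≠ j → f i k = 0) :
    (c M).inj i ≫ sumMap c f = F.map (f i j) ≫ (c N).inj j := by
  rw [inj_sumMap, Finset.sum_eq_single j]
  · intro k _ hk
    rw [h k hk, h0, SemiAdditive.zero_comp]
  · simp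

/-- The extension of `F` to the biproduct completion, for a choice of sums. -/
def sumFunctor : BiprodCompletion E ⥤ T where
  obj := S
  map f := sumMap c f
  map_id M := (c M).hom_ext fun i => by
    have hi : (𝟙 M : M ⟶ M) i i = 𝟙 _ := dif_pos rfl
    rw [inj_sumMap_of_single c h0 _ i i fun k hk => dif_neg hk.symm, hi]
    simp
  map_comp {M N K} f g := (c M).hom_ext fun i => by
    have h1 : ∀ k, F.map ((f ≫ g) i k) = ∑ j, F.map (f i j) ≫ F.map (g j k) := fun k => by
      rw [BiprodCompletion.comp_apply, map_sum_of_additive h0 hadd]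
      simp only [F.map_comp]
    rw [← Category.assoc, inj_sumMap, inj_sumMap, sum_comp]
    simp only [Category.assoc, inj_sumMap, h1, comp_sum, sum_comp]
    rw [Finset.sum_comm]

theorem inj_sumMap_proj {M N : BiprodCompletion E} (f : M ⟶ N) (i : M.ι) (j : N.ι) :
    (c M).inj i ≫ sumMap c f ≫ (c N).proj j = F.map (f i j) := by
  rw [← Category.assoc, inj_sumMap, sum_comp, Finset.sum_eq_single j]
  · rw [Category.assoc, (c N).inj_proj, Category.comp_id]
  · intro k _ hk
    rw [Category.assoc, (c N).inj_proj_of_ne k j hk, SemiAdditive.comp_zero]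
  · simp

theorem exists_eq_sumMap [F.Full] {M N : BiprodCompletion E} (g : S M ⟶ S N) :
    ∃ f : M ⟶ N, sumMap c f = g := by
  refine ⟨fun i j => F.preimage ((c M).inj i ≫ g ≫ (c N).proj j), (c M).hom_ext fun i => ?_⟩
  rw [inj_sumMap]
  simp only [F.map_preimage, Category.assoc]
  rw [← comp_sum, ← comp_sum, (c N).sum_proj_inj, Category.comp_id]

instance sumFunctor_faithful [F.Faithful] : (sumFunctor c h0 hadd).Faithful where
  map_injective {M N f g} h := by
    have h' : sumMap c f = sumMap c g := h
    funext i j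
    apply F.map_injective
    rw [← inj_sumMap_proj c f, h', inj_sumMap_proj]

instance sumFunctor_full [F.Full] : (sumFunctor c h0 hadd).Full where
  map_surjective g := exists_eq_sumMap c g

/-- The sum of a family with one member is that member. -/
noncomputable def singleIso (A : E) : S ((BiprodCompletion.incl E).obj A) ≅ F.obj A where
  hom := (c _).proj ()
  inv := (c ((BiprodCompletion.incl E).obj A)).inj ()
  hom_inv_id := by
    have h := (c ((BiprodCompletion.incl E).obj A)).sum_proj_inj
    exact (Fintype.sum_unique (ι := Unit) _).symm.trans h
  inv_hom_id := (c ((BiprodCompletion.incl E).obj A)).inj_proj ()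

theorem incl_sumFunctor :
    CausallyIsomorphic (BiprodCompletion.incl E ⋙ sumFunctor c h0 hadd) F := by
  refine ⟨NatIso.ofComponents (fun A => singleIso c A) fun {A B} f => ?_, fun A =>
    Causal.iso_hom ((c ((BiprodCompletion.incl E).obj A)).causal_inj ())⟩
  change sumMap c ((BiprodCompletion.incl E).map f) ≫ (singleIso c B).hom =
    (singleIso c A).hom ≫ F.map f
  rw [← cancel_epi (singleIso c A).inv, Iso.inv_hom_id_assoc]
  exact inj_sumMap_proj c ((BiprodCompletion.incl E).map f) () ()

section Discard

variable [MonoidalCategory E] [SemiAdditiveMonoidal E] [Discarding E]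

theorem isCausalFunctor_sumFunctor (hF : IsCausalFunctor F) :
    IsCausalFunctor (sumFunctor c h0 hadd) where
  isIso_discard := by
    have := hF.isIso_discard
    have h : Causal (singleIso c (𝟙_ E)).hom :=
      Causal.iso_hom ((c ((BiprodCompletion.incl E).obj (𝟙_ E))).causal_inj ())
    unfold Causal at h
    have h1 : IsIso (discard (S ((BiprodCompletion.incl E).obj (𝟙_ E)))) := by
      rw [← h]
      infer_instance
    exact h1
  map_discard M := (c M).hom_ext fun i => by
    have h1 := (c M).causal_inj i
    have h2 := (c (𝟙_ (BiprodCompletion E))).causal_inj ()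
    have h3 : (c M).inj i ≫ sumMap c (discard M) =
        F.map (discard (M.X i)) ≫ (c (𝟙_ (BiprodCompletion E))).inj () :=
      inj_sumMap_of_single c h0 (discard M) i () fun k hk => (hk rfl).elim
    change (c M).inj i ≫ discard (S M) =
      (c M).inj i ≫ sumMap c (discard M) ≫ discard (S (𝟙_ (BiprodCompletion E)))
    unfold Causal at h1 h2
    rw [h1, hF.map_discard, reassoc_of% h3, h2]
    rfl

end Discard

section Monoidal

open BiprodCompletion

variable [SemiAdditiveMonoidal T]

omit [Discarding T] in
theorem tensor_hom_ext {Z Z' W : T} {I J : Type} [Fintype I] [Fintype J] {X : I → T} {Y : J → T}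
    {k : ∀ i, X i ⟶ Z} {r : ∀ i, Z ⟶ X i} {k' : ∀ j, Y j ⟶ Z'} {r' : ∀ j, Z' ⟶ Y j}
    (h : ∑ i, r i ≫ k i = 𝟙 Z) (h' : ∑ j, r' j ≫ k' j = 𝟙 Z') {f g : Z ⊗ Z' ⟶ W}
    (hfg : ∀ i j, (k i ⊗ₘ k' j) ≫ f = (k i ⊗ₘ k' j) ≫ g) : f = g := by
  rw [← Category.id_comp f, ← Category.id_comp g, ← id_tensorHom_id, ← h, ← h']
  simp only [sum_tensor, tensor_sum, sum_comp]
  refine Finset.sum_congr rfl fun i _ => Finset.sum_congr rfl fun j _ => ?_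
  rw [← tensorHom_comp_tensorHom, Category.assoc, Category.assoc, hfg]

variable [MonoidalCategory E] [SemiAdditiveMonoidal E] [F.Monoidal]

open Functor.LaxMonoidal Functor.OplaxMonoidal

/-- The tensor product of two sums is the sum of the tensor products. -/
noncomputable def tensorSumIso (M N : BiprodCompletion E) : S M ⊗ S N ≅ S (M ⊗ N) where
  hom := ∑ i : M.ι, ∑ j : N.ι, ((c M).proj i ⊗ₘ (c N).proj j) ≫ μ F _ _ ≫ (c (M ⊗ N)).inj (i, j)
  inv := ∑ p : M.ι × N.ι, (c (M ⊗ N)).proj p ≫ δ F _ _ ≫ ((c M).inj p.1 ⊗ₘ (c N).inj p.2)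
  hom_inv_id := by
    simp only [sum_comp, Category.assoc]
    have h : ∀ i j, (c (M ⊗ N)).inj (i, j) ≫ ∑ p : M.ι × N.ι, (c (M ⊗ N)).proj p ≫ δ F _ _ ≫
        ((c M).inj p.1 ⊗ₘ (c N).inj p.2) = δ F _ _ ≫ ((c M).inj i ⊗ₘ (c N).inj j) := fun i j =>
      (c (M ⊗ N)).inj_sum (fun p => δ F _ _ ≫ ((c M).inj p.1 ⊗ₘ (c N).inj p.2)) (i, j)
    simp only [h, Functor.Monoidal.μ_δ_assoc, tensorHom_comp_tensorHom]
    simp only [← tensor_sum, ← sum_tensor, (c M).sum_proj_inj, (c N).sum_proj_inj,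
      id_tensorHom_id]
  inv_hom_id := (c (M ⊗ N)).hom_ext fun p => by
    obtain ⟨i, j⟩ := p
    rw [← Category.assoc]
    refine (congrArg (· ≫ _) ((c (M ⊗ N)).inj_sum (fun p => δ F _ _ ≫
      ((c M).inj p.1 ⊗ₘ (c N).inj p.2)) (i, j))).trans ?_
    have h : ((c M).inj i ⊗ₘ (c N).inj j) ≫ ∑ i : M.ι, ∑ j : N.ι,
        ((c M).proj i ⊗ₘ (c N).proj j) ≫ μ F _ _ ≫ (c (M ⊗ N)).inj (i, j) =
          μ F _ _ ≫ (c (M ⊗ N)).inj (i, j) := by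
      simp only [comp_sum, tensorHom_comp_tensorHom_assoc]
      rw [Finset.sum_eq_single i, Finset.sum_eq_single j]
      · simp [(c M).inj_proj, (c N).inj_proj]
      · intro k _ hk
        rw [(c N).inj_proj_of_ne j k hk.symm, SemiAdditiveMonoidal.tensor_zero,
          SemiAdditive.zero_comp]
      · simp
      · intro k _ hk
        refine Finset.sum_eq_zero fun l _ => ?_
        rw [(c M).inj_proj_of_ne i k hk.symm, SemiAdditiveMonoidal.zero_tensor,
          SemiAdditive.zero_comp]
      · simp
    rw [Category.assoc, h, Functor.Monoidal.δ_μ_assoc, Category.comp_id]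

theorem inj_tensorSumIso {M N : BiprodCompletion E} (i : M.ι) (j : N.ι) :
    ((c M).inj i ⊗ₘ (c N).inj j) ≫ (tensorSumIso c M N).hom =
      μ F _ _ ≫ (c (M ⊗ N)).inj (i, j) := by
  rw [← cancel_mono (tensorSumIso c M N).inv, Category.assoc, Iso.hom_inv_id, Category.comp_id,
    Category.assoc]
  refine Eq.trans ?_ (congrArg (μ F _ _ ≫ ·) ((c (M ⊗ N)).inj_sum (fun p => δ F _ _ ≫
      ((c M).inj p.1 ⊗ₘ (c N).inj p.2)) (i, j))).symm
  rw [Functor.Monoidal.μ_δ_assoc]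

/-- The unit of the monoidal structure on the extension of `F`. -/
noncomputable def unitSumIso : 𝟙_ T ≅ S (𝟙_ (BiprodCompletion E)) :=
  Functor.Monoidal.εIso F ≪≫ (singleIso c (𝟙_ E)).symm

theorem unitSumIso_hom : (unitSumIso c).hom =
    ε F ≫ (c (𝟙_ (BiprodCompletion E))).inj () := rfl

include h0 in
theorem inj_sumMap_mono {M N : BiprodCompletion E} (f : M.ι → N.ι)
    (φ : ∀ i, M.X i ⟶ N.X (f i)) (i : M.ι) :
    (c M).inj i ≫ sumMap c (mono f φ) = F.map (φ i) ≫ (c N).inj (f i) := by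
  rw [inj_sumMap_of_single c h0 _ i (f i) fun k hk => mono_apply_of_ne _ _ hk.symm]
  simp [mono]

theorem tensor_hom_ext₃ {M N K : BiprodCompletion E} {W : T} {f g : (S M ⊗ S N) ⊗ S K ⟶ W}
    (h : ∀ i j k, (((c M).inj i ⊗ₘ (c N).inj j) ⊗ₘ (c K).inj k) ≫ f =
      (((c M).inj i ⊗ₘ (c N).inj j) ⊗ₘ (c K).inj k) ≫ g) : f = g := by
  have h1 : ∑ p : M.ι × N.ι, ((c M).proj p.1 ⊗ₘ (c N).proj p.2) ≫
      ((c M).inj p.1 ⊗ₘ (c N).inj p.2) = 𝟙 (S M ⊗ S N) := by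
    simp only [tensorHom_comp_tensorHom, Fintype.sum_prod_type]
    simp only [← tensor_sum, ← sum_tensor, (c M).sum_proj_inj, (c N).sum_proj_inj,
      id_tensorHom_id]
  exact tensor_hom_ext h1 (c K).sum_proj_inj fun p k => h p.1 p.2 k

theorem tensorSumIso_natural {M N M' N' : BiprodCompletion E} (f : M ⟶ N) (g : M' ⟶ N') :
    (sumMap c f ⊗ₘ sumMap c g) ≫ (tensorSumIso c N N').hom =
      (tensorSumIso c M M').hom ≫ sumMap c (f ⊗ₘ g) := by
  refine tensor_hom_ext (c M).sum_proj_inj (c M').sum_proj_inj fun i j => ?_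
  rw [tensorHom_comp_tensorHom_assoc, inj_sumMap, inj_sumMap, reassoc_of% inj_tensorSumIso]
  have h : (c (M ⊗ M')).inj (i, j) ≫ sumMap c (f ⊗ₘ g) = ∑ p : N.ι × N'.ι,
    F.map (f i p.1 ⊗ₘ g j p.2) ≫ (c (N ⊗ N')).inj p := inj_sumMap c (f ⊗ₘ g) (i, j)
  rw [h, Fintype.sum_prod_type]
  simp only [sum_tensor, tensor_sum, sum_comp, comp_sum]
  rw [Finset.sum_comm]
  refine Finset.sum_congr rfl fun k _ => Finset.sum_congr rfl fun l _ => ?_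
  rw [← tensorHom_comp_tensorHom, Category.assoc, inj_tensorSumIso,
    Functor.LaxMonoidal.μ_natural_assoc]

/-- The extension of a monoidal functor to the biproduct completion is monoidal. -/
noncomputable def sumFunctorCoreMonoidal : (sumFunctor c h0 hadd).CoreMonoidal where
  εIso := unitSumIso c
  μIso M N := tensorSumIso c M N
  μIso_hom_natural_left {M N} f K := by
    have h := tensorSumIso_natural c f (𝟙 K)
    have hid : sumMap c (𝟙 K) = 𝟙 (S K) := (sumFunctor c h0 hadd).map_id K
    rw [hid, tensorHom_id, tensorHom_id] at h
    exact h
  μIso_hom_natural_right {M N} K f := by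
    have h := tensorSumIso_natural c (𝟙 K) f
    have hid : sumMap c (𝟙 K) = 𝟙 (S K) := (sumFunctor c h0 hadd).map_id K
    rw [hid, id_tensorHom, id_tensorHom] at h
    exact h
  associativity M N K := by
    refine tensor_hom_ext₃ c fun i j k => ?_
    change (((c M).inj i ⊗ₘ (c N).inj j) ⊗ₘ (c K).inj k) ≫ ((tensorSumIso c M N).hom ▷ S K) ≫
      (tensorSumIso c (M ⊗ N) K).hom ≫ sumMap c (α_ M N K).hom =
      (((c M).inj i ⊗ₘ (c N).inj j) ⊗ₘ (c K).inj k) ≫ (α_ (S M) (S N) (S K)).hom ≫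
        S M ◁ (tensorSumIso c N K).hom ≫ (tensorSumIso c M (N ⊗ K)).hom
    have h1 : (((c M).inj i ⊗ₘ (c N).inj j) ⊗ₘ (c K).inj k) ≫ ((tensorSumIso c M N).hom ▷ S K) =
        μ F _ _ ▷ _ ≫ ((c (M ⊗ N)).inj (i, j) ⊗ₘ (c K).inj k) := by
      rw [← tensorHom_id, tensorHom_comp_tensorHom, inj_tensorSumIso, Category.comp_id,
        ← tensorHom_id, tensorHom_comp_tensorHom, Category.id_comp]
    have h2 : ((c M).inj i ⊗ₘ (c N).inj j ⊗ₘ (c K).inj k) ≫ (S M ◁ (tensorSumIso c N K).hom) =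
        _ ◁ μ F _ _ ≫ ((c M).inj i ⊗ₘ (c (N ⊗ K)).inj (j, k)) := by
      rw [← id_tensorHom, tensorHom_comp_tensorHom, inj_tensorSumIso, Category.comp_id,
        ← id_tensorHom, tensorHom_comp_tensorHom, Category.id_comp]
    have h3 : (c ((M ⊗ N) ⊗ K)).inj ((i, j), k) ≫ sumMap c (α_ M N K).hom =
        F.map (α_ _ _ _).hom ≫ (c (M ⊗ N ⊗ K)).inj (i, j, k) :=
      inj_sumMap_mono c h0 _ _ _
    rw [associator_naturality_assoc, reassoc_of% h1, reassoc_of% h2, inj_tensorSumIso,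
      reassoc_of% inj_tensorSumIso, h3]
    exact Functor.LaxMonoidal.associativity_assoc F _ _ _ _
  left_unitality M := by
    have h : ∀ i, (𝟙 (𝟙_ T) ⊗ₘ (c M).inj i) ≫ (λ_ (S M)).hom = (𝟙 (𝟙_ T) ⊗ₘ (c M).inj i) ≫
        (unitSumIso c).hom ▷ S M ≫ (tensorSumIso c (𝟙_ _) M).hom ≫
          sumMap c (λ_ M).hom := fun i => by
      have h1 : (𝟙 (𝟙_ T) ⊗ₘ (c M).inj i) ≫ (unitSumIso c).hom ▷ S M =
          ε F ▷ _ ≫ ((c (𝟙_ (BiprodCompletion E))).inj () ⊗ₘ (c M).inj i) := by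
        rw [unitSumIso_hom, ← tensorHom_id, tensorHom_comp_tensorHom, ← tensorHom_id,
          tensorHom_comp_tensorHom]
        simp
      have h3 : (c (𝟙_ (BiprodCompletion E) ⊗ M)).inj ((), i) ≫ sumMap c (λ_ M).hom =
          F.map (λ_ _).hom ≫ (c M).inj i := inj_sumMap_mono c h0 _ _ _
      rw [reassoc_of% h1, reassoc_of% inj_tensorSumIso, h3, id_tensorHom, leftUnitor_naturality]
      exact Functor.LaxMonoidal.left_unitality_assoc F _ _
    have h2 : ∑ _u : Unit, 𝟙 (𝟙_ T) ≫ 𝟙 (𝟙_ T) = 𝟙 (𝟙_ T) := by simp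
    exact tensor_hom_ext h2 (c M).sum_proj_inj fun _ i => h i
  right_unitality M := by
    have h : ∀ i, ((c M).inj i ⊗ₘ 𝟙 (𝟙_ T)) ≫ (ρ_ (S M)).hom = ((c M).inj i ⊗ₘ 𝟙 (𝟙_ T)) ≫
        S M ◁ (unitSumIso c).hom ≫ (tensorSumIso c M (𝟙_ _)).hom ≫
          sumMap c (ρ_ M).hom := fun i => by
      have h1 : ((c M).inj i ⊗ₘ 𝟙 (𝟙_ T)) ≫ S M ◁ (unitSumIso c).hom =
          _ ◁ ε F ≫ ((c M).inj i ⊗ₘ (c (𝟙_ (BiprodCompletion E))).inj ()) := by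
        rw [unitSumIso_hom, ← id_tensorHom, tensorHom_comp_tensorHom, ← id_tensorHom,
          tensorHom_comp_tensorHom]
        simp
      have h3 : (c (M ⊗ 𝟙_ (BiprodCompletion E))).inj (i, ()) ≫ sumMap c (ρ_ M).hom =
          F.map (ρ_ _).hom ≫ (c M).inj i := inj_sumMap_mono c h0 _ _ _
      rw [reassoc_of% h1, reassoc_of% inj_tensorSumIso, h3, tensorHom_id, rightUnitor_naturality]
      exact Functor.LaxMonoidal.right_unitality_assoc F _ _
    have h2 : ∑ _u : Unit, 𝟙 (𝟙_ T) ≫ 𝟙 (𝟙_ T) = 𝟙 (𝟙_ T) := by simp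
    exact tensor_hom_ext (c M).sum_proj_inj h2 fun i _ => h i

theorem causal_unitSumIso (h : Causal (ε F)) : Causal (unitSumIso c).hom :=
  h.comp ((c (𝟙_ (BiprodCompletion E))).causal_inj ())

theorem causal_tensorSumIso [MonoidalDiscarding T] (h : ∀ A B, Causal (μ F A B))
    (M N : BiprodCompletion E) : Causal (tensorSumIso c M N).hom := by
  refine tensor_hom_ext (c M).sum_proj_inj (c N).sum_proj_inj fun i j => ?_
  have h1 := (h _ _).comp ((c (M ⊗ N)).causal_inj (i, j))
  have h2 := ((c M).causal_inj i).tensor ((c N).causal_inj j)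
  unfold Causal at h1 h2
  rw [reassoc_of% inj_tensorSumIso, h2, ← h1, Category.assoc]

end Monoidal

end Functor

/-- If all families have causal sums, and all objects of `T` are such sums, then `F` extends to a
causal monoidal equivalence of the biproduct completion with `T`. -/
theorem exists_extension [MonoidalCategory E] [SemiAdditiveMonoidal E] [Discarding E]
    [SemiAdditiveMonoidal T] [MonoidalDiscarding T] (F : E ⥤ T) [F.Full] [F.Faithful] [F.Monoidal]
    (hF : IsCausalFunctor F) (hε : Causal (Functor.LaxMonoidal.ε F))
    (hμ : ∀ A B, Causal (Functor.LaxMonoidal.μ F A B))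
    (h0 : ∀ A B, F.map (0 : A ⟶ B) = 0)
    (hadd : ∀ {A B} (f g : A ⟶ B), F.map (f + g) = F.map f + F.map g)
    (hsum : ∀ M : BiprodCompletion E, ∃ Z, Nonempty (CausalSum F M Z))
    (hsurj : ∀ Z : T, ∃ M : BiprodCompletion E, Nonempty (CausalSum F M Z)) :
    ∃ J : BiprodCompletion E ⥤ T, IsCausalMonoidalEquivalence J ∧
      CausallyIsomorphic (BiprodCompletion.incl E ⋙ J) F := by
  choose S c using hsum
  let c := fun M => (c M).some
  refine ⟨sumFunctor c h0 hadd, .of_fullyFaithful (isCausalFunctor_sumFunctor c h0 hadd hF)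
    ⟨(sumFunctorCoreMonoidal c h0 hadd).toMonoidal, causal_unitSumIso c hε,
      causal_tensorSumIso c hμ⟩ fun Z => ?_, incl_sumFunctor c h0 hadd⟩
  obtain ⟨M, ⟨d⟩⟩ := hsurj Z
  exact ⟨M, (c M).iso d, (c M).causal_iso d⟩

end CausalSum

/-! ### Splitting causal idempotents -/

section SplitCausal

open Idempotents

variable {E : Type*} [Category* E] [MonoidalCategory E] [Discarding E] [MonoidalDiscarding E]

instance : (toSplitCausal E).Full where
  map_surjective f := by
    obtain ⟨g, hg⟩ := (toKaroubi E).map_surjective f.hom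
    exact ⟨g, ObjectProperty.hom_ext _ hg⟩

instance : (toSplitCausal E).Faithful where
  map_injective {A B f g} h := by
    have h' : ((toSplitCausal E).map f).hom.f = ((toSplitCausal E).map g).hom.f := by rw [h]
    exact h'

theorem causal_splitCausal_iff {P Q : SplitCausal E} (f : P ⟶ Q) : Causal f ↔ Causal f.hom.f := by
  rw [causal_fullSubcategory_iff, causal_karoubi_iff Q.property P.property]

/-- The functor `A ↦ (A, 𝟙 A)` is monoidal. -/
def toSplitCausalCoreMonoidal : (toSplitCausal E).CoreMonoidal :=
  liftCoreMonoidal _ (toKaroubi E) _ toKaroubiCoreMonoidal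

theorem isCausalFunctor_toSplitCausal : IsCausalFunctor (toSplitCausal E) where
  isIso_discard := by
    have h : discard ((toSplitCausal E).obj (𝟙_ E)) = 𝟙 (𝟙_ (SplitCausal E)) :=
      discard_unit (C := SplitCausal E)
    rw [h]
    exact inferInstanceAs (IsIso (𝟙 (𝟙_ (SplitCausal E))))
  map_discard A := by
    apply ObjectProperty.hom_ext
    apply Karoubi.hom_ext
    change 𝟙 A ≫ discard A = discard A ≫ 𝟙 (𝟙_ E) ≫ discard (𝟙_ E)
    rw [discard_unit, Category.id_comp, Category.id_comp, Category.comp_id]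

variable (Q : ObjectProperty (SplitCausal E)) [Q.IsMonoidal]

theorem isCausalFunctor_ι : IsCausalFunctor Q.ι where
  isIso_discard := by
    have h : discard (Q.ι.obj (𝟙_ Q.FullSubcategory)) = 𝟙 (𝟙_ (SplitCausal E)) :=
      discard_unit (C := SplitCausal E)
    rw [h]
    exact inferInstanceAs (IsIso (𝟙 (𝟙_ (SplitCausal E))))
  map_discard A := by
    have h : discard (Q.ι.obj (𝟙_ Q.FullSubcategory)) = 𝟙 (𝟙_ (SplitCausal E)) :=
      discard_unit (C := SplitCausal E)
    rw [h]
    exact (Category.comp_id _).symm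

theorem isCausalFunctor_lift (hQ : ∀ A, Q ((toSplitCausal E).obj A)) :
    IsCausalFunctor (Q.lift (toSplitCausal E) hQ) where
  isIso_discard := by
    have h : discard ((Q.lift (toSplitCausal E) hQ).obj (𝟙_ E)) = 𝟙 (𝟙_ Q.FullSubcategory) :=
      discard_unit (C := Q.FullSubcategory)
    rw [h]
    exact inferInstanceAs (IsIso (𝟙 (𝟙_ Q.FullSubcategory)))
  map_discard A := Q.hom_ext (isCausalFunctor_toSplitCausal.map_discard A)

variable [SemiAdditive E]

/-- A splitting of the idempotent of `Z` through a family of objects presents `Z` as their sum. -/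
def causalSumOfSplitting {M : BiprodCompletion E} {Z : SplitCausal E} (m : ∀ i, M.X i ⟶ Z.obj.X)
    (e : ∀ i, Z.obj.X ⟶ M.X i) (h1 : ∀ i, m i ≫ e i = 𝟙 _) (h0 : ∀ i j, i ≠ j → m i ≫ e j = 0)
    (hp : ∑ i, e i ≫ m i = Z.obj.p) (hm : ∀ i, Causal (m i)) :
    CausalSum (toSplitCausal E) M Z :=
  have hmp : ∀ i, m i ≫ Z.obj.p = m i := fun i => by
    rw [← hp, comp_sum, Finset.sum_eq_single i]
    · rw [← Category.assoc, h1, Category.id_comp]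
    · intro j _ hj
      rw [← Category.assoc, h0 i j hj.symm, SemiAdditive.zero_comp]
    · simp
  have hpe : ∀ i, Z.obj.p ≫ e i = e i := fun i => by
    rw [← hp, sum_comp, Finset.sum_eq_single i]
    · rw [Category.assoc, h1, Category.comp_id]
    · intro j _ hj
      rw [Category.assoc, h0 j i hj, SemiAdditive.comp_zero]
    · simp
  { inj := fun i => ObjectProperty.homMk ⟨m i, (Category.id_comp _).trans (hmp i)⟩
    proj := fun i => ObjectProperty.homMk
      ⟨e i, (congrArg (_ ≫ ·) (Category.comp_id (e i))).trans (hpe i)⟩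
    inj_proj := fun i => ObjectProperty.hom_ext _ (Karoubi.hom_ext _ _ (h1 i))
    inj_proj_of_ne := fun i j h => ObjectProperty.hom_ext _ (Karoubi.hom_ext _ _ (h0 i j h))
    sum_proj_inj := by
      apply ObjectProperty.hom_ext
      apply Karoubi.hom_ext
      rw [fullSubcategory_sum_hom, karoubi_sum_f]
      exact hp
    causal_inj := fun i => (causal_splitCausal_iff _).2 (hm i) }

/-- A decomposition of the idempotent of `Z` presents `Z` as a causal sum. -/
theorem HasCausalFiniteDecomposition.exists_causalSum {Z : SplitCausal E}
    (h : HasCausalFiniteDecomposition Z.obj.p) :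
    ∃ M : BiprodCompletion E, Nonempty (CausalSum (toSplitCausal E) M Z) := by
  obtain ⟨n, B, e, m, h1, hm, h0, hp⟩ := h
  refine ⟨⟨Fin n, B⟩, ⟨causalSumOfSplitting m e h1 (fun i j hij => ?_) hp.symm hm⟩⟩
  -- the orthogonality of the summands `mᵢ ∘ eᵢ` is that of the `mᵢ` and `eⱼ`, as `eᵢ ∘ mᵢ = 1`
  have h2 := congrArg (fun f => m i ≫ f ≫ e j) (h0 i j hij)
  simp only [Category.assoc, SemiAdditive.comp_zero, SemiAdditive.zero_comp] at h2
  rwa [reassoc_of% h1 i, h1 j, Category.comp_id] at h2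

variable {Q}

/-- A sum in the ambient category is a sum in every full subcategory that contains it. -/
def CausalSum.lift {hQ : ∀ A, Q ((toSplitCausal E).obj A)} {M : BiprodCompletion E}
    {Z : Q.FullSubcategory} (c : CausalSum (toSplitCausal E) M Z.obj) :
    CausalSum (Q.lift (toSplitCausal E) hQ) M Z where
  inj i := Q.homMk (c.inj i)
  proj i := Q.homMk (c.proj i)
  inj_proj i := Q.hom_ext (c.inj_proj i)
  inj_proj_of_ne i j h := Q.hom_ext (c.inj_proj_of_ne i j h)
  sum_proj_inj := by
    apply Q.hom_ext
    rw [fullSubcategory_sum_hom]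
    exact c.sum_proj_inj
  causal_inj i := (causal_fullSubcategory_iff Q _).2 (c.causal_inj i)

variable [SemiAdditiveMonoidal E] (hQ : ∀ A, Q ((toSplitCausal E).obj A))
  (hsum : ∀ M : BiprodCompletion E, ∃ Z : Q.FullSubcategory,
    Nonempty (CausalSum (toSplitCausal E) M Z.obj))
  (hE : FiniteDecompositionProperty E)

include hQ hsum hE

/-- The biproduct completion is equivalent to a full subcategory of the splitting, when that
subcategory has all the sums and all causal idempotents decompose. -/
theorem exists_biprodCompletion_equivalence :
    ∃ J : BiprodCompletion E ⥤ Q.FullSubcategory, IsCausalMonoidalEquivalence J ∧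
      CausallyIsomorphic (BiprodCompletion.incl E ⋙ J) (Q.lift (toSplitCausal E) hQ) := by
  let _ : (Q.lift (toSplitCausal E) hQ).Monoidal :=
    (liftCoreMonoidal Q _ hQ toSplitCausalCoreMonoidal).toMonoidal
  refine exists_extension (Q.lift (toSplitCausal E) hQ) (isCausalFunctor_lift Q hQ) ?_ ?_
    (fun _ _ => rfl) (fun _ _ => rfl) (fun M => ?_) fun Z => ?_
  · exact causal_id (𝟙_ Q.FullSubcategory)
  · intro A B
    rw [causal_fullSubcategory_iff, causal_splitCausal_iff]
    exact causal_id (A ⊗ B)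
  · obtain ⟨Z, ⟨c⟩⟩ := hsum M
    exact ⟨Z, ⟨c.lift⟩⟩
  · obtain ⟨M, ⟨c⟩⟩ := (hE _ Z.obj.obj.p Z.obj.obj.idem Z.obj.property).exists_causalSum
    exact ⟨M, ⟨c.lift⟩⟩

omit hQ in
/-- A full subcategory that has all the sums is equivalent to the splitting: every object of the
splitting is a sum, and sums are unique up to causal isomorphism. -/
theorem isCausalMonoidalEquivalence_ι : IsCausalMonoidalEquivalence Q.ι := by
  refine .of_fullyFaithful (isCausalFunctor_ι Q) ⟨inferInstance, ?_, ?_⟩ fun Z => ?_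
  · exact causal_id (𝟙_ (SplitCausal E))
  · exact fun A B => causal_id (A.obj ⊗ B.obj)
  · obtain ⟨M, ⟨c⟩⟩ := (hE _ Z.obj.p Z.obj.idem Z.property).exists_causalSum
    obtain ⟨Z', ⟨c'⟩⟩ := hsum M
    exact ⟨Z', c'.iso c, c'.causal_iso c⟩

end SplitCausal

/-! ### The embedding of `CP* C` in the splitting is fully faithful and monoidal -/

section CPStarEmbedding

open TwoRoads.DaggerCategory (dag dag_id dag_comp dag_dag)
open TwoRoads.DaggerSymmetricMonoidal Idempotents

variable {C : Type*} [Category* C] [MonoidalCategory C] [SymmetricCategory C]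
  [DaggerCategory C] [DaggerSymmetricMonoidal C]

namespace CPStar

theorem selfDual_coact_μ (A : CPStar C) : A.selfDual.coact ≫ A.as ◁ A.μ = A.δ := by
  have h := A.cup_μ
  simp only [DaggerDual.coact, Category.assoc]
  rw [h, Iso.inv_hom_id_assoc]

theorem δ_selfDual_act (A : CPStar C) : A.δ ▷ A.as ≫ A.selfDual.act = A.μ := by
  have h := congrArg dag A.cup_δ
  simp only [dag_comp, dag_whiskerLeft, dag_whiskerRight, dag_associator_inv, dag_dag,
    dag_rightUnitor, Category.assoc] at h
  simp only [DaggerDual.act, dag_comp, dag_dag]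
  rw [reassoc_of% h]
  simp

/-- A morphism out of an object of `CPM C` and into a Frobenius structure becomes completely
positive on doubled objects under a positivity condition on a mixed Choi endomorphism. -/
theorem isCP_comp_δ {B : CPM C} {X : CPStar C} {f : B.double ⟶ X.as}
    (h : Positive (choi B.dual.coact X.μ f)) :
    CPM.IsCP (A := B) (B := X.toCPM) (f ≫ X.δ) := by
  have h1 := choi_precomp B.dual.coact X.selfDual.act (𝟙 _) f X.δ
  rw [MonoidalCategory.whiskerLeft_id, Category.comp_id, Category.id_comp, δ_selfDual_act] at h1
  exact (congrArg Positive h1).mpr h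

theorem isCP_μ_comp {B : CPM C} {X : CPStar C} {f : X.as ⟶ B.double}
    (h : Positive (choi X.δ B.dual.act f)) :
    CPM.IsCP (A := X.toCPM) (B := B) (X.μ ≫ f) := by
  have h1 := choi_precomp X.selfDual.coact B.dual.act X.μ f (𝟙 _)
  rw [id_whiskerRight, Category.comp_id, Category.id_comp, selfDual_coact_μ] at h1
  exact (congrArg Positive h1).mpr h

/-- Bending wires turns `δ ∘ f ∘ μ` and `f` into the same endomorphism, so that the
conditions of complete positivity agree. -/
theorem isCP_sandwich_iff {A B : CPStar C} {f : A.as ⟶ B.as} :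
    CPM.IsCP (A := A.toCPM) (B := B.toCPM) (A.μ ≫ f ≫ B.δ) ↔ IsCP f := by
  have h := choi_precomp A.selfDual.coact B.selfDual.act A.μ f B.δ
  rw [selfDual_coact_μ, δ_selfDual_act] at h
  exact iff_of_eq (congrArg Positive h)

theorem toSplitDagger_map_val {A B : CPStar C} (f : A ⟶ B) :
    ((toSplitDagger C).map f).hom.hom.f.1 = A.μ ≫ f.1 ≫ B.δ := rfl

instance : (toSplitDagger C).Faithful where
  map_injective {A B f g} h := by
    have h1 : A.μ ≫ f.1 ≫ B.δ = A.μ ≫ g.1 ≫ B.δ := by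
      rw [← toSplitDagger_map_val, h, toSplitDagger_map_val]
    have h2 := congrArg (fun k => A.δ ≫ k ≫ B.μ) h1
    simp only [Category.assoc, B.special, Category.comp_id, reassoc_of% A.special] at h2
    exact CPStar.hom_ext h2

instance : (toSplitDagger C).Full where
  map_surjective {A B} g := by
    let k : A.as ⊗ A.as ⟶ B.as ⊗ B.as := g.hom.hom.f.1
    have hk : CPM.IsCP (A := A.toCPM) (B := B.toCPM) k := g.hom.hom.f.2
    have hc : (A.μ ≫ 𝟙 A.as ≫ A.δ) ≫ k ≫ B.μ ≫ 𝟙 B.as ≫ B.δ = k :=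
      congrArg Subtype.val g.hom.hom.comm
    have h1 : A.μ ≫ (A.δ ≫ k ≫ B.μ) ≫ B.δ = k := by
      refine Eq.trans ?_ hc
      simp
    refine ⟨⟨A.δ ≫ k ≫ B.μ, isCP_sandwich_iff.1 ?_⟩, ?_⟩
    · rw [h1]; exact hk
    · exact ObjectProperty.hom_ext _ (ObjectProperty.hom_ext _ (Karoubi.hom_ext _ _
        (CPM.hom_ext h1)))

theorem isCausalFunctor_toSplitDagger : IsCausalFunctor (toSplitDagger C) where
  isIso_discard := by
    let u := unit C
    have hε : u.δ ≫ (λ_ (𝟙_ C)).hom = 𝟙 (𝟙_ C) := Iso.inv_hom_id _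
    have hμ : u.μ = (λ_ (𝟙_ C)).hom := dag_leftUnitor_inv _
    have h1 : (discard u.toCPM).1 = 𝟙 (𝟙_ C ⊗ 𝟙_ C) := by
      change (u.μ ≫ 𝟙 (𝟙_ C)) ≫ (λ_ (𝟙_ C)).inv = _
      rw [hμ, Category.comp_id, Iso.hom_inv_id]
    have h2 : CPM.IsCP (A := (𝟙_ (CPM C))) (B := u.toCPM) (𝟙 (𝟙_ C ⊗ 𝟙_ C)) := by
      rw [← id_tensorHom_id]
      refine (CPM.isCP_pure_of_iso (A := 𝟙_ (CPM C)) (B := u.toCPM) (Iso.refl _) (Iso.refl _)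
        (dag_id _) ?_).1
      change (λ_ (𝟙_ C)).inv ≫ (𝟙 _ ⊗ₘ 𝟙 _) = dag (𝟙 _) ≫ (λ_ (𝟙_ C)).inv
      rw [dag_id, id_tensorHom_id, Category.id_comp, Category.comp_id]
    have hp : u.μ ≫ 𝟙 (𝟙_ C) ≫ u.δ = 𝟙 (𝟙_ C ⊗ 𝟙_ C) := by
      rw [hμ, Category.id_comp]
      exact Iso.hom_inv_id _
    have hd : (discard ((toSplitDagger C).obj u)).hom.hom.f.1 = 𝟙 (𝟙_ C ⊗ 𝟙_ C) := by
      change (u.μ ≫ 𝟙 (𝟙_ C) ≫ u.δ) ≫ (discard u.toCPM).1 = _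
      rw [hp, h1]
      exact Category.id_comp _
    let k : 𝟙_ (SplitDaggerCausal C) ⟶ (toSplitDagger C).obj u :=
      ObjectProperty.homMk (ObjectProperty.homMk ⟨⟨𝟙 (𝟙_ C ⊗ 𝟙_ C), h2⟩, CPM.hom_ext (by
        change 𝟙 _ ≫ 𝟙 (𝟙_ C ⊗ 𝟙_ C) ≫ u.μ ≫ 𝟙 (𝟙_ C) ≫ u.δ = 𝟙 (𝟙_ C ⊗ 𝟙_ C)
        rw [hp]
        exact (Category.id_comp _).trans (Category.id_comp _))⟩)
    refine ⟨k, ?_, ?_⟩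
    · refine ObjectProperty.hom_ext _ (ObjectProperty.hom_ext _ (Karoubi.hom_ext _ _
        (CPM.hom_ext ?_)))
      refine ((congrArg (· ≫ 𝟙 (𝟙_ C ⊗ 𝟙_ C)) hd).trans (Category.comp_id _)).trans hp.symm
    · refine ObjectProperty.hom_ext _ (ObjectProperty.hom_ext _ (Karoubi.hom_ext _ _
        (CPM.hom_ext ?_)))
      exact (congrArg (𝟙 (𝟙_ C ⊗ 𝟙_ C) ≫ ·) hd).trans (Category.comp_id _)
  map_discard A := by
    refine ObjectProperty.hom_ext _ (ObjectProperty.hom_ext _ (Karoubi.hom_ext _ _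
        (CPM.hom_ext ?_)))
    change (A.μ ≫ 𝟙 A.as ≫ A.δ) ≫ (A.μ ≫ A.ε) ≫ (λ_ (𝟙_ C)).inv = (A.μ ≫ A.ε ≫ (unit C).δ) ≫
      ((unit C).μ ≫ 𝟙 _ ≫ (unit C).δ) ≫ ((unit C).μ ≫ 𝟙 _) ≫ (λ_ (𝟙_ C)).inv
    simp only [Category.assoc, Category.id_comp, reassoc_of% A.special,
      reassoc_of% (unit C).special]

/-- The morphism `δ ∘ f ∘ μ`. -/
abbrev sandwich (A B : CPStar C) (f : A.as ⟶ B.as) : A.as ⊗ A.as ⟶ B.as ⊗ B.as := A.μ ≫ f ≫ B.δ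

theorem sandwich_comp (A B D : CPStar C) (f : A.as ⟶ B.as) (g : B.as ⟶ D.as) :
    sandwich A B f ≫ sandwich B D g = sandwich A D (f ≫ g) := by
  simp [sandwich, reassoc_of% B.special]

theorem sandwich_tensor {A B A' B' : CPStar C} (f : A.as ⟶ B.as) (g : A'.as ⟶ B'.as) :
    tensorδ A.as A.as A'.as A'.as ≫ (sandwich A B f ⊗ₘ sandwich A' B' g) ≫
      tensorμ B.as B.as B'.as B'.as = sandwich (tensorObj A A') (tensorObj B B') (f ⊗ₘ g) := by
  have h1 : (tensorObj A A').μ = tensorδ A.as A.as A'.as A'.as ≫ (A.μ ⊗ₘ A'.μ) :=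
    dag_comul_tensor A A'
  simp only [sandwich, h1, δ_tensor, Category.assoc, tensorHom_comp_tensorHom_assoc]

theorem sandwich_unit : sandwich (unit C) (unit C) (𝟙 _) = 𝟙 (𝟙_ C ⊗ 𝟙_ C) := by
  have hμ : (unit C).μ = (λ_ (𝟙_ C)).hom := dag_leftUnitor_inv _
  rw [sandwich, hμ, Category.id_comp]
  exact Iso.hom_inv_id _

theorem sandwich_of_δ {A B : CPStar C} (φ : A.as ⟶ B.as)
    (hδ : A.δ ≫ (φ ⊗ₘ φ) = φ ≫ B.δ) :
    sandwich A A (𝟙 _) ≫ (φ ⊗ₘ φ) = sandwich A B φ := by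
  simp [sandwich, hδ]

theorem tensor_selfDual_η (A B : CPStar C) :
    (A.selfDual.tensor B.selfDual).η = (tensorObj A B).selfDual.η := by
  change (λ_ (𝟙_ C)).inv ≫ ((dag A.ε ≫ A.δ) ⊗ₘ (dag B.ε ≫ B.δ)) ≫ tensorμ _ _ _ _ =
    dag (tensorObj A B).ε ≫ (tensorObj A B).δ
  have h : (tensorObj A B).ε = (A.ε ⊗ₘ B.ε) ≫ (λ_ (𝟙_ C)).hom := Comon.tensorObj_counit _ _
  rw [h, δ_tensor, dag_comp, dag_tensor, dag_leftUnitor]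
  simp

theorem isCP_id_of_η {A B : CPM C} (hA : A.as = B.as) (hd : A.dual.dual = B.dual.dual)
    (h : A.dual.η ≫ (eqToHom hA ⊗ₘ eqToHom hd) = B.dual.η) :
    CPM.IsCP (A := A) (B := B) (eqToHom hd ⊗ₘ eqToHom hA) := by
  obtain ⟨A, D⟩ := A
  obtain ⟨B, D'⟩ := B
  obtain rfl : A = B := hA
  refine (CPM.isCP_pure_of_iso (A := ⟨A, D⟩) (B := ⟨A, D'⟩) (Iso.refl A) (eqToIso hd)
    (dag_id _) ?_).1
  simpa using h

theorem isCP_id_tensor (A B : CPStar C) :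
    CPM.IsCP (A := A.toCPM ⊗ B.toCPM) (B := (tensorObj A B).toCPM)
      (𝟙 ((A.as ⊗ B.as) ⊗ (A.as ⊗ B.as))) ∧
    CPM.IsCP (A := (tensorObj A B).toCPM) (B := A.toCPM ⊗ B.toCPM)
      (𝟙 ((A.as ⊗ B.as) ⊗ (A.as ⊗ B.as))) := by
  have h := tensor_selfDual_η A B
  have h' : ∀ u : 𝟙_ C ⟶ (A.as ⊗ B.as) ⊗ (A.as ⊗ B.as),
      u ≫ (𝟙 (A.as ⊗ B.as) ⊗ₘ 𝟙 (A.as ⊗ B.as)) = u :=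
    fun u => by rw [id_tensorHom_id, Category.comp_id]
  constructor
  · exact (congrArg (CPM.IsCP (A := A.toCPM ⊗ B.toCPM) (B := (tensorObj A B).toCPM))
      (id_tensorHom_id _ _)).mp (isCP_id_of_η (A := A.toCPM ⊗ B.toCPM)
        (B := (tensorObj A B).toCPM) rfl rfl ((h' _).trans h))
  · exact (congrArg (CPM.IsCP (B := A.toCPM ⊗ B.toCPM) (A := (tensorObj A B).toCPM))
      (id_tensorHom_id _ _)).mp (isCP_id_of_η (B := A.toCPM ⊗ B.toCPM)
        (A := (tensorObj A B).toCPM) rfl rfl ((h' _).trans h.symm))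

theorem isCP_id_unit :
    CPM.IsCP (A := 𝟙_ (CPM C)) (B := (unit C).toCPM) (𝟙 (𝟙_ C ⊗ 𝟙_ C)) ∧
    CPM.IsCP (A := (unit C).toCPM) (B := 𝟙_ (CPM C)) (𝟙 (𝟙_ C ⊗ 𝟙_ C)) := by
  have h : (DaggerDual.unit (C := C)).η = (unit C).selfDual.η := by
    change (λ_ (𝟙_ C)).inv = dag (𝟙 _) ≫ (λ_ (𝟙_ C)).inv
    rw [dag_id, Category.id_comp]
  have h' : ∀ u : 𝟙_ C ⟶ 𝟙_ C ⊗ 𝟙_ C, u ≫ (𝟙 (𝟙_ C) ⊗ₘ 𝟙 (𝟙_ C)) = u :=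
    fun u => by rw [id_tensorHom_id, Category.comp_id]
  constructor
  · exact (congrArg (CPM.IsCP (A := 𝟙_ (CPM C)) (B := (unit C).toCPM))
      (id_tensorHom_id _ _)).mp (isCP_id_of_η (A := 𝟙_ (CPM C)) (B := (unit C).toCPM) rfl rfl
        ((h' _).trans h))
  · exact (congrArg (CPM.IsCP (B := 𝟙_ (CPM C)) (A := (unit C).toCPM))
      (id_tensorHom_id _ _)).mp (isCP_id_of_η (B := 𝟙_ (CPM C)) (A := (unit C).toCPM) rfl rfl
        ((h' _).trans h.symm))

theorem sandwich_tensor_id (A B : CPStar C) :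
    tensorδ A.as A.as B.as B.as ≫ (sandwich A A (𝟙 _) ⊗ₘ sandwich B B (𝟙 _)) ≫
      tensorμ A.as A.as B.as B.as = sandwich (tensorObj A B) (tensorObj A B) (𝟙 _) := by
  rw [sandwich_tensor, id_tensorHom_id]

theorem sandwich_id_idem (A : CPStar C) :
    sandwich A A (𝟙 _) ≫ sandwich A A (𝟙 _) = sandwich A A (𝟙 _) := by
  rw [sandwich_comp, Category.id_comp]

/-- The structure isomorphisms `F A ⊗ F B ≅ F (A ⊗ B)` of the embedding `F` of `CP* C`. -/
def toKaroubiμIso (A B : CPStar C) :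
    (toKaroubi C).obj A ⊗ (toKaroubi C).obj B ≅ (toKaroubi C).obj (A ⊗ B) where
  hom := ⟨⟨sandwich (tensorObj A B) (tensorObj A B) (𝟙 _), by
      have h := (isCP_id_tensor A B).1.comp (B := (tensorObj A B).toCPM)
        (isCP_sandwich (isCP_id (tensorObj A B)))
      exact (congrArg (CPM.IsCP (A := A.toCPM ⊗ B.toCPM) (B := (tensorObj A B).toCPM))
        (Category.id_comp _)).mp h⟩, CPM.hom_ext (by
      change (tensorδ A.as A.as B.as B.as ≫ (sandwich A A (𝟙 _) ⊗ₘ sandwich B B (𝟙 _)) ≫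
        tensorμ A.as A.as B.as B.as) ≫ sandwich (tensorObj A B) (tensorObj A B) (𝟙 _) ≫
          sandwich (tensorObj A B) (tensorObj A B) (𝟙 _) =
            sandwich (tensorObj A B) (tensorObj A B) (𝟙 _)
      rw [sandwich_tensor_id, sandwich_id_idem, sandwich_id_idem])⟩
  inv := ⟨⟨sandwich (tensorObj A B) (tensorObj A B) (𝟙 _), by
      have h := (isCP_sandwich (isCP_id (tensorObj A B))).comp (B := (tensorObj A B).toCPM)
        (isCP_id_tensor A B).2
      exact (congrArg (CPM.IsCP (B := A.toCPM ⊗ B.toCPM) (A := (tensorObj A B).toCPM))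
        (Category.comp_id _)).mp h⟩, CPM.hom_ext (by
      change sandwich (tensorObj A B) (tensorObj A B) (𝟙 _) ≫
        sandwich (tensorObj A B) (tensorObj A B) (𝟙 _) ≫
        (tensorδ A.as A.as B.as B.as ≫ (sandwich A A (𝟙 _) ⊗ₘ sandwich B B (𝟙 _)) ≫
        tensorμ A.as A.as B.as B.as) =
            sandwich (tensorObj A B) (tensorObj A B) (𝟙 _)
      rw [sandwich_tensor_id, sandwich_id_idem, sandwich_id_idem])⟩
  hom_inv_id := Karoubi.hom_ext _ _ (CPM.hom_ext
    ((sandwich_id_idem (tensorObj A B)).trans (sandwich_tensor_id A B).symm))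
  inv_hom_id := Karoubi.hom_ext _ _ (CPM.hom_ext (sandwich_id_idem (tensorObj A B)))

/-- The structure isomorphism `I ≅ F I` of the embedding `F` of `CP* C`. -/
def toKaroubiεIso : 𝟙_ (Karoubi (CPM C)) ≅ (toKaroubi C).obj (𝟙_ (CPStar C)) where
  hom := ⟨⟨𝟙 (𝟙_ C ⊗ 𝟙_ C), isCP_id_unit.1⟩, CPM.hom_ext (by
    change 𝟙 (𝟙_ C ⊗ 𝟙_ C) ≫ 𝟙 (𝟙_ C ⊗ 𝟙_ C) ≫ sandwich (unit C) (unit C) (𝟙 _) = 𝟙 (𝟙_ C ⊗ 𝟙_ C)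
    rw [sandwich_unit, Category.id_comp, Category.id_comp])⟩
  inv := ⟨⟨𝟙 (𝟙_ C ⊗ 𝟙_ C), isCP_id_unit.2⟩, CPM.hom_ext (by
    change sandwich (unit C) (unit C) (𝟙 _) ≫ 𝟙 (𝟙_ C ⊗ 𝟙_ C) ≫ 𝟙 (𝟙_ C ⊗ 𝟙_ C) = 𝟙 (𝟙_ C ⊗ 𝟙_ C)
    rw [sandwich_unit, Category.id_comp, Category.id_comp])⟩
  hom_inv_id := Karoubi.hom_ext _ _ (CPM.hom_ext (Category.id_comp (𝟙 (𝟙_ C ⊗ 𝟙_ C))))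
  inv_hom_id := Karoubi.hom_ext _ _ (CPM.hom_ext
    ((Category.id_comp (𝟙 (𝟙_ C ⊗ 𝟙_ C))).trans sandwich_unit.symm))

/-- All the structure isomorphisms of the splitting become, after composition with the
idempotents, of the form `δ ∘ φ ∘ μ` for a structure isomorphism `φ` of `C`. -/
def toKaroubiCore : (toKaroubi C).CoreMonoidal where
  εIso := toKaroubiεIso
  μIso := toKaroubiμIso
  μIso_hom_natural_left {A B} f D := Karoubi.hom_ext _ _ (CPM.hom_ext (by
    change (tensorδ A.as A.as D.as D.as ≫ (sandwich A B f.1 ⊗ₘ sandwich D D (𝟙 _)) ≫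
        tensorμ B.as B.as D.as D.as) ≫ sandwich (tensorObj B D) (tensorObj B D) (𝟙 _) =
      sandwich (tensorObj A D) (tensorObj A D) (𝟙 _) ≫
        sandwich (tensorObj A D) (tensorObj B D) (f.1 ⊗ₘ 𝟙 _)
    rw [sandwich_tensor, sandwich_comp, sandwich_comp, Category.id_comp, Category.comp_id]))
  μIso_hom_natural_right {A B} D f := Karoubi.hom_ext _ _ (CPM.hom_ext (by
    change (tensorδ D.as D.as A.as A.as ≫ (sandwich D D (𝟙 _) ⊗ₘ sandwich A B f.1) ≫
        tensorμ D.as D.as B.as B.as) ≫ sandwich (tensorObj D B) (tensorObj D B) (𝟙 _) =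
      sandwich (tensorObj D A) (tensorObj D A) (𝟙 _) ≫
        sandwich (tensorObj D A) (tensorObj D B) (𝟙 _ ⊗ₘ f.1)
    rw [sandwich_tensor, sandwich_comp, sandwich_comp, Category.id_comp, Category.comp_id]))
  associativity A B D := Karoubi.hom_ext _ _ (CPM.hom_ext (by
    change (tensorδ (A.as ⊗ B.as) (A.as ⊗ B.as) D.as D.as ≫
        (sandwich (tensorObj A B) (tensorObj A B) (𝟙 _) ⊗ₘ sandwich D D (𝟙 _)) ≫
          tensorμ (A.as ⊗ B.as) (A.as ⊗ B.as) D.as D.as) ≫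
        sandwich (tensorObj (tensorObj A B) D) (tensorObj (tensorObj A B) D) (𝟙 _) ≫
        sandwich (tensorObj (tensorObj A B) D) (tensorObj A (tensorObj B D))
          (α_ A.as B.as D.as).hom =
      ((tensorδ (A.as ⊗ B.as) (A.as ⊗ B.as) D.as D.as ≫
        ((tensorδ A.as A.as B.as B.as ≫ (sandwich A A (𝟙 _) ⊗ₘ sandwich B B (𝟙 _)) ≫
          tensorμ A.as A.as B.as B.as) ⊗ₘ sandwich D D (𝟙 _)) ≫
          tensorμ (A.as ⊗ B.as) (A.as ⊗ B.as) D.as D.as) ≫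
        ((α_ A.as B.as D.as).hom ⊗ₘ (α_ A.as B.as D.as).hom)) ≫
      (tensorδ A.as A.as (B.as ⊗ D.as) (B.as ⊗ D.as) ≫
        (sandwich A A (𝟙 _) ⊗ₘ sandwich (tensorObj B D) (tensorObj B D) (𝟙 _)) ≫
          tensorμ A.as A.as (B.as ⊗ D.as) (B.as ⊗ D.as)) ≫
        sandwich (tensorObj A (tensorObj B D)) (tensorObj A (tensorObj B D)) (𝟙 _)
    rw [sandwich_tensor_id A B, sandwich_tensor_id (tensorObj A B) D,
      sandwich_tensor_id A (tensorObj B D), sandwich_id_idem, sandwich_comp, sandwich_comp]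
    rw [sandwich_of_δ (B := tensorObj A (tensorObj B D)) _ (δ_associator A B D), sandwich_comp]
    simp only [Category.id_comp, Category.comp_id]))
  left_unitality A := Karoubi.hom_ext _ _ (CPM.hom_ext (by
    change (tensorδ (𝟙_ C) (𝟙_ C) A.as A.as ≫ (𝟙 (𝟙_ C ⊗ 𝟙_ C) ⊗ₘ sandwich A A (𝟙 _)) ≫
        tensorμ (𝟙_ C) (𝟙_ C) A.as A.as) ≫ ((λ_ A.as).hom ⊗ₘ (λ_ A.as).hom) =
      (tensorδ (𝟙_ C) (𝟙_ C) A.as A.as ≫ (𝟙 (𝟙_ C ⊗ 𝟙_ C) ⊗ₘ sandwich A A (𝟙 _)) ≫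
        tensorμ (𝟙_ C) (𝟙_ C) A.as A.as) ≫
        sandwich (tensorObj (unit C) A) (tensorObj (unit C) A) (𝟙 _) ≫
        sandwich (tensorObj (unit C) A) A (λ_ A.as).hom
    have h := sandwich_tensor_id (unit C) A
    rw [sandwich_unit] at h
    have h' := sandwich_of_δ (B := A) _ (δ_leftUnitor A)
    rw [h, sandwich_comp, sandwich_comp]
    simp only [Category.id_comp]
    exact h'))
  right_unitality A := Karoubi.hom_ext _ _ (CPM.hom_ext (by
    change (tensorδ A.as A.as (𝟙_ C) (𝟙_ C) ≫ (sandwich A A (𝟙 _) ⊗ₘ 𝟙 (𝟙_ C ⊗ 𝟙_ C)) ≫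
        tensorμ A.as A.as (𝟙_ C) (𝟙_ C)) ≫ ((ρ_ A.as).hom ⊗ₘ (ρ_ A.as).hom) =
      (tensorδ A.as A.as (𝟙_ C) (𝟙_ C) ≫ (sandwich A A (𝟙 _) ⊗ₘ 𝟙 (𝟙_ C ⊗ 𝟙_ C)) ≫
        tensorμ A.as A.as (𝟙_ C) (𝟙_ C)) ≫
        sandwich (tensorObj A (unit C)) (tensorObj A (unit C)) (𝟙 _) ≫
        sandwich (tensorObj A (unit C)) A (ρ_ A.as).hom
    have h := sandwich_tensor_id A (unit C)
    rw [sandwich_unit] at h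
    have h' := sandwich_of_δ (B := A) _ (δ_rightUnitor A)
    rw [h, sandwich_comp, sandwich_comp]
    simp only [Category.id_comp]
    exact h'))

theorem sandwich_counit (A : CPStar C) :
    sandwich A A (𝟙 _) ≫ (A.μ ≫ A.ε) ≫ (λ_ (𝟙_ C)).inv = (A.μ ≫ A.ε) ≫ (λ_ (𝟙_ C)).inv := by
  simp [sandwich, reassoc_of% A.special]

theorem exists_monoidal_toSplitDagger :
    ∃ _ : (toSplitDagger C).Monoidal,
      Causal (Functor.LaxMonoidal.ε (toSplitDagger C)) ∧
        ∀ A B : CPStar C, Causal (Functor.LaxMonoidal.μ (toSplitDagger C) A B) := by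
  let m : (toSplitDagger C).CoreMonoidal :=
    liftCoreMonoidal (daggerIdempotents C) _ _ (liftCoreMonoidal (causalIdempotents (CPM C)) _ _
      toKaroubiCore)
  refine ⟨m.toMonoidal, ?_, fun A B => ?_⟩
  · refine ObjectProperty.hom_ext _ (ObjectProperty.hom_ext _ (Karoubi.hom_ext _ _
      (CPM.hom_ext ?_)))
    change 𝟙 (𝟙_ C ⊗ 𝟙_ C) ≫ sandwich (unit C) (unit C) (𝟙 _) ≫ ((unit C).μ ≫ (unit C).ε) ≫
      (λ_ (𝟙_ C)).inv = 𝟙 (𝟙_ C ⊗ 𝟙_ C) ≫ (λ_ (𝟙_ C)).hom ≫ (λ_ (𝟙_ C)).inv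
    have hμ : (unit C).μ = (λ_ (𝟙_ C)).hom := dag_leftUnitor_inv _
    rw [sandwich_counit, hμ, Category.id_comp, Category.id_comp]
    change ((λ_ (𝟙_ C)).hom ≫ 𝟙 _) ≫ (λ_ (𝟙_ C)).inv = _
    rw [Category.comp_id]
  · refine ObjectProperty.hom_ext _ (ObjectProperty.hom_ext _ (Karoubi.hom_ext _ _
      (CPM.hom_ext ?_)))
    change sandwich (tensorObj A B) (tensorObj A B) (𝟙 _) ≫
        sandwich (tensorObj A B) (tensorObj A B) (𝟙 _) ≫
        ((tensorObj A B).μ ≫ (tensorObj A B).ε) ≫ (λ_ (𝟙_ C)).inv =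
      (tensorδ A.as A.as B.as B.as ≫ (sandwich A A (𝟙 _) ⊗ₘ sandwich B B (𝟙 _)) ≫
        tensorμ A.as A.as B.as B.as) ≫
      (tensorδ A.as A.as B.as B.as ≫ ((A.μ ≫ A.ε) ⊗ₘ (B.μ ≫ B.ε)) ≫ (λ_ (𝟙_ C)).hom) ≫
        (λ_ (𝟙_ C)).inv
    rw [sandwich_tensor_id, ← dag_comul_comp_counit_tensor, sandwich_counit]
    exact sandwich_counit (tensorObj A B)

end CPStar

end CPStarEmbedding

/-! ### Scalars -/

section Scalar

open TwoRoads.DaggerCategory (dag dag_id dag_comp dag_dag)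
open TwoRoads.DaggerSymmetricMonoidal

variable {C : Type*} [Category* C] [MonoidalCategory C]

/-- Multiplication by the scalar `s` on `X`. -/
def scalar (s : 𝟙_ C ⟶ 𝟙_ C) (X : C) : X ⟶ X := (λ_ X).inv ≫ s ▷ X ≫ (λ_ X).hom

theorem scalar_natural (s : 𝟙_ C ⟶ 𝟙_ C) {X Y : C} (f : X ⟶ Y) :
    f ≫ scalar s Y = scalar s X ≫ f := by
  simp only [scalar, Category.assoc, ← leftUnitor_naturality]
  rw [leftUnitor_inv_naturality_assoc, whisker_exchange_assoc]

theorem scalar_comp (s t : 𝟙_ C ⟶ 𝟙_ C) (X : C) : scalar s X ≫ scalar t X = scalar (s ≫ t) X := by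
  simp [scalar]

theorem scalar_whiskerRight (s : 𝟙_ C ⟶ 𝟙_ C) (X Y : C) : scalar s X ▷ Y = scalar s (X ⊗ Y) := by
  simp only [scalar]
  monoidal

theorem whiskerLeft_scalar [BraidedCategory C] (s : 𝟙_ C ⟶ 𝟙_ C) (X Y : C) :
    X ◁ scalar s Y = scalar s (X ⊗ Y) := by
  rw [← cancel_epi (β_ Y X).hom, BraidedCategory.braiding_naturality_left (scalar s Y) X |>.symm,
    scalar_whiskerRight, scalar_natural]

theorem dag_scalar [SymmetricCategory C] [DaggerCategory C] [DaggerSymmetricMonoidal C]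
    (s : 𝟙_ C ⟶ 𝟙_ C) (X : C) : dag (scalar s X) = scalar (dag s) X := by
  simp [scalar, dag_comp, dag_whiskerRight, dag_leftUnitor, dag_leftUnitor_inv]

end Scalar

/-! ### The Frobenius structure of the doubled object -/

section Pants

open TwoRoads.DaggerCategory (dag dag_id dag_comp dag_dag)
open TwoRoads.DaggerSymmetricMonoidal

variable {C : Type*} [Category* C] [MonoidalCategory C] [SymmetricCategory C]
  [DaggerCategory C]

namespace DaggerDual

variable {A : C} (D : DaggerDual A)

/-- The comultiplication of `A* ⊗ A` given by the cup of `A`. -/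
def comul : D.dual ⊗ A ⟶ (D.dual ⊗ A) ⊗ (D.dual ⊗ A) :=
  D.dual ◁ D.coact ≫ (α_ D.dual A (D.dual ⊗ A)).inv

theorem comul_ε_whiskerRight : D.comul ≫ D.ε ▷ (D.dual ⊗ A) = (λ_ (D.dual ⊗ A)).inv := by
  have h := D.snake_right
  calc
    _ = 𝟙 _ ⊗≫ (D.dual ◁ D.η ≫ (α_ D.dual A D.dual).inv ≫ D.ε ▷ D.dual) ▷ A ⊗≫ 𝟙 _ := by
      simp only [comul, coact]; monoidal
    _ = _ := by rw [h]; monoidal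

theorem comul_whiskerLeft_ε : D.comul ≫ (D.dual ⊗ A) ◁ D.ε = (ρ_ (D.dual ⊗ A)).inv := by
  have h := D.coact_ε
  calc
    _ = 𝟙 _ ⊗≫ D.dual ◁ (D.coact ≫ A ◁ D.ε) ⊗≫ 𝟙 _ := by
      simp only [comul]; monoidal
    _ = _ := by rw [h]; monoidal

theorem comul_coassoc :
    D.comul ≫ (D.dual ⊗ A) ◁ D.comul =
      D.comul ≫ D.comul ▷ (D.dual ⊗ A) ≫ (α_ _ _ _).hom := by
  symm
  calc
    _ = 𝟙 _ ⊗≫ D.dual ◁ (𝟙_ C ◁ D.η ≫ D.η ▷ (A ⊗ D.dual)) ▷ A ⊗≫ 𝟙 _ := by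
      simp only [comul, coact]; monoidal
    _ = _ := by
      rw [whisker_exchange]
      simp only [comul, coact]; monoidal

variable [DaggerSymmetricMonoidal C]

theorem dag_comul :
    dag D.comul = (α_ D.dual A (D.dual ⊗ A)).hom ≫ D.dual ◁ ((α_ A D.dual A).inv ≫
      dag D.η ▷ A ≫ (λ_ A).hom) := by
  simp only [comul, coact, dag_comp, dag_whiskerLeft, dag_whiskerRight, dag_associator_inv,
    dag_associator, dag_leftUnitor_inv, Category.assoc]

theorem comul_frobenius : choi D.comul (dag D.comul) (𝟙 _) = dag D.comul ≫ D.comul := by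
  calc
    _ = 𝟙 _ ⊗≫ D.dual ◁ (D.η ▷ (A ⊗ D.dual) ≫ (A ⊗ D.dual) ◁ dag D.η) ▷ A ⊗≫ 𝟙 _ := by
      rw [dag_comul]
      simp only [choi, comul, coact]; monoidal
    _ = _ := by
      rw [← whisker_exchange, dag_comul]
      simp only [comul, coact]; monoidal

theorem comul_dag_comul : D.comul ≫ dag D.comul = scalar (D.η ≫ dag D.η) (D.dual ⊗ A) := by
  rw [← whiskerLeft_scalar, dag_comul]
  simp only [comul, coact, scalar]
  monoidal

theorem dag_comul_ε_eq :
    dag D.comul ≫ D.ε = (β_ D.dual A).hom ▷ (D.dual ⊗ A) ≫ tensorμ A D.dual D.dual A ≫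
      (dag D.η ⊗ₘ D.ε) ≫ (λ_ (𝟙_ C)).hom := by
  have h : (β_ D.dual A).hom ▷ (D.dual ⊗ A) ≫ tensorμ A D.dual D.dual A =
      𝟙 _ ⊗≫ (β_ D.dual (A ⊗ D.dual)).hom ▷ A ⊗≫ 𝟙 _ := by
    rw [BraidedCategory.braiding_tensor_right_hom]
    simp only [tensorμ]
    monoidal
  have h1 : (β_ D.dual (A ⊗ D.dual)).hom ≫ dag D.η ▷ D.dual =
      D.dual ◁ dag D.η ≫ (ρ_ _).hom ≫ (λ_ _).inv := by
    rw [← BraidedCategory.braiding_naturality_right, braiding_tensorUnit_right]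
  symm
  calc
    _ = 𝟙 _ ⊗≫ ((β_ D.dual (A ⊗ D.dual)).hom ≫ dag D.η ▷ D.dual) ▷ A ⊗≫ D.ε := by
      rw [reassoc_of% h, MonoidalCategory.tensorHom_def]
      monoidal
    _ = _ := by
      rw [h1, dag_comul]
      monoidal

theorem dag_comul_ε_eq' :
    dag D.comul ≫ D.ε = (D.dual ⊗ A) ◁ (β_ D.dual A).hom ≫ tensorμ D.dual A A D.dual ≫
      (D.ε ⊗ₘ dag D.η) ≫ (λ_ (𝟙_ C)).hom := by
  have h : (D.dual ⊗ A) ◁ (β_ D.dual A).hom ≫ tensorμ D.dual A A D.dual =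
      𝟙 _ ⊗≫ D.dual ◁ (β_ (A ⊗ D.dual) A).hom ⊗≫ 𝟙 _ := by
    rw [BraidedCategory.braiding_tensor_left_hom]
    simp only [tensorμ]
    monoidal
  have h1 : (β_ (A ⊗ D.dual) A).hom ≫ A ◁ dag D.η =
      dag D.η ▷ A ≫ (λ_ _).hom ≫ (ρ_ _).inv := by
    rw [← BraidedCategory.braiding_naturality_left, braiding_tensorUnit_left]
  symm
  calc
    _ = 𝟙 _ ⊗≫ D.dual ◁ ((β_ (A ⊗ D.dual) A).hom ≫ A ◁ dag D.η) ⊗≫ D.ε := by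
      rw [reassoc_of% h, MonoidalCategory.tensorHom_def']
      monoidal
    _ = _ := by
      rw [h1, dag_comul]
      monoidal

theorem comul_symmetric :
    (β_ (D.dual ⊗ A) (D.dual ⊗ A)).hom ≫ dag D.comul ≫ D.ε = dag D.comul ≫ D.ε := by
  have h : (β_ A D.dual).hom ≫ D.ε = dag D.η := by
    rw [D.ε_eq, SymmetricCategory.symmetry_assoc]
  have hδ : ∀ W X Y Z : C, tensorδ W X Y Z = tensorμ W Y X Z := fun W X Y Z => by
    simp [tensorδ, tensorμ, SymmetricCategory.braiding_swap_eq_inv_braiding X Y]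
  have h1 := tensorδ_braiding D.dual A A D.dual
  rw [hδ, hδ] at h1
  rw [dag_comul_ε_eq, ← BraidedCategory.braiding_naturality_right_assoc, reassoc_of% h1,
    tensorHom_comp_tensorHom_assoc, h, ← D.ε_eq, ← dag_comul_ε_eq', dag_comul_ε_eq]

end DaggerDual

/-- The normalised Frobenius structure on `A* ⊗ A`. The comonoid given by the cup and the cap of `A`
is special up to the scalar `dim A`. For a scalar `z` with `z† ∘ z ∘ dim A = 1`, the
comultiplication is multiplied by `z` and the counit by `w = z† ∘ dim A`, so that the counit laws
persist by `z ∘ w = 1`. -/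
def normalisedPants [DaggerSymmetricMonoidal C] {A : C} (D : DaggerDual A) (z : 𝟙_ C ⟶ 𝟙_ C)
    (hz : scalar (z ≫ dag z ≫ D.η ≫ dag D.η) (D.dual ⊗ A) = 𝟙 _) : CPStar C :=
  let w := dag z ≫ D.η ≫ dag D.η
  have hzw : z ≫ w = z ≫ dag z ≫ D.η ≫ dag D.η := rfl
  letI : ComonObj (D.dual ⊗ A) :=
    { comul := scalar z _ ≫ D.comul
      counit := scalar w _ ≫ D.ε
      counit_comul := by
        rw [comp_whiskerRight, scalar_whiskerRight, Category.assoc, ← Category.assoc D.comul,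
          scalar_natural, Category.assoc, reassoc_of% scalar_comp, hzw, hz,
          Category.id_comp,
          D.comul_ε_whiskerRight]
      comul_counit := by
        rw [MonoidalCategory.whiskerLeft_comp, whiskerLeft_scalar, Category.assoc,
          ← Category.assoc D.comul, scalar_natural, Category.assoc, reassoc_of% scalar_comp, hzw, hz,
          Category.id_comp,
          D.comul_whiskerLeft_ε]
      comul_assoc := by
        rw [MonoidalCategory.whiskerLeft_comp, whiskerLeft_scalar, comp_whiskerRight,
          scalar_whiskerRight]
        simp only [Category.assoc]
        rw [← Category.assoc D.comul, ← Category.assoc D.comul, scalar_natural, Category.assoc,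
          Category.assoc, D.comul_coassoc] }
  { as := D.dual ⊗ A
    frobenius := by
      apply CPStar.frobenius_of_choi_id
      change choi (scalar z _ ≫ D.comul) (dag (scalar z _ ≫ D.comul)) (𝟙 _) =
        dag (scalar z _ ≫ D.comul) ≫ scalar z _ ≫ D.comul
      rw [dag_comp, dag_scalar, scalar_natural]
      have h : choi (scalar z _ ≫ D.comul) (scalar (dag z) _ ≫ dag D.comul) (𝟙 _) =
          scalar (z ≫ dag z) _ ≫ choi D.comul (dag D.comul) (𝟙 _) := by
        simp only [choi, comp_whiskerRight, scalar_whiskerRight, Category.assoc,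
          MonoidalCategory.whiskerLeft_comp, whiskerLeft_scalar, id_whiskerRight, Category.id_comp,
          ← scalar_comp]
        congr 1
        rw [← Category.assoc, ← Category.assoc, scalar_natural]
        simp only [Category.assoc]
      rw [h, D.comul_frobenius, Category.assoc, ← Category.assoc (dag D.comul), scalar_natural,
        Category.assoc, reassoc_of% scalar_comp, ← scalar_comp, ← scalar_comp, scalar_natural]
    special := by
      change (scalar z _ ≫ D.comul) ≫ dag (scalar z _ ≫ D.comul) = 𝟙 _
      rw [dag_comp, dag_scalar, Category.assoc, scalar_natural, ← hz]
      rw [← Category.assoc D.comul, scalar_natural, Category.assoc, D.comul_dag_comul,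
        scalar_comp, scalar_comp]
    symmetric := by
      change (β_ _ _).hom ≫ dag (scalar z _ ≫ D.comul) ≫ scalar w _ ≫ D.ε =
        dag (scalar z _ ≫ D.comul) ≫ scalar w _ ≫ D.ε
      rw [dag_comp, dag_scalar, scalar_natural, Category.assoc, ← Category.assoc (dag D.comul),
        scalar_natural, ← Category.assoc (β_ _ _).hom, scalar_natural, Category.assoc,
        Category.assoc, ← Category.assoc (β_ _ _).hom, scalar_natural, Category.assoc,
        D.comul_symmetric] }

theorem choi_coact_dag_comul [DaggerSymmetricMonoidal C] {A : C} (D : DaggerDual A) :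
    choi D.coact (dag D.comul) (𝟙 _) = dag D.coact ≫ D.coact := by
  calc
    _ = 𝟙 _ ⊗≫ (D.η ▷ (A ⊗ D.dual) ≫ (A ⊗ D.dual) ◁ dag D.η) ▷ A ⊗≫ 𝟙 _ := by
      rw [D.dag_comul]
      simp only [choi, DaggerDual.coact]; monoidal
    _ = _ := by
      rw [← whisker_exchange]
      simp only [DaggerDual.coact, dag_comp, dag_whiskerRight, dag_associator,
        dag_leftUnitor_inv]
      monoidal

theorem choi_comul_act [DaggerSymmetricMonoidal C] {A : C} (D : DaggerDual A) :
    choi D.comul D.act (𝟙 _) = D.act ≫ dag D.act := by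
  calc
    _ = 𝟙 _ ⊗≫ D.dual ◁ (D.η ▷ (A ⊗ D.dual) ≫ (A ⊗ D.dual) ◁ dag D.η) ⊗≫ 𝟙 _ := by
      simp only [choi, DaggerDual.comul, DaggerDual.coact, DaggerDual.act]; monoidal
    _ = _ := by
      rw [← whisker_exchange]
      simp only [DaggerDual.act, dag_comp, dag_whiskerLeft, dag_associator, dag_dag,
        dag_rightUnitor]
      monoidal

theorem choi_scalar {S T K L : C} (c : S ⟶ S ⊗ K) (m : L ⊗ T ⟶ T) (s : 𝟙_ C ⟶ 𝟙_ C)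
    (f : K ⟶ L) : choi c m (scalar s K ≫ f) = scalar s _ ≫ choi c m f := by
  simp only [choi, comp_whiskerRight, scalar_whiskerRight, Category.assoc,
    MonoidalCategory.whiskerLeft_comp, whiskerLeft_scalar]
  rw [← Category.assoc, ← Category.assoc, scalar_natural]
  simp only [Category.assoc]

theorem choi_scalar_left {S T K L : C} (c : S ⟶ S ⊗ K) (m : L ⊗ T ⟶ T) (s : 𝟙_ C ⟶ 𝟙_ C)
    (f : K ⟶ L) : choi (scalar s S ≫ c) m f = scalar s _ ≫ choi c m f := by
  simp only [choi, comp_whiskerRight, scalar_whiskerRight, Category.assoc]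

theorem choi_scalar_right {S T K L : C} (c : S ⟶ S ⊗ K) (m : L ⊗ T ⟶ T) (s : 𝟙_ C ⟶ 𝟙_ C)
    (f : K ⟶ L) : choi c (scalar s _ ≫ m) f = scalar s _ ≫ choi c m f := by
  rw [← choi_scalar]
  simp only [choi, comp_whiskerRight, scalar_whiskerRight, Category.assoc]
  rw [← Category.assoc (f ▷ T), scalar_natural, Category.assoc]

/-- In the splitting, every object of `CPM C` is causally isomorphic to the image of a normalised
Frobenius structure, by the comultiplication and the multiplication, suitably scaled. -/
theorem exists_pants [DaggerSymmetricMonoidal C] (hpos : PositiveDimensional C) (B : CPM C) :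
    ∃ (X : CPStar C) (k : B ⟶ X.toCPM) (r : X.toCPM ⟶ B),
      k ≫ r = 𝟙 B ∧ (r ≫ k).1 = X.μ ≫ 𝟙 X.as ≫ X.δ ∧ Causal k := by
  obtain ⟨A, D⟩ := B
  obtain ⟨z, hz⟩ := hpos A D
  have hz' : scalar (z ≫ dag z ≫ D.η ≫ dag D.η) (D.dual ⊗ A) = 𝟙 _ := by
    rw [← whiskerLeft_scalar, scalar, hz, MonoidalCategory.whiskerLeft_id]
  let w := dag z ≫ D.η ≫ dag D.η
  have hzw : z ≫ w = z ≫ dag z ≫ D.η ≫ dag D.η := rfl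
  let X := normalisedPants D z hz'
  let δ' : D.dual ⊗ A ⟶ (D.dual ⊗ A) ⊗ (D.dual ⊗ A) := scalar z _ ≫ D.comul
  let μ' : (D.dual ⊗ A) ⊗ (D.dual ⊗ A) ⟶ D.dual ⊗ A := dag δ'
  let ε' : D.dual ⊗ A ⟶ 𝟙_ C := scalar w _ ≫ D.ε
  have hs : δ' ≫ μ' = 𝟙 _ := X.special
  have hμ : μ' = scalar (dag z) _ ≫ dag D.comul := by
    rw [← scalar_natural, ← dag_scalar, ← dag_comp]
  have hk : Positive (choi D.coact μ' (scalar z (D.dual ⊗ A))) := by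
    refine ⟨_, dag D.coact ≫ scalar (dag z) _, ?_⟩
    have h := choi_scalar D.coact μ' z (𝟙 _)
    rw [Category.comp_id] at h
    rw [h, hμ, choi_scalar_right, choi_coact_dag_comul, dag_comp, dag_scalar, dag_dag, dag_dag,
      Category.assoc, reassoc_of% scalar_comp, reassoc_of% scalar_comp,
      ← Category.assoc (dag D.coact),
      scalar_natural, Category.assoc, ← scalar_comp, ← scalar_comp, scalar_natural]
  have hr : Positive (choi δ' D.act (scalar w (D.dual ⊗ A))) := by
    refine ⟨_, D.act, ?_⟩
    have h := choi_scalar δ' D.act w (𝟙 _)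
    rw [Category.comp_id] at h
    rw [h, choi_scalar_left, choi_comul_act, ← Category.assoc, scalar_natural, scalar_comp, hzw,
      ← scalar_whiskerRight, hz', id_whiskerRight, Category.id_comp]
  have h1 : scalar z (D.dual ⊗ A) ≫ scalar w (D.dual ⊗ A) = 𝟙 _ := by rw [scalar_comp, hzw, hz']
  have h2 : scalar w (D.dual ⊗ A) ≫ scalar z (D.dual ⊗ A) = 𝟙 _ := by rw [scalar_natural, h1]
  refine ⟨X, ⟨scalar z (D.dual ⊗ A) ≫ δ', CPStar.isCP_comp_δ (B := ⟨A, D⟩) (X := X) hk⟩,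
    ⟨μ' ≫ scalar w (D.dual ⊗ A), CPStar.isCP_μ_comp (B := ⟨A, D⟩) (X := X) hr⟩, CPM.hom_ext ?_, ?_,
    CPM.hom_ext ?_⟩
  · change (scalar z (D.dual ⊗ A) ≫ δ') ≫ μ' ≫ scalar w (D.dual ⊗ A) = 𝟙 _
    rw [Category.assoc, reassoc_of% hs, h1]
  · change (μ' ≫ scalar w (D.dual ⊗ A)) ≫ scalar z (D.dual ⊗ A) ≫ δ' = μ' ≫ 𝟙 (D.dual ⊗ A) ≫ δ'
    rw [Category.assoc, reassoc_of% h2, Category.id_comp]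
  · change (scalar z (D.dual ⊗ A) ≫ δ') ≫ (μ' ≫ ε') ≫ (λ_ (𝟙_ C)).inv = D.ε ≫ (λ_ (𝟙_ C)).inv
    simp only [Category.assoc, reassoc_of% hs, ε', reassoc_of% h1]

end Pants

/-! ### Direct sums of Frobenius structures -/

section DirectSum

open TwoRoads.DaggerCategory (dag dag_id dag_comp dag_dag)
open TwoRoads.DaggerSymmetricMonoidal

variable {C : Type*} [Category* C] [DaggerCategory C]

theorem dag_eqToHom {A B : C} (h : A = B) : dag (eqToHom h) = eqToHom h.symm := by
  subst h; exact dag_id A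

variable [SemiAdditive C]

/-- Dagger biproducts of families indexed by a finite type. -/
theorem exists_daggerBiproduct [HasDaggerBiproducts C] {ι : Type*} [Fintype ι] (A : ι → C) :
    ∃ (B : C) (κ : ∀ i, A i ⟶ B),
      (∀ i, κ i ≫ dag (κ i) = 𝟙 (A i)) ∧ (∀ i j, i ≠ j → κ i ≫ dag (κ j) = 0) ∧
        ∑ i, dag (κ i) ≫ κ i = 𝟙 B := by
  let e := Fintype.equivFin ι
  obtain ⟨B, κ, h1, h2, h3⟩ := HasDaggerBiproducts.exists_biproduct _ fun k => A (e.symm k)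
  refine ⟨B, fun i => eqToHom (by simp) ≫ κ (e i), fun i => ?_, fun i j hij => ?_, ?_⟩
  · rw [dag_comp, dag_eqToHom, Category.assoc, reassoc_of% h1]; simp
  · rw [dag_comp, dag_eqToHom, Category.assoc,
      reassoc_of% h2 _ _ fun h => hij (e.injective h)]
    simp [SemiAdditive.comp_zero, SemiAdditive.zero_comp]
  · rw [← h3, ← e.sum_comp]
    refine Finset.sum_congr rfl fun i _ => ?_
    rw [dag_comp, dag_eqToHom]; simp

theorem dag_sum [DaggerSemiAdditive C] {ι : Type*} (s : Finset ι) {A B : C} (f : ι → (A ⟶ B)) :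
    dag (∑ i ∈ s, f i) = ∑ i ∈ s, dag (f i) :=
  map_sum (⟨⟨dag, dag_zero A B⟩, DaggerSemiAdditive.dag_add⟩ : (A ⟶ B) →+ (B ⟶ A)) f s

variable [MonoidalCategory C] [SemiAdditiveMonoidal C] [SymmetricCategory C]
  [DaggerSemiAdditive C] [DaggerSymmetricMonoidal C]

section

variable {ι : Type*} [Fintype ι]

/-- The comultiplication of the biproduct, summand by summand. -/
def directSumδ (X : ι → CPStar C) {B : C} (κ : ∀ i, (X i).as ⟶ B) : B ⟶ B ⊗ B :=
  ∑ i, dag (κ i) ≫ (X i).δ ≫ (κ i ⊗ₘ κ i)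

/-- The counit of the biproduct, summand by summand. -/
def directSumε (X : ι → CPStar C) {B : C} (κ : ∀ i, (X i).as ⟶ B) : B ⟶ 𝟙_ C :=
  ∑ i, dag (κ i) ≫ (X i).ε

variable {X : ι → CPStar C} {B : C} {κ : ∀ i, (X i).as ⟶ B}

theorem comp_directSumδ (h1 : ∀ i, κ i ≫ dag (κ i) = 𝟙 (X i).as)
    (h0 : ∀ i j, i ≠ j → κ i ≫ dag (κ j) = 0) (i : ι) :
    κ i ≫ directSumδ X κ = (X i).δ ≫ (κ i ⊗ₘ κ i) := by
  rw [directSumδ, comp_sum, Finset.sum_eq_single i]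
  · rw [reassoc_of% h1]
  · intro j _ hj
    rw [reassoc_of% h0 i j hj.symm, SemiAdditive.zero_comp]
  · simp

theorem comp_directSumε (h1 : ∀ i, κ i ≫ dag (κ i) = 𝟙 (X i).as)
    (h0 : ∀ i j, i ≠ j → κ i ≫ dag (κ j) = 0) (i : ι) :
    κ i ≫ directSumε X κ = (X i).ε := by
  rw [directSumε, comp_sum, Finset.sum_eq_single i]
  · rw [reassoc_of% h1]
  · intro j _ hj
    rw [reassoc_of% h0 i j hj.symm, SemiAdditive.zero_comp]
  · simp

theorem dag_directSumδ :
    dag (directSumδ X κ) = ∑ i, (dag (κ i) ⊗ₘ dag (κ i)) ≫ (X i).μ ≫ κ i := by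
  rw [directSumδ, dag_sum]
  refine Finset.sum_congr rfl fun i _ => ?_
  rw [dag_comp, dag_comp, dag_tensor, dag_dag, Category.assoc]

theorem tensor_directSumμ (h1 : ∀ i, κ i ≫ dag (κ i) = 𝟙 (X i).as)
    (h0 : ∀ i j, i ≠ j → κ i ≫ dag (κ j) = 0) (i : ι) :
    (κ i ⊗ₘ κ i) ≫ dag (directSumδ X κ) = (X i).μ ≫ κ i := by
  rw [dag_directSumδ, comp_sum, Finset.sum_eq_single i]
  · rw [tensorHom_comp_tensorHom_assoc, h1, id_tensorHom_id, Category.id_comp]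
  · intro j _ hj
    rw [tensorHom_comp_tensorHom_assoc, h0 i j hj.symm, SemiAdditiveMonoidal.zero_tensor,
      SemiAdditive.zero_comp]
  · simp

theorem tensor_directSumμ_of_ne (h0 : ∀ i j, i ≠ j → κ i ≫ dag (κ j) = 0) {i j : ι} (hij : i ≠ j) :
    (κ i ⊗ₘ κ j) ≫ dag (directSumδ X κ) = 0 := by
  rw [dag_directSumδ, comp_sum]
  refine Finset.sum_eq_zero fun k _ => ?_
  rw [tensorHom_comp_tensorHom_assoc]
  by_cases hk : i = k
  · rw [h0 j k (fun h => hij (hk.trans h.symm)), SemiAdditiveMonoidal.tensor_zero,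
      SemiAdditive.zero_comp]
  · rw [h0 i k hk, SemiAdditiveMonoidal.zero_tensor, SemiAdditive.zero_comp]

theorem ext_of_sum (hs : ∑ i, dag (κ i) ≫ κ i = 𝟙 B) {Y : C} {f g : B ⟶ Y}
    (h : ∀ i, κ i ≫ f = κ i ≫ g) : f = g := by
  rw [← Category.id_comp f, ← Category.id_comp g, ← hs, sum_comp, sum_comp]
  simp only [Category.assoc, h]

theorem ext_tensor_of_sum (hs : ∑ i, dag (κ i) ≫ κ i = 𝟙 B) {Y : C} {f g : B ⊗ B ⟶ Y}
    (h : ∀ i j, (κ i ⊗ₘ κ j) ≫ f = (κ i ⊗ₘ κ j) ≫ g) : f = g := by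
  have h2 : (𝟙 (B ⊗ B) : B ⊗ B ⟶ B ⊗ B) =
      ∑ i, ∑ j, (dag (κ i) ⊗ₘ dag (κ j)) ≫ (κ i ⊗ₘ κ j) := by
    simp only [tensorHom_comp_tensorHom, ← tensor_sum, ← sum_tensor, hs, id_tensorHom_id]
  rw [← Category.id_comp f, ← Category.id_comp g, h2]
  simp only [sum_comp, Category.assoc, h]

/-- The Frobenius structure on a dagger biproduct of Frobenius structures. -/
def directSum (h1 : ∀ i, κ i ≫ dag (κ i) = 𝟙 (X i).as)
    (h0 : ∀ i j, i ≠ j → κ i ≫ dag (κ j) = 0) (hs : ∑ i, dag (κ i) ≫ κ i = 𝟙 B) : CPStar C :=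
  have hδ := comp_directSumδ h1 h0
  have hε := comp_directSumε h1 h0
  have hμ := tensor_directSumμ h1 h0
  have hμ0 : ∀ i j, i ≠ j → (κ i ⊗ₘ κ j) ≫ dag (directSumδ X κ) = 0 :=
    fun i j => tensor_directSumμ_of_ne h0
  letI : ComonObj B :=
    { comul := directSumδ X κ
      counit := directSumε X κ
      counit_comul := ext_of_sum hs fun i => by
        have h : (X i).δ ≫ (X i).ε ▷ (X i).as = (λ_ _).inv := ComonObj.counit_comul _
        rw [reassoc_of% hδ, ← tensorHom_id, tensorHom_comp_tensorHom, hε, Category.comp_id,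
          MonoidalCategory.tensorHom_def, reassoc_of% h, leftUnitor_inv_naturality]
      comul_counit := ext_of_sum hs fun i => by
        have h : (X i).δ ≫ (X i).as ◁ (X i).ε = (ρ_ _).inv := ComonObj.comul_counit _
        rw [reassoc_of% hδ, ← id_tensorHom, tensorHom_comp_tensorHom, hε, Category.comp_id,
          tensorHom_def', reassoc_of% h, rightUnitor_inv_naturality]
      comul_assoc := ext_of_sum hs fun i => by
        have h : (X i).δ ≫ (X i).as ◁ (X i).δ = (X i).δ ≫ (X i).δ ▷ (X i).as ≫ (α_ _ _ _).hom :=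
          ComonObj.comul_assoc _
        rw [reassoc_of% hδ, reassoc_of% hδ, ← id_tensorHom, ← tensorHom_id,
          tensorHom_comp_tensorHom, tensorHom_comp_tensorHom_assoc, hδ, Category.comp_id]
        have h3 : (κ i ⊗ₘ ((X i).δ ≫ (κ i ⊗ₘ κ i))) = (X i).as ◁ (X i).δ ≫ (κ i ⊗ₘ κ i ⊗ₘ κ i) := by
          rw [← id_tensorHom, tensorHom_comp_tensorHom, Category.id_comp]
        have h4 : (((X i).δ ≫ (κ i ⊗ₘ κ i)) ⊗ₘ κ i) =
            (X i).δ ▷ (X i).as ≫ ((κ i ⊗ₘ κ i) ⊗ₘ κ i) := by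
          rw [← tensorHom_id, tensorHom_comp_tensorHom, Category.id_comp]
        rw [h3, h4, reassoc_of% h, Category.assoc, associator_naturality] }
  { as := B
    frobenius := by
      apply CPStar.frobenius_of_choi_id
      change choi (directSumδ X κ) (dag (directSumδ X κ)) (𝟙 B) =
        dag (directSumδ X κ) ≫ directSumδ X κ
      have key : ∀ i j, (κ i ⊗ₘ κ j) ≫ choi (directSumδ X κ) (dag (directSumδ X κ)) (𝟙 B) =
          (X i).δ ▷ (X j).as ≫ (α_ _ _ _).hom ≫ (κ i ⊗ₘ ((κ i ⊗ₘ κ j) ≫ dag (directSumδ X κ))) := by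
        intro i j
        rw [choi, id_whiskerRight, Category.id_comp, ← tensorHom_id (directSumδ X κ),
          tensorHom_comp_tensorHom_assoc, hδ, Category.comp_id]
        have h4 : (((X i).δ ≫ (κ i ⊗ₘ κ i)) ⊗ₘ κ j) =
            (X i).δ ▷ (X j).as ≫ ((κ i ⊗ₘ κ i) ⊗ₘ κ j) := by
          rw [← tensorHom_id, tensorHom_comp_tensorHom, Category.id_comp]
        rw [h4, Category.assoc, associator_naturality_assoc, ← id_tensorHom,
          tensorHom_comp_tensorHom, Category.comp_id]
      refine ext_tensor_of_sum hs fun i j => ?_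
      rw [key]
      by_cases hij : i = j
      · subst hij
        have h5 : (κ i ⊗ₘ ((X i).μ ≫ κ i)) = (X i).as ◁ (X i).μ ≫ (κ i ⊗ₘ κ i) := by
          rw [← id_tensorHom, tensorHom_comp_tensorHom, Category.id_comp]
        have h6 := (X i).frobenius_left
        rw [hμ, h5, reassoc_of% h6, reassoc_of% hμ, hδ]
      · rw [hμ0 i j hij, reassoc_of% hμ0 i j hij, SemiAdditiveMonoidal.tensor_zero,
          SemiAdditive.zero_comp, SemiAdditive.comp_zero, SemiAdditive.comp_zero]
    special := ext_of_sum hs fun i => by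
      change κ i ≫ directSumδ X κ ≫ dag (directSumδ X κ) = κ i ≫ 𝟙 B
      rw [reassoc_of% hδ, hμ, reassoc_of% (X i).special, Category.comp_id]
    symmetric := ext_tensor_of_sum hs fun i j => by
      change (κ i ⊗ₘ κ j) ≫ (β_ B B).hom ≫ dag (directSumδ X κ) ≫ directSumε X κ =
        (κ i ⊗ₘ κ j) ≫ dag (directSumδ X κ) ≫ directSumε X κ
      rw [BraidedCategory.braiding_naturality_assoc]
      by_cases hij : i = j
      · subst hij
        rw [reassoc_of% hμ, hε]
        exact (X i).symmetric
      · rw [reassoc_of% hμ0 i j hij, reassoc_of% hμ0 j i (Ne.symm hij), SemiAdditive.zero_comp,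
          SemiAdditive.zero_comp, SemiAdditive.comp_zero] }

end

/-- Finite families of Frobenius structures have a direct sum in `CP* C`: the injections are causal
and together with their daggers they satisfy the equations of a biproduct. -/
theorem exists_directSum [HasDaggerBiproducts C] {ι : Type*} [Fintype ι] (X : ι → CPStar C) :
    ∃ (Y : CPStar C) (κ : ∀ i, X i ⟶ Y) (π : ∀ i, Y ⟶ X i),
      (∀ i, κ i ≫ π i = 𝟙 _) ∧ (∀ i j, i ≠ j → (κ i ≫ π j).1 = 0) ∧
        ∑ i, (π i ≫ κ i).1 = 𝟙 Y.as ∧ ∀ i, Causal (κ i) := by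
  obtain ⟨B, κ, h1, h0, hs⟩ := exists_daggerBiproduct fun i => (X i).as
  have hδ := comp_directSumδ h1 h0
  have hμ := tensor_directSumμ h1 h0
  have hμ0 : ∀ i j, i ≠ j → (κ i ⊗ₘ κ j) ≫ dag (directSumδ X κ) = 0 :=
    fun i j => tensor_directSumμ_of_ne h0
  have e1 : ∀ i, κ i ▷ B ≫ dag (directSumδ X κ) = (X i).as ◁ dag (κ i) ≫ (X i).μ ≫ κ i := by
    intro i
    have h2 : ∀ f g : (X i).as ⊗ B ⟶ B, (∀ j, (X i).as ◁ κ j ≫ f = (X i).as ◁ κ j ≫ g) → f = g := by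
      intro f g h
      have h3 : 𝟙 ((X i).as ⊗ B) = ∑ j, (X i).as ◁ dag (κ j) ≫ (X i).as ◁ κ j := by
        simp only [← id_tensorHom, tensorHom_comp_tensorHom, Category.comp_id, ← tensor_sum, hs,
          id_tensorHom_id]
      rw [← Category.id_comp f, ← Category.id_comp g, h3]
      simp only [sum_comp, Category.assoc, h]
    refine h2 _ _ fun j => ?_
    rw [← tensorHom_def'_assoc]
    by_cases hij : i = j
    · subst hij
      rw [hμ, ← MonoidalCategory.whiskerLeft_comp_assoc, h1, MonoidalCategory.whiskerLeft_id,
        Category.id_comp]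
    · rw [hμ0 i j hij, ← MonoidalCategory.whiskerLeft_comp_assoc, h0 j i (Ne.symm hij),
        ← id_tensorHom, SemiAdditiveMonoidal.tensor_zero, SemiAdditive.zero_comp]
  have e2 : ∀ i, directSumδ X κ ≫ B ◁ dag (κ i) = dag (κ i) ≫ (X i).δ ≫ κ i ▷ (X i).as := by
    intro i
    refine ext_of_sum hs fun j => ?_
    rw [reassoc_of% hδ, ← id_tensorHom, tensorHom_comp_tensorHom, Category.comp_id]
    by_cases hij : j = i
    · subst hij
      rw [h1, reassoc_of% h1, tensorHom_id]
    · rw [h0 j i hij, reassoc_of% h0 j i hij, SemiAdditiveMonoidal.tensor_zero,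
        SemiAdditive.zero_comp, SemiAdditive.comp_zero]
  let Y := directSum h1 h0 hs
  refine ⟨Y, fun i => ⟨κ i, ?_⟩, fun i => ⟨dag (κ i), ?_⟩, fun i => CPStar.hom_ext (h1 i),
    fun i j hij => h0 i j hij, hs, fun i => CPStar.hom_ext (comp_directSumε h1 h0 i)⟩
  · change Positive (choi (X i).δ (dag (directSumδ X κ)) (κ i))
    have h := (X i).isCP_id.conj ((X i).as ◁ dag (κ i))
    have h2 : choi (X i).δ (dag (directSumδ X κ)) (κ i) =
      (X i).as ◁ dag (κ i) ≫ choi (X i).δ (X i).μ (𝟙 _) ≫ dag ((X i).as ◁ dag (κ i)) := by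
      rw [choi, e1, choi, dag_whiskerLeft, dag_dag]
      simp only [MonoidalCategory.whiskerLeft_comp, id_whiskerRight, Category.id_comp,
        Category.assoc]
      rw [← associator_naturality_right_assoc, whisker_exchange_assoc]
    rw [h2]; exact h
  · change Positive (choi (directSumδ X κ) (X i).μ (dag (κ i)))
    have h := (X i).isCP_id.conj (dag (κ i) ▷ (X i).as)
    have h2 : choi (directSumδ X κ) (X i).μ (dag (κ i)) =
      dag (κ i) ▷ (X i).as ≫ choi (X i).δ (X i).μ (𝟙 _) ≫ dag (dag (κ i) ▷ (X i).as) := by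
      have h3 := choi_precomp (directSumδ X κ) (X i).μ (dag (κ i)) (𝟙 _) (𝟙 _)
      rw [Category.comp_id, Category.comp_id, id_whiskerRight, Category.id_comp, e2] at h3
      rw [h3, choi, choi, dag_whiskerRight, dag_dag]
      simp only [comp_whiskerRight, id_whiskerRight, Category.id_comp,
        Category.assoc]
      rw [associator_naturality_left_assoc, whisker_exchange]
    rw [h2]; exact h

end DirectSum

/-! ### Causal sums and equivalences for `CPM C` -/

section CPMEquivalence

open TwoRoads.DaggerCategory (dag dag_id dag_comp dag_dag)

variable {C : Type*} [Category* C] [MonoidalCategory C] [SymmetricCategory C]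
  [DaggerCategory C] [SemiAdditive C] [SemiAdditiveMonoidal C]
  [DaggerSemiAdditive C] [HasDaggerBiproducts C]

theorem CPM.sum_val [DaggerSymmetricMonoidal C] {ι : Type*} (s : Finset ι) {A B : CPM C}
    (f : ι → (A ⟶ B)) : (∑ i ∈ s, f i).1 = ∑ i ∈ s, (f i).1 :=
  map_sum (⟨⟨Subtype.val, rfl⟩, fun _ _ => rfl⟩ : (A ⟶ B) →+ (A.double ⟶ B.double)) f s

/-- The image in the splitting of a direct sum of normalised Frobenius structures is a causal sum
of the corresponding objects of `CPM C`. -/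
theorem exists_causalSum_toSplitDagger [DaggerSymmetricMonoidal C] (hpos : PositiveDimensional C)
    (M : BiprodCompletion (CPM C)) :
    ∃ Y : CPStar C, Nonempty (CausalSum (toSplitCausal (CPM C)) M
      ((CPStar.toSplitDagger C).obj Y).obj) := by
  choose X k r hkr hrk hk using fun i => exists_pants hpos (M.X i)
  obtain ⟨Y, κ, π, h1, h0, hs, hc⟩ := exists_directSum X
  let G {A B : CPStar C} (f : A ⟶ B) : A.toCPM ⟶ B.toCPM :=
    ⟨A.μ ≫ f.1 ≫ B.δ, CPStar.isCP_sandwich f.2⟩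
  have hp : ∀ i, r i ≫ k i = G (𝟙 (X i)) := fun i => CPM.hom_ext (hrk i)
  have hκ : ∀ i, Causal (G (κ i)) := fun i => by
    have h := CPStar.isCausalFunctor_toSplitDagger.map (hc i)
    rw [causal_fullSubcategory_iff, causal_splitCausal_iff] at h
    exact h
  have hG : ∀ {A B D : CPStar C} (f : A ⟶ B) (g : B ⟶ D), G f ≫ G g = G (f ≫ g) := fun f g =>
    CPM.hom_ext (CPStar.sandwich_comp _ _ _ f.1 g.1)
  have hkp : ∀ i, k i ≫ G (𝟙 (X i)) = k i := fun i => by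
    rw [← hp, reassoc_of% hkr]
  have e1 : ∀ i, (k i ≫ G (κ i)) ≫ G (π i) ≫ r i = 𝟙 (M.X i) := fun i => by
    rw [Category.assoc, reassoc_of% hG, h1, reassoc_of% hkp, hkr]
  have e2 : ∀ i j, i ≠ j → (k i ≫ G (κ i)) ≫ G (π j) ≫ r j = 0 := fun i j hij => by
    have h : G (κ i ≫ π j) = 0 := CPM.hom_ext (by
      change (X i).μ ≫ (κ i ≫ π j).1 ≫ (X j).δ = 0
      rw [h0 i j hij, SemiAdditive.zero_comp, SemiAdditive.comp_zero])
    rw [Category.assoc, reassoc_of% hG, h, SemiAdditive.zero_comp, SemiAdditive.comp_zero]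
  have e3 : ∑ i, (G (π i) ≫ r i) ≫ k i ≫ G (κ i) = G (𝟙 Y) := by
    have h : ∀ i, (G (π i) ≫ r i) ≫ k i ≫ G (κ i) = G (π i ≫ κ i) := fun i => by
      rw [Category.assoc, ← Category.assoc (r i), hp, hG, hG, Category.id_comp]
    simp only [h]
    apply CPM.hom_ext
    rw [CPM.sum_val]
    change ∑ i, Y.μ ≫ (π i ≫ κ i).1 ≫ Y.δ = Y.μ ≫ 𝟙 Y.as ≫ Y.δ
    rw [← hs, sum_comp, comp_sum]
  exact ⟨Y, ⟨causalSumOfSplitting (Z := ((CPStar.toSplitDagger C).obj Y).obj)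
    (fun i => k i ≫ G (κ i)) (fun i => G (π i) ≫ r i) e1 e2 e3 fun i => (hk i).comp (hκ i)⟩⟩

variable [DaggerCompact C]

/-- The equivalences for `CPM C`. The first functor is the equivalence of the biproduct completion
with the splitting, followed by an inverse of the embedding of `CP* C`. -/
theorem cpm_equivalences (hpos : PositiveDimensional C)
    (hfd : FiniteDecompositionProperty (CPM C)) :
    (∃ F₁ : BiprodCompletion (CPM C) ⥤ CPStar C,
        CausallyIsomorphic
          (BiprodCompletion.incl (CPM C) ⋙ F₁ ⋙ CPStar.toSplitDagger C ⋙ (daggerIdempotents C).ι)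
          (toSplitCausal (CPM C)) ∧
        IsCausalMonoidalEquivalence F₁) ∧
      IsCausalMonoidalEquivalence (CPStar.toSplitDagger C) ∧
      IsCausalMonoidalEquivalence (daggerIdempotents C).ι := by
  have hQ : ∀ A, daggerIdempotents C ((toSplitCausal (CPM C)).obj A) := fun A => dag_id _
  have hsum : ∀ M, ∃ Z : SplitDaggerCausal C,
      Nonempty (CausalSum (toSplitCausal (CPM C)) M Z.obj) := fun M =>
    let ⟨Y, hY⟩ := exists_causalSum_toSplitDagger hpos M
    ⟨_, hY⟩
  have hS : IsCausalMonoidalEquivalence (CPStar.toSplitDagger C) := by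
    refine .of_fullyFaithful CPStar.isCausalFunctor_toSplitDagger
      CPStar.exists_monoidal_toSplitDagger fun Z => ?_
    obtain ⟨M, ⟨c⟩⟩ := (hfd _ Z.obj.obj.p Z.obj.obj.idem Z.obj.property).exists_causalSum
    obtain ⟨Y, ⟨c'⟩⟩ := exists_causalSum_toSplitDagger hpos M
    refine ⟨Y, (daggerIdempotents C).isoMk (c'.iso c), ?_⟩
    rw [causal_fullSubcategory_iff]
    exact c'.causal_iso c
  obtain ⟨J, hJ, hJi⟩ := exists_biprodCompletion_equivalence hQ hsum hfd
  obtain ⟨G, hG, hGi, -⟩ := hS.exists_inverse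
  have hι := isCausalMonoidalEquivalence_ι hsum hfd
  refine ⟨⟨J ⋙ G, ?_, hJ.comp hG⟩, hS, hι⟩
  have h1 : CausallyIsomorphic ((BiprodCompletion.incl (CPM C) ⋙ J) ⋙ (G ⋙ CPStar.toSplitDagger C))
      ((BiprodCompletion.incl (CPM C) ⋙ J) ⋙ 𝟭 _) := hGi.whiskerLeft _
  have h2 := h1.trans hJi
  exact h2.whiskerRight hι.causal

end CPMEquivalence

/-! ### Characterisation of the matrix trace -/

section TraceUniqueness

/-- A minimal idempotent of a complex algebra: a nonzero idempotent `p` such that `p A p` consists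
of the multiples of `p`. -/
def IsMinimalIdempotent {A : Type*} [Ring A] [Algebra ℂ A] (p : A) : Prop :=
  p ≠ 0 ∧ p * p = p ∧ ∀ x, ∃ c : ℂ, p * x * p = c • p

variable {A : Type*} [CStarAlgebra A]

theorem IsMatrixTrace.mul_comm {τ : A →ₗ[ℂ] ℂ} (h : IsMatrixTrace τ) (x y : A) :
    τ (x * y) = τ (y * x) := by
  obtain ⟨n, d, e, h⟩ := h
  rw [h, h]
  refine Finset.sum_congr rfl fun i _ => ?_
  rw [map_mul, map_mul, Pi.mul_apply, Pi.mul_apply, Matrix.trace_mul_comm]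

/-- The matrix trace of a minimal idempotent `p` is `1`. With `v = p v ≠ 0` and `f v = 1`, the
element `p (v f) p` has rank one and is a multiple of `p`, so `p` is a projection of rank one in a
single block. -/
theorem IsMatrixTrace.apply_of_isMinimalIdempotent {τ : A →ₗ[ℂ] ℂ} (h : IsMatrixTrace τ) {p : A}
    (hp : IsMinimalIdempotent p) : τ p = 1 := by
  obtain ⟨n, d, e, h⟩ := h
  obtain ⟨h0, hpp, hmin⟩ := hp
  rw [h]
  set q := e p with hq
  have hq0 : q ≠ 0 := fun h => h0 (e.injective (by rw [← hq, h, map_zero]))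
  have hqq : q * q = q := by rw [hq, ← map_mul, hpp]
  obtain ⟨i, hi⟩ := Function.ne_iff.1 hq0
  have hqi : q i * q i = q i := congrFun hqq i
  -- a vector `v` of the range of the block `q i`, and a functional `f` with `f v = 1`
  obtain ⟨w, hw⟩ : ∃ w, (q i).mulVec w ≠ 0 := by
    by_contra! hc
    exact hi (Matrix.toLin'.injective (LinearMap.ext fun w => by simpa using hc w))
  obtain ⟨v, hv⟩ : ∃ v, v = (q i).mulVec w := ⟨_, rfl⟩
  rw [← hv] at hw
  have hqv : (q i).mulVec v = v := by rw [hv, Matrix.mulVec_mulVec, hqi]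
  obtain ⟨k, hk⟩ := Function.ne_iff.1 hw
  obtain ⟨f, hf⟩ : ∃ f : Fin (d i) → ℂ, f ⬝ᵥ v = 1 :=
    ⟨Pi.single k (v k)⁻¹, by rw [single_dotProduct]; exact inv_mul_cancel₀ hk⟩
  let g := Matrix.vecMul f (q i)
  have hgv : g ⬝ᵥ v = 1 := by rw [← Matrix.dotProduct_mulVec, hqv, hf]
  obtain ⟨c, hc⟩ := hmin (e.symm (Pi.single i (Matrix.vecMulVec v f)))
  have hc' : q * Pi.single i (Matrix.vecMulVec v f) * q = c • q := by
    have := congrArg e hc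
    rwa [map_mul, map_mul, AlgEquiv.apply_symm_apply, map_smul] at this
  have hci : Matrix.vecMulVec v g = c • q i := by
    have := congrFun hc' i
    rw [Pi.mul_apply, Pi.mul_apply, Pi.single_eq_same, Matrix.mul_vecMulVec, Matrix.vecMulVec_mul,
      hqv] at this
    exact this
  have hc1 : c = 1 := by
    have := congrFun (congrArg (fun X => Matrix.mulVec X v) hci) k
    simp only [Matrix.vecMulVec_mulVec, Matrix.smul_mulVec, hqv, hgv] at this
    have h2 : v k = c * v k := by simpa using this
    exact (mul_right_cancel₀ hk (by rw [one_mul]; exact h2)).symm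
  rw [hc1, one_smul] at hc' hci
  rw [Finset.sum_eq_single i]
  · rw [← hci, Matrix.trace_vecMulVec, dotProduct_comm, hgv]
  · intro j _ hj
    rw [← congrFun hc' j, Pi.mul_apply, Pi.mul_apply, Pi.single_eq_of_ne hj, mul_zero, zero_mul,
      Matrix.trace_zero]
  · simp

/-- A tracial functional taking the same value `c` on all minimal idempotents is `c` times the
matrix trace. -/
theorem IsMatrixTrace.eq_smul {τ : A →ₗ[ℂ] ℂ} (h : IsMatrixTrace τ) {φ : A →ₗ[ℂ] ℂ} {c : ℂ}
    (hφ : ∀ x y, φ (x * y) = φ (y * x)) (hc : ∀ p, IsMinimalIdempotent p → φ p = c) :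
    φ = c • τ := by
  classical
  have h1 : ∀ p, IsMinimalIdempotent p → (c • τ) p = c := fun p hp => by
    rw [LinearMap.smul_apply, h.apply_of_isMinimalIdempotent hp, smul_eq_mul, mul_one]
  have h2 : ∀ x y, (c • τ) (x * y) = (c • τ) (y * x) := fun x y => by
    rw [LinearMap.smul_apply, h.mul_comm, LinearMap.smul_apply]
  obtain ⟨n, d, e, -⟩ := h
  have hE : ∀ i (a : Fin (d i)), IsMinimalIdempotent (A := A)
      (e.symm (Pi.single i (Matrix.single a a (1 : ℂ)))) := by
    intro i a
    refine ⟨fun h => ?_, ?_, fun x => ?_⟩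
    · have := congrArg e h
      rw [AlgEquiv.apply_symm_apply, map_zero] at this
      have h3 := congrFun (congrFun (congrFun this i) a) a
      simp at h3
    · rw [← map_mul, ← Pi.single_mul, Matrix.single_mul_single_same, one_mul]
    · refine ⟨e x i a a, e.injective ?_⟩
      rw [map_mul, map_mul, map_smul, AlgEquiv.apply_symm_apply]
      funext j
      by_cases hj : j = i
      · subst hj
        ext b b'
        simp [Matrix.single_mul_mul_single, Matrix.single_apply]
      · simp [Pi.single_eq_of_ne hj]
  have key : ∀ ψ : A →ₗ[ℂ] ℂ, (∀ x y, ψ (x * y) = ψ (y * x)) →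
      (∀ p, IsMinimalIdempotent p → ψ p = c) → ∀ i (a b : Fin (d i)),
        ψ (e.symm (Pi.single i (Matrix.single a b (1 : ℂ)))) = if a = b then c else 0 := by
    intro ψ hψ hψc i a b
    by_cases hab : a = b
    · subst hab
      rw [if_pos rfl, hψc _ (hE i a)]
    · have h3 : (Pi.single i (Matrix.single a b (1 : ℂ)) : (j : Fin n) →
          Matrix (Fin (d j)) (Fin (d j)) ℂ) =
          Pi.single i (Matrix.single a a (1 : ℂ)) * Pi.single i (Matrix.single a b (1 : ℂ)) := by
        rw [← Pi.single_mul, Matrix.single_mul_single_same, one_mul]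
      rw [if_neg hab, h3, map_mul, hψ, ← map_mul, ← Pi.single_mul,
        Matrix.single_mul_single_of_ne _ _ _ _ (Ne.symm hab), Pi.single_zero, map_zero, map_zero]
  suffices h3 : φ ∘ₗ e.symm.toLinearMap = (c • τ) ∘ₗ e.symm.toLinearMap by
    ext x
    have := congrArg (fun f => f (e x)) h3
    simpa using this
  refine LinearMap.pi_ext' fun i => Matrix.ext_linearMap _ fun a b => ?_
  refine LinearMap.ext_ring ?_
  exact (key φ hφ hc i a b).trans (key _ h2 h1 i a b).symm

variable [FiniteDimensional ℂ A]

theorem IsMatrixTrace.eq_matrixTrace {τ : A →ₗ[ℂ] ℂ} (h : IsMatrixTrace τ) :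
    τ = matrixTrace A := by
  rw [isMatrixTrace_matrixTrace.eq_smul h.mul_comm fun p => h.apply_of_isMinimalIdempotent,
    one_smul]

theorem matrixTrace_mul_comm (x y : A) : matrixTrace A (x * y) = matrixTrace A (y * x) :=
  isMatrixTrace_matrixTrace.mul_comm x y

theorem matrixTrace_algEquiv {B : Type*} [CStarAlgebra B] [FiniteDimensional ℂ B] (e : A ≃ₐ[ℂ] B)
    (x : A) : matrixTrace B (e x) = matrixTrace A x := by
  have h : IsMatrixTrace (matrixTrace B ∘ₗ e.toLinearMap) := by
    obtain ⟨n, d, f, h⟩ := isMatrixTrace_matrixTrace (A := B)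
    exact ⟨n, d, e.trans f, fun x => h (e x)⟩
  exact congrArg (fun f => f x) h.eq_matrixTrace

theorem matrixTrace_pi {ι : Type*} [Fintype ι] (B : ι → Type*) [∀ i, CStarAlgebra (B i)]
    [∀ i, FiniteDimensional ℂ (B i)] (x : ∀ i, B i) :
    matrixTrace (∀ i, B i) x = ∑ i, matrixTrace (B i) (x i) := by
  classical
  let φ : (∀ i, B i) →ₗ[ℂ] ℂ := ∑ i, matrixTrace (B i) ∘ₗ LinearMap.proj i
  have hφ : ∀ x, φ x = ∑ i, matrixTrace (B i) (x i) := fun x => by simp [φ]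
  have h := isMatrixTrace_matrixTrace (A := ∀ i, B i)|>.eq_smul (φ := φ) (c := 1) (fun x y => by
    rw [hφ, hφ]
    exact Finset.sum_congr rfl fun i _ => matrixTrace_mul_comm _ _) fun p hp => by
      obtain ⟨h0, hpp, hmin⟩ := hp
      obtain ⟨i, hi⟩ := Function.ne_iff.1 h0
      have hpi : p i * p i = p i := congrFun hpp i
      obtain ⟨c, hc⟩ := hmin (Pi.single i 1)
      have hci := congrFun hc i
      rw [Pi.mul_apply, Pi.mul_apply, Pi.single_eq_same, mul_one, hpi, Pi.smul_apply] at hci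
      have hc1 : c = 1 := by
        by_contra hne
        have h2 : (1 - c) • p i = 0 := by rw [sub_smul, one_smul, ← hci, sub_self]
        rcases smul_eq_zero.1 h2 with h3 | h3
        · exact hne (sub_eq_zero.1 h3).symm
        · exact hi h3
      rw [hc1, one_smul] at hc
      rw [hφ, Finset.sum_eq_single i]
      · refine isMatrixTrace_matrixTrace.apply_of_isMinimalIdempotent ⟨hi, hpi, fun x => ?_⟩
        obtain ⟨c, hc⟩ := hmin (Pi.single i x)
        have := congrFun hc i
        rw [Pi.mul_apply, Pi.mul_apply, Pi.single_eq_same] at this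
        exact ⟨c, this⟩
      · intro j _ hj
        rw [← congrFun hc j, Pi.mul_apply, Pi.mul_apply, Pi.single_eq_of_ne hj, mul_zero, zero_mul,
          map_zero]
      · simp
  rw [one_smul] at h
  rw [← hφ, h]

/-- The matrix trace is faithful. -/
theorem eq_zero_of_matrixTrace_eq_zero {y : A} (h : matrixTrace A (star y * y) = 0) : y = 0 := by
  obtain ⟨n, d, e, he⟩ := isMatrixTrace_matrixTrace (A := A)
  let π : ∀ i, A →ₐ[ℂ] Module.End ℂ (Fin (d i) → ℂ) := fun i =>
    (Matrix.toLinAlgEquiv' (R := ℂ) (n := Fin (d i))).toAlgHom.comp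
      ((Pi.evalAlgHom ℂ (fun i => Matrix (Fin (d i)) (Fin (d i)) ℂ) i).comp e.toAlgHom)
  have hπ : ∀ i x, LinearMap.trace ℂ _ (π i x) = (e x i).trace := fun i x =>
    Matrix.trace_toLin'_eq _
  rw [he] at h
  have h1 : ∀ i, (e (star y * y) i).trace = 0 := fun i =>
    (Finset.sum_eq_zero_iff_of_nonneg fun i _ => by rw [← hπ]; exact trace_rep_nonneg (π i) y).1 h i
      (Finset.mem_univ i)
  have h2 : ∀ i, IsNilpotent (π i (star y * y)) := fun i =>
    isNilpotent_of_trace_rep_eq_zero (π i) y (by rw [hπ, h1])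
  choose m hm using h2
  refine eq_zero_of_isNilpotent_star_mul_self ⟨∑ i, m i, e.injective ?_⟩
  rw [map_zero]
  funext i
  have h3 : π i ((star y * y) ^ ∑ i, m i) = 0 := by
    rw [map_pow]
    exact pow_eq_zero_of_le (Finset.single_le_sum (fun _ _ => Nat.zero_le _) (Finset.mem_univ i))
      (hm i)
  exact (Matrix.toLinAlgEquiv' (R := ℂ) (n := Fin (d i))).injective (h3.trans (map_zero _).symm)

/-- A tracial functional on a tensor product with value `1` on minimal idempotents is the product of
the matrix traces, because the tensor product of two minimal idempotents is minimal. -/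
theorem matrixTrace_tmul {B : Type*} [CStarAlgebra B] [FiniteDimensional ℂ B]
    (τ : A ⊗[ℂ] B →ₗ[ℂ] ℂ)
    (hτ : ∀ x y, τ (x * y) = τ (y * x)) (hp : ∀ p, IsMinimalIdempotent p → τ p = 1)
    (x : A) (y : B) :
    τ (x ⊗ₜ y) = matrixTrace A x * matrixTrace B y := by
  have hpq : ∀ (p : A) (q : B), IsMinimalIdempotent p → IsMinimalIdempotent q →
      IsMinimalIdempotent (p ⊗ₜ[ℂ] q) := by
    intro p q hp hq
    refine ⟨fun h => ?_, ?_, fun z => ?_⟩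
    · obtain ⟨f, hf⟩ := not_forall.1 (mt (Module.forall_dual_apply_eq_zero_iff ℂ p).1 hp.1)
      obtain ⟨g, hg⟩ := not_forall.1 (mt (Module.forall_dual_apply_eq_zero_iff ℂ q).1 hq.1)
      have := congrArg (TensorProduct.lid ℂ ℂ ∘ TensorProduct.map f g) h
      simp [hf, hg] at this
    · rw [Algebra.TensorProduct.tmul_mul_tmul, hp.2.1, hq.2.1]
    · induction z using TensorProduct.induction_on with
      | zero => exact ⟨0, by simp⟩
      | add z z' hz hz' =>
        obtain ⟨c, hc⟩ := hz
        obtain ⟨c', hc'⟩ := hz'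
        exact ⟨c + c', by rw [mul_add, add_mul, hc, hc', add_smul]⟩
      | tmul a b =>
        obtain ⟨c, hc⟩ := hp.2.2 a
        obtain ⟨c', hc'⟩ := hq.2.2 b
        exact ⟨c * c', by
          rw [Algebra.TensorProduct.tmul_mul_tmul, Algebra.TensorProduct.tmul_mul_tmul, hc, hc',
            TensorProduct.smul_tmul_smul]⟩
  have h1 : ∀ q, IsMinimalIdempotent q → ∀ x : A, τ (x ⊗ₜ q) = matrixTrace A x := by
    intro q hq x
    have h := isMatrixTrace_matrixTrace (A := A)|>.eq_smul
      (φ := τ ∘ₗ (TensorProduct.mk ℂ A B).flip q) (c := 1) (fun x y => by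
        have := hτ (x ⊗ₜ q) (y ⊗ₜ q)
        rwa [Algebra.TensorProduct.tmul_mul_tmul, Algebra.TensorProduct.tmul_mul_tmul, hq.2.1]
          at this) fun p hp' => hp _ (hpq p q hp' hq)
    rw [one_smul] at h
    exact congrArg (fun f => f x) h
  have h := isMatrixTrace_matrixTrace (A := B)|>.eq_smul
    (φ := τ ∘ₗ TensorProduct.mk ℂ A B x) (c := matrixTrace A x) (fun y y' => by
      have := hτ (x ⊗ₜ y) (1 ⊗ₜ y')
      rwa [Algebra.TensorProduct.tmul_mul_tmul, Algebra.TensorProduct.tmul_mul_tmul, mul_one,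
        one_mul] at this) fun q hq => h1 q hq x
  exact congrArg (fun f => f y) h

theorem trace_eq_matrixTrace (H : Type*) [NormedAddCommGroup H] [InnerProductSpace ℂ H]
    [FiniteDimensional ℂ H] [CompleteSpace H] : Quant.trace H = matrixTrace (H →L[ℂ] H) := by
  refine IsMatrixTrace.eq_matrixTrace ?_
  let b := Module.finBasis ℂ H
  refine ⟨1, fun _ => Module.finrank ℂ H, ((Module.End.toContinuousLinearMap (𝕜 := ℂ) H).symm.trans
    (algEquivMatrix b)).trans (AlgEquiv.funUnique ℂ (Fin 1) _).symm, fun x => ?_⟩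
  rw [Fin.sum_univ_one]
  exact LinearMap.trace_eq_matrix_trace ℂ b _

end TraceUniqueness

namespace CStar

instance : MonoidalDiscarding CStar where
  discard_tensor A B := by
    let T := tensorObj A B
    refine hom_ext (TensorProduct.ext' fun x y => ?_)
    exact matrixTrace_tmul (A := A.carrier) (B := B.carrier) (matrixTrace T.carrier)
      (matrixTrace_mul_comm (A := T.carrier))
      (fun p => isMatrixTrace_matrixTrace (A := T.carrier)|>.apply_of_isMinimalIdempotent) x y

theorem causal_isoOfStarAlgEquiv {A B : CStar} (e : A.carrier ≃⋆ₐ[ℂ] B.carrier) :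
    Causal (isoOfStarAlgEquiv e).hom :=
  hom_ext (LinearMap.ext fun x => matrixTrace_algEquiv
    (AlgEquiv.ofRingEquiv (f := e.toRingEquiv) fun c => by
      rw [Algebra.algebraMap_eq_smul_one, Algebra.algebraMap_eq_smul_one]
      exact (map_smul e c 1).trans (congrArg (c • ·) (map_one e))) x)

end CStar

/-! ### Positivity criteria and transposes -/

section Criterion

variable {R : Type*} [CStarAlgebra R] [PartialOrder R] [StarOrderedRing R]

/-- Positivity of `N` can be tested on a faithful positive functional: if `T (y* N y) ≥ 0` for all
`y`, then `N ≥ 0`. -/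
theorem nonneg_of_functional_nonneg {T : R →ₗ[ℂ] ℂ} (hT : ∀ y, 0 ≤ T (star y * y))
    (hf : ∀ y, T (star y * y) = 0 → y = 0) {N : R} (hN : ∀ y, 0 ≤ T (star y * N * y)) : 0 ≤ N := by
  have hK : ∀ y, T (star y * (N - star N) * y) = 0 := fun y => by
    have h1 := map_star_of_positive hT (star y * N * y)
    rw [starRingEnd_apply, (IsSelfAdjoint.of_nonneg (hN y)).star_eq] at h1
    rw [mul_sub, sub_mul, map_sub, ← h1, star_mul, star_mul, star_star, mul_assoc, sub_self]
  -- by polarization the form `T (y* (N - N*) z)` vanishes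
  have hsa : IsSelfAdjoint N := by
    set K := N - star N with hKdef
    have h1 : T (star K * K * 1) + T (star 1 * K * K) = 0 := by
      have := hK (K + 1)
      rw [star_add, add_mul, add_mul, mul_add, mul_add, map_add, map_add, map_add, hK, hK] at this
      simpa using this
    have h2 : T (star K * K * 1) - T (star 1 * K * K) = 0 := by
      have := hK (K + Complex.I • 1)
      rw [star_add, add_mul, add_mul, mul_add, mul_add, map_add, map_add, map_add, hK, hK,
        star_smul, smul_mul_assoc, smul_mul_assoc, mul_smul_comm, map_smul, map_smul] at this
      simp only [RCLike.star_def, Complex.conj_I, smul_eq_mul, zero_add, neg_mul,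
        add_zero] at this
      have h3 : Complex.I * (T (star K * K * 1) - T (star 1 * K * K)) = 0 := by
        rw [mul_sub, sub_eq_add_neg]
        simpa using this
      exact (mul_eq_zero.1 h3).resolve_left Complex.I_ne_zero
    have h3 : T (star K * K) = 0 := by
      rw [mul_one] at h1 h2
      have h4 : (2 : ℂ) * T (star K * K) = 0 := by linear_combination h1 + h2
      exact (mul_eq_zero.1 h4).resolve_left two_ne_zero
    exact (sub_eq_zero.1 (hf K h3)).symm
  -- the negative part `m = s* s` of `N` satisfies `m N m = -(s m)* (s m)`, so `T` vanishes there
  -- and `s m = 0`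
  have hneg := CFC.negPart_nonneg N
  obtain ⟨s, hs⟩ := exists_eq_star_mul_self hneg
  set m := N⁻ with hm
  have hmsa : star m = m := (IsSelfAdjoint.of_nonneg hneg).star_eq
  have h1 : star m * N * m = -(star (s * m) * (s * m)) := by
    conv_lhs => rw [← CFC.posPart_sub_negPart N hsa, ← hm]
    rw [mul_sub, hmsa, sub_mul, hm, CFC.negPart_mul_posPart, zero_mul, zero_sub, ← hm, star_mul,
      hmsa, ← mul_assoc, mul_assoc m (star s) s, ← hs]
  have h2 := hN m
  rw [h1, map_neg] at h2
  have h3 := hf _ (le_antisymm (neg_nonneg.1 h2) (hT _))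
  have h4 : star m * m = 0 := by
    rw [hmsa]
    nth_rw 1 [hs]
    rw [mul_assoc, h3, mul_zero]
  have h5 : m = 0 := (CStarRing.star_mul_self_eq_zero_iff m).1 h4
  rw [← CFC.posPart_sub_negPart N hsa, ← hm, h5, sub_zero]
  exact CFC.posPart_nonneg N

/-- The matrix form of `nonneg_of_functional_nonneg`. -/
theorem cstarMatrix_nonneg_of_functional_nonneg {n : Type*} [Fintype n] {σ : R →ₗ[ℂ] ℂ}
    (hσ : ∀ y, 0 ≤ σ (star y * y)) (hf : ∀ y, σ (star y * y) = 0 → y = 0) (M : CStarMatrix n n R)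
    (hM : ∀ Y : n → R, 0 ≤ ∑ i, ∑ j, σ (star (Y i) * M i j * Y j)) : 0 ≤ M := by
  classical
  let T : CStarMatrix n n R →ₗ[ℂ] ℂ :=
    { toFun N := ∑ i, σ (N i i)
      map_add' N N' := by simp [Finset.sum_add_distrib]
      map_smul' c N := by simp [Finset.mul_sum] }
  have hT : ∀ Y : CStarMatrix n n R, T (star Y * Y) = ∑ i, ∑ r, σ (star (Y r i) * Y r i) := by
    intro Y
    simp [T, CStarMatrix.mul_apply, CStarMatrix.star_apply]
  refine nonneg_of_functional_nonneg (T := T) (fun Y => ?_) (fun Y h => ?_) fun Y => ?_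
  · rw [hT]
    exact Finset.sum_nonneg fun i _ => Finset.sum_nonneg fun r _ => hσ _
  · rw [hT] at h
    refine CStarMatrix.ext fun r i => hf _ ?_
    have h1 := (Finset.sum_eq_zero_iff_of_nonneg fun i _ =>
      Finset.sum_nonneg fun r _ => hσ (Y r i)).1 h i (Finset.mem_univ i)
    exact (Finset.sum_eq_zero_iff_of_nonneg fun r _ => hσ (Y r i)).1 h1 r (Finset.mem_univ r)
  · have : T (star Y * M * Y) = ∑ l, ∑ i, ∑ j, σ (star (Y i l) * M i j * Y j l) := by
      simp only [T, LinearMap.coe_mk, AddHom.coe_mk, CStarMatrix.mul_apply, CStarMatrix.star_apply,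
        Finset.sum_mul, map_sum]
      exact Finset.sum_congr rfl fun l _ => Finset.sum_comm
    rw [this]
    exact Finset.sum_nonneg fun l _ => hM fun i => Y i l

variable {S : Type*} [CStarAlgebra S] [PartialOrder S] [StarOrderedRing S]

/-- Complete positivity need only be checked on Gram matrices of rank one. -/
theorem map_cstarMatrix_nonneg_of_rankOne (f : R →ₗ[ℂ] S)
    (h : ∀ (k : ℕ) (x : Fin k → R),
      0 ≤ (CStarMatrix.ofMatrix (Matrix.of fun i j => f (star (x i) * x j)) :
        CStarMatrix (Fin k) (Fin k) S))
    (k : ℕ) (M : CStarMatrix (Fin k) (Fin k) R) (hM : 0 ≤ M) : 0 ≤ M.map f := by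
  obtain ⟨v, hv⟩ := exists_gram hM
  choose w hw using fun r => exists_gram (h k (v r))
  refine gram_nonneg (m := Fin k × Fin k) _ (fun p i => w p.1 p.2 i) fun i j => ?_
  rw [CStarMatrix.map_apply, hv, map_sum, Fintype.sum_prod_type]
  exact Finset.sum_congr rfl fun r _ => hw r i j

/-- A completely positive map sends Gram matrices to Gram matrices. -/
theorem exists_gram_map (f : R →CP S) {k : ℕ} (x : Fin k → R) :
    ∃ w : Fin k → Fin k → S, ∀ i j, f.toLinearMap (star (x i) * x j) =
      ∑ r, star (w r i) * w r j :=
  exists_gram (f.map_cstarMatrix_nonneg' k _ (rankOne_nonneg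
    (CStarMatrix.ofMatrix (Matrix.of fun i j => star (x i) * x j)) x fun _ _ => rfl))

theorem cp_map_star (f : R →CP S) (x : R) : f.toLinearMap (star x) = star (f.toLinearMap x) := by
  obtain ⟨w, hw⟩ := exists_gram_map f ![1, x]
  have h1 := hw 0 1
  have h2 := hw 1 0
  simp only [Matrix.cons_val_zero, Matrix.cons_val_one, star_one, one_mul, mul_one] at h1 h2
  rw [h1, h2, star_sum]
  exact Finset.sum_congr rfl fun r _ => by rw [star_mul, star_star]

end Criterion

namespace CStar

theorem matrixTrace_ext {A : CStar} {x y : A.carrier}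
    (h : ∀ a, matrixTrace A.carrier (a * x) = matrixTrace A.carrier (a * y)) : x = y := by
  refine sub_eq_zero.1 (eq_zero_of_matrixTrace_eq_zero ?_)
  rw [mul_sub, map_sub, h, sub_self]

/-- The transpose of a linear map, for the bilinear forms `tr (a b)`. -/
theorem exists_linearTranspose {A B : CStar} (f : A.carrier →ₗ[ℂ] B.carrier) :
    ∃ g : B.carrier →ₗ[ℂ] A.carrier, ∀ a b,
      matrixTrace A.carrier (a * g b) = matrixTrace B.carrier (f a * b) := by
  let β : A.carrier →ₗ[ℂ] Module.Dual ℂ A.carrier :=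
    ((LinearMap.mul ℂ A.carrier).compr₂ (matrixTrace A.carrier)).flip
  have hβ : Function.Injective β := (injective_iff_map_eq_zero β).2 fun x hx =>
    matrixTrace_ext fun a => by
      rw [mul_zero, map_zero]
      exact congrArg (fun f => f a) hx
  let e := LinearEquiv.ofBijective β
    ⟨hβ, (LinearMap.injective_iff_surjective_of_finrank_eq_finrank
      Subspace.dual_finrank_eq.symm).1 hβ⟩
  refine ⟨e.symm.toLinearMap ∘ₗ (((LinearMap.mul ℂ B.carrier).compr₂
    (matrixTrace B.carrier)).comp f).flip, fun a b => ?_⟩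
  exact congrArg (fun φ : Module.Dual ℂ A.carrier => φ a) (e.apply_symm_apply _)

/-- The transpose of a completely positive map for the bilinear forms `tr (a b)`. -/
theorem exists_transpose {A B : CStar} (f : A ⟶ B) :
    ∃ g : B ⟶ A, ∀ a b,
      matrixTrace A.carrier (a * g.toLinearMap b) =
        matrixTrace B.carrier (f.toLinearMap a * b) := by
  obtain ⟨g, hg⟩ := exists_linearTranspose f.toLinearMap
  refine ⟨{ g with map_cstarMatrix_nonneg' := map_cstarMatrix_nonneg_of_rankOne g fun k b => ?_ },
    hg⟩
  refine cstarMatrix_nonneg_of_functional_nonneg isMatrixTrace_matrixTrace.nonneg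
    (fun y => eq_zero_of_matrixTrace_eq_zero) _ fun Y => ?_
  obtain ⟨w, hw⟩ := exists_gram_map f fun i => star (Y i)
  have h : ∀ i j, matrixTrace A.carrier (star (Y i) * g (star (b i) * b j) * Y j) =
      ∑ r, matrixTrace B.carrier (w r i * star (b i) * (b j * star (w r j))) := fun i j => by
    rw [matrixTrace_mul_comm, ← mul_assoc, hg]
    have := hw j i
    rw [star_star] at this
    rw [this, Finset.sum_mul, map_sum]
    refine Finset.sum_congr rfl fun r _ => ?_
    rw [mul_assoc, matrixTrace_mul_comm]
    simp only [mul_assoc]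
  have h2 : ∑ i, ∑ j, matrixTrace A.carrier (star (Y i) * g (star (b i) * b j) * Y j) =
      ∑ r, matrixTrace B.carrier (star (∑ i, b i * star (w r i)) * ∑ j, b j * star (w r j)) := by
    simp only [h, star_sum, Finset.sum_mul_sum, map_sum, star_mul, star_star]
    refine Eq.trans ?_ Finset.sum_comm
    exact Finset.sum_congr rfl fun i _ => Finset.sum_comm
  exact h2 ▸ Finset.sum_nonneg fun r _ => isMatrixTrace_matrixTrace.nonneg _

/-- The transpose of a completely positive map for the bilinear forms `tr (a b)`. -/
noncomputable def transpose {A B : CStar} (f : A ⟶ B) : B ⟶ A :=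
  Classical.choose (exists_transpose f)

theorem matrixTrace_mul_transpose {A B : CStar} (f : A ⟶ B) (a : A.carrier) (b : B.carrier) :
    matrixTrace A.carrier (a * (transpose f).toLinearMap b) =
      matrixTrace B.carrier (f.toLinearMap a * b) :=
  Classical.choose_spec (exists_transpose f) a b

theorem eq_transpose {A B : CStar} {f : A ⟶ B} {g : B ⟶ A}
    (h : ∀ a b, matrixTrace A.carrier (a * g.toLinearMap b) =
      matrixTrace B.carrier (f.toLinearMap a * b)) : g = transpose f :=
  hom_ext <| LinearMap.ext fun b => matrixTrace_ext fun a =>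
    (h a b).trans (matrixTrace_mul_transpose f a b).symm

theorem transpose_transpose {A B : CStar} (f : A ⟶ B) : transpose (transpose f) = f :=
  (eq_transpose fun b a => by
    rw [matrixTrace_mul_comm, ← matrixTrace_mul_transpose, matrixTrace_mul_comm]).symm

theorem transpose_id (A : CStar) : transpose (𝟙 A) = 𝟙 A :=
  (eq_transpose fun _ _ => rfl).symm

theorem transpose_comp {A B D : CStar} (f : A ⟶ B) (g : B ⟶ D) :
    transpose (f ≫ g) = transpose g ≫ transpose f :=
  (eq_transpose (f := f ≫ g) (g := transpose g ≫ transpose f) fun a d =>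
    (matrixTrace_mul_transpose f a ((transpose g).toLinearMap d)).trans
      (matrixTrace_mul_transpose g (f.toLinearMap a) d)).symm

/-- The transpose of a unital map preserves the trace. -/
theorem causal_transpose {A B : CStar} {f : A ⟶ B} (h : f.toLinearMap 1 = 1) :
    Causal (transpose f) :=
  hom_ext <| LinearMap.ext fun b => by
    have := matrixTrace_mul_transpose f 1 b
    rw [h, one_mul, one_mul] at this
    exact this

/-- The transpose of a trace-preserving map is unital. -/
theorem transpose_one {A B : CStar} {f : A ⟶ B} (h : Causal f) :
    (transpose f).toLinearMap 1 = 1 :=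
  matrixTrace_ext fun a => by
    rw [matrixTrace_mul_transpose, mul_one, mul_one]
    exact congrArg (fun f : A ⟶ 𝟙_ CStar => f.toLinearMap a) h

end CStar

/-! ### The range of a completely positive unital idempotent -/

/-- A completely positive unital idempotent of a C*-algebra. -/
structure UnitalIdempotent (A : Type*) [CStarAlgebra A] [PartialOrder A] [StarOrderedRing A] where
  map : A →CP A
  map_one : map.toLinearMap 1 = 1
  map_map : ∀ x, map.toLinearMap (map.toLinearMap x) = map.toLinearMap x

namespace UnitalIdempotent

variable {A : Type*} [CStarAlgebra A] [PartialOrder A] [StarOrderedRing A] (φ : UnitalIdempotent A)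

/-- The linear map underlying a unital idempotent. -/
abbrev lin : A →ₗ[ℂ] A := φ.map.toLinearMap

theorem lin_one : φ.lin 1 = 1 := φ.map_one

theorem lin_lin (x : A) : φ.lin (φ.lin x) = φ.lin x := φ.map_map x

theorem lin_star (x : A) : φ.lin (star x) = star (φ.lin x) := cp_map_star φ.map x

/-- The Kadison-Schwarz inequality in matrix form: the matrix of the
`φ (xᵢ* xⱼ) - φ (xᵢ)* φ (xⱼ)` is positive. -/
theorem exists_schwarz_gram {k : ℕ} (x : Fin k → A) :
    ∃ w : Fin (k + 1) → Fin k → A, ∀ i j,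
      φ.lin (star (x i) * x j) - star (φ.lin (x i)) * φ.lin (x j) =
        ∑ r, star (w r i) * w r j := by
  obtain ⟨v, hv⟩ := exists_gram_map φ.map (Fin.cons 1 x : Fin (k + 1) → A)
  refine ⟨fun r i => v r i.succ - v r 0 * φ.lin (x i), fun i j => ?_⟩
  have h00 := hv 0 0
  have h0 := fun i => hv 0 (Fin.succ i)
  have h0' := fun i => hv (Fin.succ i) 0
  have h := hv i.succ j.succ
  simp only [Fin.cons_zero, Fin.cons_succ, star_one, one_mul, mul_one] at h00 h0 h0' h
  simp only [star_sub, star_mul, sub_mul, mul_sub, Finset.sum_sub_distrib]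
  have e1 : ∑ r, star (v r i.succ) * (v r 0 * φ.lin (x j)) = φ.lin (star (x i)) * φ.lin (x j) := by
    rw [h0', Finset.sum_mul]
    exact Finset.sum_congr rfl fun r _ => (mul_assoc _ _ _).symm
  have e2 : ∑ r, star (φ.lin (x i)) * star (v r 0) * v r j.succ =
      star (φ.lin (x i)) * φ.lin (x j) := by
    rw [show φ.lin (x j) = _ from h0 j, Finset.mul_sum]
    exact Finset.sum_congr rfl fun r _ => mul_assoc _ _ _
  have e3 : ∑ r, star (φ.lin (x i)) * star (v r 0) * (v r 0 * φ.lin (x j)) =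
      star (φ.lin (x i)) * φ.lin (x j) := by
    have h1 : φ.map.toLinearMap 1 = 1 := φ.map_one
    rw [h1] at h00
    calc _ = star (φ.lin (x i)) * (∑ r, star (v r 0) * v r 0) * φ.lin (x j) := by
          rw [Finset.mul_sum, Finset.sum_mul]
          exact Finset.sum_congr rfl fun r _ => by simp only [mul_assoc]
      _ = _ := by rw [← h00, mul_one]
  rw [e1, e2, e3, ← h, φ.lin_star]
  abel

/-- `φ` is a bimodule map over its range, up to `φ`. The matrix of `exists_schwarz_gram` for `a*`
and `x` is sent by `φ` to a positive matrix with first diagonal entry `0`, so the entry beside it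
vanishes. -/
theorem lin_mul_lin {a : A} (ha : φ.lin a = a) (x : A) : φ.lin (a * φ.lin x) = φ.lin (a * x) := by
  obtain ⟨w, hw⟩ := φ.exists_schwarz_gram ![star a, x]
  have h11 := hw 0 0
  have h12 := hw 0 1
  simp only [Matrix.cons_val_zero, Matrix.cons_val_one, star_star, φ.lin_star, ha] at h11 h12
  choose u hu using fun r => exists_gram_map φ.map (w r)
  have key : ∑ r, ∑ s, star (u r s 0) * u r s 0 = 0 := by
    have h1 := congrArg φ.lin h11
    rw [map_sub, φ.lin_lin, sub_self, map_sum] at h1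
    rw [h1]
    exact Finset.sum_congr rfl fun r _ => (hu r 0 0).symm
  have hu0 : ∀ r s, u r s 0 = 0 := fun r s => by
    have h1 := (Finset.sum_eq_zero_iff_of_nonneg fun r _ =>
      Finset.sum_nonneg fun s _ => star_mul_self_nonneg (u r s 0)).1 key r (Finset.mem_univ r)
    have h2 := (Finset.sum_eq_zero_iff_of_nonneg fun s _ =>
      star_mul_self_nonneg (u r s 0)).1 h1 s (Finset.mem_univ s)
    exact (CStarRing.star_mul_self_eq_zero_iff _).1 h2
  have h2 := congrArg φ.lin h12
  rw [map_sub, φ.lin_lin, map_sum] at h2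
  refine (sub_eq_zero.1 (h2.trans (Finset.sum_eq_zero fun r _ => (hu r 0 1).trans ?_))).symm
  exact Finset.sum_eq_zero fun s _ => by rw [hu0, star_zero, zero_mul]

theorem lin_lin_mul {a : A} (ha : φ.lin a = a) (x : A) : φ.lin (φ.lin x * a) = φ.lin (x * a) := by
  have h : φ.lin (star a) = star a := by rw [φ.lin_star, ha]
  have h1 := congrArg star (φ.lin_mul_lin h (star x))
  simpa only [← φ.lin_star, star_mul, star_star] using h1

/-- The range of `φ`, with the Choi-Effros product `a ∘ b = φ (a b)`. -/
def Range : Type _ := LinearMap.range φ.lin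

namespace Range

variable {φ}

/-- The underlying element of the ambient algebra. -/
noncomputable def val (a : φ.Range) : A := Subtype.val (p := (· ∈ LinearMap.range φ.lin)) a

theorem lin_val (a : φ.Range) : φ.lin a.val = a.val := by
  obtain ⟨_, x, rfl⟩ := a
  exact φ.lin_lin x

variable (φ) in
/-- The element of the range determined by an element of the ambient algebra. -/
noncomputable def mk (x : A) : φ.Range := ⟨φ.lin x, x, rfl⟩

theorem ext {a b : φ.Range} (h : a.val = b.val) : a = b := Subtype.ext h

theorem val_mk (x : A) : (mk φ x).val = φ.lin x := rfl

noncomputable instance : NormedAddCommGroup φ.Range :=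
  inferInstanceAs (NormedAddCommGroup (LinearMap.range φ.lin))

noncomputable instance : NormedSpace ℂ φ.Range :=
  inferInstanceAs (NormedSpace ℂ (LinearMap.range φ.lin))

instance [FiniteDimensional ℂ A] : FiniteDimensional ℂ φ.Range :=
  inferInstanceAs (FiniteDimensional ℂ (LinearMap.range φ.lin))

theorem val_add (a b : φ.Range) : (a + b).val = a.val + b.val := rfl

theorem val_smul (c : ℂ) (a : φ.Range) : (c • a).val = c • a.val := rfl

theorem norm_val (a : φ.Range) : ‖a.val‖ = ‖a‖ := rfl

noncomputable instance : Mul φ.Range := ⟨fun a b => mk φ (a.val * b.val)⟩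

noncomputable instance : One φ.Range := ⟨mk φ 1⟩

noncomputable instance : Star φ.Range := ⟨fun a => mk φ (star a.val)⟩

theorem val_mul (a b : φ.Range) : (a * b).val = φ.lin (a.val * b.val) := rfl

theorem val_one : (1 : φ.Range).val = 1 := φ.lin_one

theorem val_star (a : φ.Range) : (star a).val = star a.val :=
  (φ.lin_star _).trans (congrArg star a.lin_val)

noncomputable instance : Ring φ.Range :=
  { (inferInstance : AddCommGroup φ.Range) with
    mul_assoc a b c := ext <| by
      rw [val_mul, val_mul, val_mul, val_mul, φ.lin_lin_mul c.lin_val, φ.lin_mul_lin a.lin_val,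
        mul_assoc]
    one_mul a := ext <| by rw [val_mul, val_one, one_mul, lin_val]
    mul_one a := ext <| by rw [val_mul, val_one, mul_one, lin_val]
    left_distrib a b c := ext <| by
      rw [val_mul, val_add, mul_add, map_add]
      rfl
    right_distrib a b c := ext <| by
      rw [val_mul, val_add, add_mul, map_add]
      rfl
    zero_mul a := ext <| (congrArg φ.lin (zero_mul a.val)).trans (map_zero _)
    mul_zero a := ext <| (congrArg φ.lin (mul_zero a.val)).trans (map_zero _) }

theorem norm_lin_le (x : A) : ‖φ.lin x‖ ≤ ‖x‖ := by
  have hpos : ∀ y : A, 0 ≤ φ.lin (star y * y) := fun y => by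
    obtain ⟨w, hw⟩ := exists_gram_map φ.map ![y]
    exact (hw 0 0).symm ▸ Finset.sum_nonneg fun r _ => star_mul_self_nonneg _
  have h1 : star (φ.lin x) * φ.lin x ≤ φ.lin (star x * x) := by
    obtain ⟨w, hw⟩ := φ.exists_schwarz_gram ![x]
    exact sub_nonneg.1 ((hw 0 0).symm ▸ Finset.sum_nonneg fun r _ => star_mul_self_nonneg _)
  have h2 : φ.lin (star x * x) ≤ algebraMap ℝ A (‖x‖ ^ 2) := by
    obtain ⟨y, hy⟩ := exists_eq_star_mul_self
      (sub_nonneg.2 (CStarAlgebra.star_mul_le_algebraMap_norm_sq (a := x)))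
    have h3 := hpos y
    rw [← hy, map_sub] at h3
    have h4 : φ.lin (algebraMap ℝ A (‖x‖ ^ 2)) = algebraMap ℝ A (‖x‖ ^ 2) := by
      rw [Algebra.algebraMap_eq_smul_one, ← Complex.coe_smul, map_smul, φ.lin_one]
    rwa [h4, sub_nonneg] at h3
  have h3 := (CStarAlgebra.norm_le_iff_le_algebraMap _ (sq_nonneg ‖x‖)
    (star_mul_self_nonneg (φ.lin x))).2 (h1.trans h2)
  rw [CStarRing.norm_star_mul_self, ← sq] at h3
  exact le_of_sq_le_sq h3 (norm_nonneg _)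

noncomputable instance : NormedRing φ.Range :=
  { (inferInstance : NormedAddCommGroup φ.Range), (inferInstance : Ring φ.Range) with
    norm_mul_le a b := (norm_lin_le _).trans (norm_mul_le a.val b.val) }

noncomputable instance : StarRing φ.Range where
  star_involutive a := ext <| by rw [val_star, val_star, star_star]
  star_mul a b := ext <| by
    rw [val_star, val_mul, ← φ.lin_star, star_mul, val_mul, val_star, val_star]
  star_add a b := ext <| by rw [val_star, val_add, star_add, val_add, val_star, val_star]

noncomputable instance : Algebra ℂ φ.Range :=
  Algebra.ofModule
    (fun c a b => ext <| by rw [val_mul, val_smul, smul_mul_assoc, map_smul, val_smul, val_mul])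
    (fun c a b => ext <| by rw [val_mul, val_smul, mul_smul_comm, map_smul, val_smul, val_mul])

/-- The Choi-Effros C*-algebra. The C*-identity follows from `0 ≤ a* a ≤ φ (a* a)`. -/
noncomputable instance [FiniteDimensional ℂ A] : CStarAlgebra φ.Range where
  toCompleteSpace := FiniteDimensional.complete ℂ φ.Range
  norm_mul_self_le a := by
    have h1 : star a.val * a.val ≤ φ.lin (star a.val * a.val) := by
      obtain ⟨w, hw⟩ := φ.exists_schwarz_gram ![a.val]
      have h2 := hw 0 0
      simp only [Matrix.cons_val_zero, lin_val] at h2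
      exact sub_nonneg.1 (h2 ▸ Finset.sum_nonneg fun r _ => star_mul_self_nonneg _)
    have h2 := CStarAlgebra.norm_le_norm_of_nonneg_of_le (star_mul_self_nonneg a.val) h1
    rw [CStarRing.norm_star_mul_self] at h2
    refine h2.trans (le_of_eq ?_)
    rw [← norm_val, val_mul, val_star]
  norm_smul_le c a := norm_smul_le c a
  star_smul c a := ext <| by
    rw [val_star, val_smul, star_smul, val_smul, val_star]

end Range

end UnitalIdempotent

namespace CStar

/-- The Choi-Effros algebra of a unital idempotent, as an object of `CStar`. -/
noncomputable def range {A : CStar} (φ : UnitalIdempotent A.carrier) : CStar where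
  carrier := φ.Range
  partialOrder := CStarAlgebra.spectralOrder _
  starOrderedRing := CStarAlgebra.spectralOrderedRing _

section

variable {A : CStar} (φ : UnitalIdempotent A.carrier)

/-- The inclusion of the Choi-Effros algebra. -/
noncomputable def rangeIncl : range φ ⟶ A :=
  let m : φ.Range →ₗ[ℂ] A.carrier :=
    { toFun := UnitalIdempotent.Range.val
      map_add' := UnitalIdempotent.Range.val_add
      map_smul' := UnitalIdempotent.Range.val_smul }
  { m with
    map_cstarMatrix_nonneg' := map_cstarMatrix_nonneg_of_rankOne (R := (range φ).carrier) m
      fun k b => by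
        let c : Fin k → φ.Range := b
        have hc : ∀ i j, (star (c i) * c j).val = φ.lin (star (c i).val * (c j).val) :=
            fun i j => by
          rw [UnitalIdempotent.Range.val_mul, UnitalIdempotent.Range.val_star]
        obtain ⟨w, hw⟩ := exists_gram_map φ.map fun i => (c i).val
        exact gram_nonneg _ w fun i j => (hc i j).trans (hw i j) }

theorem matrixTrace_lin_nonneg (y : A.carrier) :
    0 ≤ matrixTrace A.carrier (φ.lin (star y * y)) := by
  obtain ⟨w, hw⟩ := exists_gram_map φ.map ![y]
  have h2 := hw 0 0
  simp only [Matrix.cons_val_zero] at h2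
  rw [h2, map_sum]
  exact Finset.sum_nonneg fun r _ => isMatrixTrace_matrixTrace.nonneg _

theorem val_eq_zero_of_matrixTrace_eq_zero {b : φ.Range}
    (hb : matrixTrace A.carrier (φ.lin (star b.val * b.val)) = 0) : b.val = 0 := by
  obtain ⟨w, hw⟩ := φ.exists_schwarz_gram ![b.val]
  have h2 := hw 0 0
  simp only [Matrix.cons_val_zero, UnitalIdempotent.Range.lin_val] at h2
  have h3 := congrArg (matrixTrace A.carrier) h2
  rw [map_sub, hb, zero_sub, map_sum] at h3
  exact eq_zero_of_matrixTrace_eq_zero (le_antisymm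
    (neg_nonneg.1 (h3.symm ▸ Finset.sum_nonneg fun r _ => isMatrixTrace_matrixTrace.nonneg _))
    (isMatrixTrace_matrixTrace.nonneg _))

/-- A unital idempotent, as a map to its Choi-Effros algebra. Its complete positivity is tested
against the restriction of the trace of `A`, which is a faithful positive functional. -/
noncomputable def rangeProj : A ⟶ range φ :=
  let e : A.carrier →ₗ[ℂ] (range φ).carrier := φ.lin.rangeRestrict
  let m : (range φ).carrier →ₗ[ℂ] A.carrier := (rangeIncl φ).toLinearMap
  { e with
    map_cstarMatrix_nonneg' := map_cstarMatrix_nonneg_of_rankOne e fun k x => by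
      let σ : (range φ).carrier →ₗ[ℂ] ℂ := matrixTrace A.carrier ∘ₗ m
      have hσ : ∀ b : φ.Range, σ (star b * b) =
          matrixTrace A.carrier (φ.lin (star b.val * b.val)) := fun b => by
        change matrixTrace A.carrier (star b * b).val = _
        rw [UnitalIdempotent.Range.val_mul, UnitalIdempotent.Range.val_star]
      refine cstarMatrix_nonneg_of_functional_nonneg (σ := σ)
        (fun b => le_of_le_of_eq (matrixTrace_lin_nonneg φ _) (hσ b).symm)
        (fun b hb => UnitalIdempotent.Range.ext
          (val_eq_zero_of_matrixTrace_eq_zero φ ((hσ b).symm.trans hb))) _ fun Y => ?_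
      let y : Fin k → A.carrier := fun i => (show φ.Range from Y i).val
      have h2 : ∀ i j, σ (star (Y i) * e (star (x i) * x j) * Y j) =
          matrixTrace A.carrier (φ.lin (star (x i * y i) * (x j * y j))) := fun i j => by
        have h3 : ∀ (u v : φ.Range) (z : A.carrier),
            (star u * UnitalIdempotent.Range.mk φ z * v).val =
            φ.lin (star u.val * z * v.val) := fun u v z => by
          have h4 : φ.lin (star u.val) = star u.val := by
            rw [φ.lin_star, UnitalIdempotent.Range.lin_val]
          rw [UnitalIdempotent.Range.val_mul, UnitalIdempotent.Range.val_mul,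
            UnitalIdempotent.Range.val_star, UnitalIdempotent.Range.val_mk, φ.lin_mul_lin h4,
            φ.lin_lin_mul v.lin_val]
        refine (congrArg (matrixTrace A.carrier) (h3 (Y i) (Y j) (star (x i) * x j))).trans ?_
        rw [star_mul]
        simp only [mul_assoc, y]
      have h5 : ∑ i, ∑ j, σ (star (Y i) * e (star (x i) * x j) * Y j) =
          matrixTrace A.carrier (φ.lin (star (∑ i, x i * y i) * ∑ j, x j * y j)) := by
        simp only [h2, star_sum, Finset.sum_mul_sum, map_sum]
      exact le_of_le_of_eq (matrixTrace_lin_nonneg φ _) h5.symm }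

end

/-- Choi-Effros: a completely positive unital idempotent of a finite-dimensional C*-algebra splits
through a C*-algebra, by completely positive unital maps. -/
theorem exists_splitting_of_unital {A : CStar} (p : A ⟶ A) (hp : p ≫ p = p)
    (h1 : p.toLinearMap 1 = 1) :
    ∃ (B : CStar) (e : A ⟶ B) (m : B ⟶ A), e.toLinearMap 1 = 1 ∧ m.toLinearMap 1 = 1 ∧
      m ≫ e = 𝟙 B ∧ e ≫ m = p := by
  let φ : UnitalIdempotent A.carrier :=
    ⟨p, h1, fun x => congrArg (fun f : A ⟶ A => f.toLinearMap x) hp⟩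
  exact ⟨range φ, rangeProj φ, rangeIncl φ, rfl, φ.lin_one,
    hom_ext (LinearMap.ext fun b => UnitalIdempotent.Range.ext
      (UnitalIdempotent.Range.lin_val (show φ.Range from b))),
    hom_ext (LinearMap.ext fun x => rfl)⟩

/-- A causal idempotent splits through a causal map, in `CStar`. -/
theorem exists_splitting {A : CStar} {p : A ⟶ A} (hp : p ≫ p = p) (hc : Causal p) :
    ∃ (B : CStar) (e : A ⟶ B) (m : B ⟶ A), Causal m ∧ m ≫ e = 𝟙 B ∧ e ≫ m = p := by
  obtain ⟨B, e, m, he, -, hme, hem⟩ := exists_splitting_of_unital (transpose p)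
    (by rw [← transpose_comp, hp]) (transpose_one hc)
  refine ⟨B, transpose m, transpose e, causal_transpose he, ?_, ?_⟩
  · rw [← transpose_comp, hme, transpose_id]
  · rw [← transpose_comp, hem, transpose_transpose]

end CStar

/-! ### The structure of finite-dimensional C*-algebras -/

namespace CStar

/-- A linear map which preserves the products `x* y` is completely positive; it need not be
unital. -/
noncomputable def ofStarMul {A B : CStar} (f : A.carrier →ₗ[ℂ] B.carrier)
    (hf : ∀ x y, f (star x * y) = star (f x) * f y) : A ⟶ B :=
  { f with
    map_cstarMatrix_nonneg' := map_cstarMatrix_nonneg_of_rankOne f fun _ x =>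
      rankOne_nonneg _ (fun i => f (x i)) fun i j => hf (x i) (x j) }

theorem sum_toLinearMap {ι : Type*} (s : Finset ι) {A B : CStar} (f : ι → (A ⟶ B)) :
    (∑ i ∈ s, f i).toLinearMap = ∑ i ∈ s, (f i).toLinearMap :=
  map_sum (⟨⟨fun f => f.toLinearMap, zero_toLinearMap A B⟩, add_toLinearMap⟩ :
    (A ⟶ B) →+ (A.carrier →ₗ[ℂ] B.carrier)) f s

section Pi

variable {ι : Type} [Fintype ι] (B : ι → CStar)

/-- The product of a finite family of C*-algebras. -/
noncomputable def pi : CStar where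
  carrier := ∀ i, (B i).carrier

variable [DecidableEq ι]

/-- The inclusion of a factor in a product. -/
noncomputable def piInj (i : ι) : B i ⟶ pi B :=
  ofStarMul (B := pi B) (LinearMap.single ℂ (fun i => (B i).carrier) i) fun x y => by
    refine (Pi.single_mul (α := fun i => (B i).carrier) i (star x) y).trans ?_
    exact congrArg (· * _) (Pi.single_star (f := fun i => (B i).carrier) i x)

/-- The projection of a product on a factor. -/
noncomputable def piProj (i : ι) : pi B ⟶ B i :=
  ofStarMul (A := pi B) (LinearMap.proj (φ := fun i => (B i).carrier) i) fun _ _ => rfl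

theorem piInj_piProj (i : ι) : piInj B i ≫ piProj B i = 𝟙 (B i) :=
  hom_ext (LinearMap.ext fun x => Pi.single_eq_same (M := fun i => (B i).carrier) i x)

theorem piInj_piProj_of_ne {i j : ι} (h : i ≠ j) : piInj B i ≫ piProj B j = 0 :=
  hom_ext (LinearMap.ext fun x => Pi.single_eq_of_ne (M := fun i => (B i).carrier) h.symm x)

theorem sum_piProj_piInj : ∑ i, piProj B i ≫ piInj B i = 𝟙 (pi B) :=
  hom_ext <| (sum_toLinearMap _ _).trans <| LinearMap.ext fun x => by
    rw [LinearMap.sum_apply]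
    exact Finset.univ_sum_single (M := fun i => (B i).carrier) x

theorem causal_piInj (i : ι) : Causal (piInj B i) :=
  hom_ext <| LinearMap.ext fun x => by
    refine (matrixTrace_pi (fun i => (B i).carrier) (Pi.single i x)).trans ?_
    rw [Finset.sum_eq_single i]
    · rw [Pi.single_eq_same]
      rfl
    · intro j _ hj
      rw [Pi.single_eq_of_ne hj, map_zero]
    · simp

end Pi

section Ideal

variable {A : Type*} [CStarAlgebra A] [FiniteDimensional ℂ A]

/-- Left multiplication on the regular Hilbert space. -/
noncomputable def regularLeftMul (a : A) : RegularHilbert A →ₗ[ℂ] RegularHilbert A :=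
  (LinearMap.mulLeft ℂ a : A →ₗ[ℂ] A)

/-- The representation of a C*-algebra on a left ideal, with the inner product `tr (x* y)`. -/
noncomputable def idealRep (L : Submodule ℂ (RegularHilbert A)) [CompleteSpace L]
    (hL : ∀ a x, x ∈ L → regularLeftMul a x ∈ L) : A →⋆ₐ[ℂ] (L →L[ℂ] L) where
  toFun a := LinearMap.toContinuousLinearMap ((regularLeftMul a).restrict (hL a))
  map_one' := by
    ext1 y
    exact Subtype.ext (one_mul (show A from y.1))
  map_mul' a b := by
    ext1 y
    exact Subtype.ext (mul_assoc a b (show A from y.1))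
  map_zero' := by
    ext1 y
    exact Subtype.ext (zero_mul (show A from y.1))
  map_add' a b := by
    ext1 y
    exact Subtype.ext (add_mul a b (show A from y.1))
  commutes' r := by
    ext1 y
    exact Subtype.ext (Algebra.smul_def r (show A from y.1)).symm
  map_star' a := by
    rw [ContinuousLinearMap.star_eq_adjoint, ContinuousLinearMap.eq_adjoint_iff]
    intro y z
    refine (regularHilbert_inner_mul (star a) y.1 z.1).trans ?_
    rw [star_star]
    rfl

end Ideal

/-- A finite-dimensional C*-algebra is *-isomorphic to a product of algebras of operators. The
Hilbert spaces are minimal left ideals, one for each block, with the inner product `tr (x* y)`. -/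
theorem exists_starAlgEquiv_pi (A : CStar) :
    ∃ (n : ℕ) (H : Fin n → Quant),
      Nonempty (A.carrier ≃⋆ₐ[ℂ] (pi fun i => Quant.operators (H i)).carrier) := by
  classical
  have := isSemisimpleRing_of_finiteDimensional A.carrier
  obtain ⟨n, d, hd, ⟨e⟩⟩ := IsSemisimpleRing.exists_algEquiv_pi_matrix_of_isAlgClosed ℂ A.carrier
  -- `ψ i v` is the element of the block `i` whose first column is `v`
  let δ : ∀ i, Fin (d i) → ℂ := fun i => Pi.single (0 : Fin (d i)) 1
  let ψ : ∀ i, (Fin (d i) → ℂ) →ₗ[ℂ] RegularHilbert A.carrier := fun i =>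
    { toFun v := e.symm (Pi.single i (Matrix.vecMulVec v (δ i)))
      map_add' v w := by rw [Matrix.add_vecMulVec, Pi.single_add, map_add]; rfl
      map_smul' c v := by rw [Matrix.smul_vecMulVec, Pi.single_smul, map_smul]; rfl }
  have hψ : ∀ i a v, regularLeftMul a (ψ i v) = ψ i ((e a i).mulVec v) := fun i a v => by
    refine e.injective ?_
    change e (a * e.symm (Pi.single i (Matrix.vecMulVec v (δ i)))) =
      e (e.symm (Pi.single i (Matrix.vecMulVec ((e a i).mulVec v) (δ i))))
    rw [map_mul, AlgEquiv.apply_symm_apply, AlgEquiv.apply_symm_apply]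
    funext j
    by_cases hj : j = i
    · subst hj
      rw [Pi.mul_apply, Pi.single_eq_same, Pi.single_eq_same, Matrix.mul_vecMulVec]
    · rw [Pi.mul_apply, Pi.single_eq_of_ne hj, Pi.single_eq_of_ne hj, mul_zero]
  have hψ0 : ∀ i, Function.Injective (ψ i) := fun i v w h => by
    have h1 : Matrix.vecMulVec v (δ i) = Matrix.vecMulVec w (δ i) :=
      Pi.single_injective i (e.symm.injective h)
    funext k
    simpa [δ, Matrix.vecMulVec_apply] using congrFun (congrFun h1 k) 0
  let H : Fin n → Quant := fun i => { carrier := LinearMap.range (ψ i) }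
  let π : ∀ i, A.carrier →⋆ₐ[ℂ] ((H i).carrier →L[ℂ] (H i).carrier) := fun i =>
    idealRep (LinearMap.range (ψ i)) (by rintro a _ ⟨v, rfl⟩; exact ⟨_, (hψ i a v).symm⟩)
  let Φ : A.carrier →⋆ₐ[ℂ] ∀ i, ((H i).carrier →L[ℂ] (H i).carrier) :=
    { toFun a i := π i a
      map_one' := funext fun i => map_one (π i)
      map_mul' a b := funext fun i => map_mul (π i) a b
      map_zero' := funext fun i => map_zero (π i)
      map_add' a b := funext fun i => map_add (π i) a b
      commutes' r := funext fun i => (π i).commutes' r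
      map_star' a := funext fun i => map_star (π i) a }
  have hinj : Function.Injective Φ := (injective_iff_map_eq_zero Φ).2 fun a ha => by
    refine e.injective ?_
    rw [map_zero]
    funext i
    refine Matrix.toLin'.injective (LinearMap.ext fun v => ?_)
    have h1 : regularLeftMul a (ψ i v) = 0 :=
      congrArg Subtype.val (congrArg (fun f => f ⟨ψ i v, v, rfl⟩) (congrFun ha i))
    rw [hψ] at h1
    have h2 := hψ0 i (h1.trans (map_zero (ψ i)).symm)
    simpa using h2
  have hdim : Module.finrank ℂ A.carrier =
      Module.finrank ℂ (∀ i, ((H i).carrier →L[ℂ] (H i).carrier)) := by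
    have hfree : ∀ i, Module.Free ℂ ((H i).carrier →L[ℂ] (H i).carrier) := fun i =>
      Module.Free.of_divisionRing ℂ _
    have hfin : ∀ i, Module.Finite ℂ ((H i).carrier →L[ℂ] (H i).carrier) := fun i =>
      (Quant.operators (H i)).finiteDimensional
    rw [e.toLinearEquiv.finrank_eq, Module.finrank_pi_fintype, Module.finrank_pi_fintype]
    refine Finset.sum_congr rfl fun i _ => ?_
    have h1 : Module.finrank ℂ (H i).carrier = d i :=
      (LinearMap.finrank_range_of_inj (hψ0 i)).trans (Module.finrank_fin_fun ℂ)
    have h2 := (LinearMap.toContinuousLinearMap (𝕜 := ℂ) (E := (H i).carrier)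
      (F' := (H i).carrier)).finrank_eq
    rw [← h2, Module.finrank_linearMap, Module.finrank_matrix]
    simp [h1]
  have hsurj : Function.Surjective Φ :=
    (LinearMap.injective_iff_surjective_of_finrank_eq_finrank (f := Φ.toAlgHom.toLinearMap)
      hdim).1 hinj
  exact ⟨n, H, ⟨StarAlgEquiv.ofBijective Φ ⟨hinj, hsurj⟩⟩⟩

end CStar

namespace Quant

/-- Every family of Hilbert spaces has a causal sum in `CStar`: the product of the algebras of
operators. -/
theorem exists_causalSum_toCStar (M : BiprodCompletion Quant) :
    ∃ Z, Nonempty (CausalSum toCStar M Z) := by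
  classical
  let B : M.ι → CStar := fun i => operators (M.X i)
  exact ⟨CStar.pi B, ⟨⟨CStar.piInj B, CStar.piProj B, CStar.piInj_piProj B,
    fun i j => CStar.piInj_piProj_of_ne B, CStar.sum_piProj_piInj B, CStar.causal_piInj B⟩⟩⟩

/-- Every finite-dimensional C*-algebra is a causal sum of algebras of operators. -/
theorem exists_causalSum_of_cstar (A : CStar) :
    ∃ (n : ℕ) (H : Fin n → Quant), Nonempty (CausalSum toCStar ⟨Fin n, H⟩ A) := by
  obtain ⟨n, H, ⟨e⟩⟩ := CStar.exists_starAlgEquiv_pi A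
  let B : Fin n → CStar := fun i => operators (H i)
  let c : CausalSum toCStar ⟨Fin n, H⟩ (CStar.pi B) :=
    ⟨CStar.piInj B, CStar.piProj B, CStar.piInj_piProj B,
      fun i j => CStar.piInj_piProj_of_ne B, CStar.sum_piProj_piInj B, CStar.causal_piInj B⟩
  exact ⟨n, H, ⟨c.ofIso (CStar.isoOfStarAlgEquiv e).symm
    (Causal.iso_inv (CStar.causal_isoOfStarAlgEquiv e))⟩⟩

end Quant

/-! ### Splitting the causal idempotents of `Quant` -/

namespace Quant

theorem traceHom_eq_discard (H : Quant) : traceHom H = discard (operators H) :=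
  CStar.hom_ext (trace_eq_matrixTrace H.carrier)

theorem causal_operators_iff {H K : Quant} (f : operators H ⟶ operators K) :
    f ≫ traceHom K ≫ εIso.hom = traceHom H ≫ εIso.hom ↔ Causal f := by
  rw [← Category.assoc, cancel_mono, traceHom_eq_discard, traceHom_eq_discard]
  rfl

/-- Causality in `Quant` is causality in `CStar`. -/
theorem causal_iff {H K : Quant} (f : H ⟶ K) : Causal f ↔ Causal (toCStar.map f) :=
  causal_operators_iff f

instance : toCStar.Full where
  map_surjective f := ⟨f, rfl⟩

theorem discard_operators_unit : discard (operators unit) = εIso.inv := by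
  rw [← cancel_epi εIso.hom, Iso.hom_inv_id]
  exact (CStar.causal_isoOfStarAlgEquiv _).trans discard_unit

theorem isCausalFunctor_toCStar : IsCausalFunctor toCStar where
  isIso_discard := by
    have h : IsIso (discard (operators unit)) := by
      rw [discard_operators_unit]
      infer_instance
    exact h
  map_discard H := by
    have h : discard (operators H) = (traceHom H ≫ εIso.hom) ≫ discard (operators unit) := by
      rw [discard_operators_unit, Category.assoc, Iso.hom_inv_id, Category.comp_id,
        traceHom_eq_discard]
    exact h

theorem exists_monoidal_toCStar :
    ∃ _ : toCStar.Monoidal, Causal (Functor.LaxMonoidal.ε toCStar) ∧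
      ∀ H K, Causal (Functor.LaxMonoidal.μ toCStar H K) := by
  let _ : toCStar.Monoidal := Monoidal.fromInducedMonoidal toCStar
    { μIso := μIso
      whiskerLeft_eq := fun _ _ _ _ => rfl
      whiskerRight_eq := fun _ _ => rfl
      tensorHom_eq := fun _ _ => rfl
      εIso := εIso
      associator_eq := fun _ _ _ => rfl
      leftUnitor_eq := fun _ => rfl
      rightUnitor_eq := fun _ => rfl }
  exact ⟨inferInstance, CStar.causal_isoOfStarAlgEquiv _,
    fun H K => CStar.causal_isoOfStarAlgEquiv _⟩

/-- A causal idempotent splits through a C*-algebra, and that algebra is a causal sum of algebras of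
operators. -/
theorem finiteDecompositionProperty : FiniteDecompositionProperty Quant := by
  intro H p hp hc
  obtain ⟨B, e, m, hm, hme, hem⟩ :=
    CStar.exists_splitting (A := operators H) (p := toCStar.map p) hp ((causal_iff p).1 hc)
  obtain ⟨n, K, ⟨c⟩⟩ := exists_causalSum_of_cstar B
  let a : ∀ i, B ⟶ operators (K i) := c.proj
  let b : ∀ i, operators (K i) ⟶ B := c.inj
  have h1 : ∀ i, (b i ≫ m) ≫ e ≫ a i = 𝟙 (operators (K i)) := fun i => by
    rw [Category.assoc, reassoc_of% hme]
    exact c.inj_proj i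
  have h0 : ∀ i j, i ≠ j → ((e ≫ a i) ≫ b i ≫ m) ≫ (e ≫ a j) ≫ b j ≫ m = 0 :=
    fun i j hij => by
      have h : b i ≫ a j = 0 := c.inj_proj_of_ne i j hij
      simp only [Category.assoc]
      rw [reassoc_of% hme, ← Category.assoc (b i), h,
        SemiAdditive.zero_comp, SemiAdditive.comp_zero, SemiAdditive.comp_zero]
  have hs : ∑ i, (e ≫ a i) ≫ b i ≫ m = toCStar.map p := by
    have h : ∀ i, (e ≫ a i) ≫ b i ≫ m = e ≫ (a i ≫ b i) ≫ m := fun i => by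
      simp only [Category.assoc]
    have h' : ∑ i, a i ≫ b i = 𝟙 B := c.sum_proj_inj
    simp only [h]
    rw [← comp_sum, ← sum_comp, h', Category.id_comp, hem]
  exact ⟨n, K, fun i => (e ≫ a i : operators H ⟶ operators (K i)),
    fun i => (b i ≫ m : operators (K i) ⟶ operators H), h1,
    fun i => (causal_operators_iff (b i ≫ m)).2 ((c.causal_inj i).comp hm), h0, hs.symm⟩

end Quant

section OrthogonalSum

variable {ι : Type} [Fintype ι] {R : CStar} {A : ι → CStar}

namespace CStar

/-- Pairwise orthogonal corner inclusions `k i` of algebras `A i` in an algebra `R`, whose units add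
up to the unit of `R`. -/
structure Corners (R : CStar) (A : ι → CStar) where
  k : ∀ i, A i ⟶ R
  star_mul : ∀ i x y, (k i).toLinearMap (star x * y) =
    star ((k i).toLinearMap x) * (k i).toLinearMap y
  mul_of_ne : ∀ i j, i ≠ j → ∀ x y, (k i).toLinearMap x * (k j).toLinearMap y = 0
  causal : ∀ i, Causal (k i)
  sum_one : ∑ i, (k i).toLinearMap 1 = 1

namespace Corners

variable (c : Corners R A)

theorem mul (i : ι) (x y : (A i).carrier) :
    (c.k i).toLinearMap x * (c.k i).toLinearMap y = (c.k i).toLinearMap (x * y) := by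
  have h := c.star_mul i (star x) y
  rw [star_star] at h
  rw [h, cp_map_star, star_star]

theorem matrixTrace_k (i : ι) (x : (A i).carrier) :
    matrixTrace R.carrier ((c.k i).toLinearMap x) = matrixTrace (A i).carrier x :=
  congrArg (fun f : A i ⟶ 𝟙_ CStar => f.toLinearMap x) (c.causal i)

theorem k_transpose (i : ι) : c.k i ≫ transpose (c.k i) = 𝟙 (A i) :=
  hom_ext <| LinearMap.ext fun x => matrixTrace_ext fun a => by
    refine (matrixTrace_mul_transpose (c.k i) a ((c.k i).toLinearMap x)).trans ?_
    rw [c.mul, c.matrixTrace_k]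
    rfl

theorem k_transpose_of_ne {i j : ι} (h : i ≠ j) : c.k i ≫ transpose (c.k j) = 0 :=
  hom_ext <| LinearMap.ext fun x => matrixTrace_ext fun a => by
    refine (matrixTrace_mul_transpose (c.k j) a ((c.k i).toLinearMap x)).trans ?_
    rw [c.mul_of_ne j i h.symm, map_zero]
    exact ((congrArg _ (mul_zero a)).trans (map_zero _)).symm

/-- The conditional expectation on the sum of the corners. -/
noncomputable def expectation : R ⟶ R := ∑ i, transpose (c.k i) ≫ c.k i

theorem expectation_apply (y : R.carrier) : c.expectation.toLinearMap y =
    ∑ i, (c.k i).toLinearMap ((transpose (c.k i)).toLinearMap y) := by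
  rw [expectation, sum_toLinearMap, LinearMap.sum_apply]
  rfl

theorem expectation_idem : c.expectation ≫ c.expectation = c.expectation := by
  classical
  rw [expectation, sum_comp]
  refine Finset.sum_congr rfl fun i _ => ?_
  rw [comp_sum, Finset.sum_eq_single i]
  · rw [Category.assoc, reassoc_of% c.k_transpose i]
  · intro j _ hj
    rw [Category.assoc, ← Category.assoc (c.k i), c.k_transpose_of_ne hj.symm,
      SemiAdditive.zero_comp, SemiAdditive.comp_zero]
  · simp

theorem causal_expectation : Causal c.expectation :=
  hom_ext <| LinearMap.ext fun y => by
    change matrixTrace R.carrier (c.expectation.toLinearMap y) = matrixTrace R.carrier y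
    have h : ∀ i, matrixTrace R.carrier
        ((c.k i).toLinearMap ((transpose (c.k i)).toLinearMap y)) =
        matrixTrace R.carrier ((c.k i).toLinearMap 1 * y) := fun i => by
      rw [c.matrixTrace_k, ← matrixTrace_mul_transpose, one_mul]
    rw [expectation_apply, map_sum]
    simp only [h]
    rw [← map_sum, ← Finset.sum_mul, c.sum_one, one_mul]

theorem matrixTrace_expectation (x y : R.carrier) :
    matrixTrace R.carrier (star x * c.expectation.toLinearMap y) =
      matrixTrace R.carrier (star (c.expectation.toLinearMap x) * y) := by
  rw [expectation_apply, expectation_apply, Finset.mul_sum, star_sum, Finset.sum_mul, map_sum,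
    map_sum]
  refine Finset.sum_congr rfl fun i _ => ?_
  rw [matrixTrace_mul_comm, ← matrixTrace_mul_transpose, matrixTrace_mul_comm, cp_map_star,
    ← cp_map_star (c.k i), ← matrixTrace_mul_transpose (c.k i) _ y]

end Corners

end CStar

end OrthogonalSum

namespace Quant

open scoped InnerProduct in
/-- The inclusions of the summands in the orthogonal sum of a family of Hilbert spaces. -/
theorem exists_orthogonal_sum {ι : Type} [Fintype ι] (H : ι → Quant) :
    ∃ (S : Quant) (κ : ∀ i, (H i).carrier →L[ℂ] S.carrier),
      (∀ i, (κ i)† ∘L κ i = 1) ∧ (∀ i j, i ≠ j → (κ i)† ∘L κ j = 0) ∧ ∑ i, κ i ∘L (κ i)† = 1 := by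
  classical
  let S : Quant := { carrier := PiLp 2 fun i => (H i).carrier }
  let κ : ∀ i, (H i).carrier →L[ℂ] S.carrier := fun i => LinearMap.toContinuousLinearMap
    { toFun v := WithLp.toLp 2 (Pi.single i v)
      map_add' v w := by rw [Pi.single_add]; rfl
      map_smul' c v := by rw [Pi.single_smul]; rfl }
  let π : ∀ i, S.carrier →L[ℂ] (H i).carrier := fun i =>
    PiLp.proj (𝕜 := ℂ) 2 (fun i => (H i).carrier) i
  have hπ : ∀ i, (κ i)† = π i := fun i => by
    refine ((ContinuousLinearMap.eq_adjoint_iff _ _).2 fun x v => ?_).symm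
    refine Eq.symm ((PiLp.inner_apply (𝕜 := ℂ) (f := fun i => (H i).carrier) x _).trans ?_)
    rw [Finset.sum_eq_single i]
    · simp only [κ, LinearMap.coe_toContinuousLinearMap', LinearMap.coe_mk, AddHom.coe_mk,
        Pi.single_eq_same]
      rfl
    · intro j _ hj
      simp [κ, hj]
    · simp
  refine ⟨S, κ, fun i => ?_, fun i j h => ?_, ?_⟩
  · rw [hπ]
    ext1 v
    exact Pi.single_eq_same (M := fun i => (H i).carrier) i v
  · rw [hπ]
    ext1 v
    exact Pi.single_eq_of_ne (M := fun i => (H i).carrier) h v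
  · simp only [hπ]
    ext1 x
    rw [_root_.sum_apply]
    refine (WithLp.toLp_sum (p := 2) (V := ∀ i, (H i).carrier) Finset.univ
      fun i => Pi.single i (x i)).symm.trans ?_
    exact congrArg (WithLp.toLp 2) (Finset.univ_sum_single fun i => x i)

open scoped InnerProduct in
/-- The algebras of operators on the summands are corners of the algebra of operators on the
orthogonal sum, by `X ↦ κ X κ†`. -/
theorem exists_corners {ι : Type} [Fintype ι] (H : ι → Quant) :
    ∃ S : Quant, Nonempty (CStar.Corners (operators S) fun i => operators (H i)) := by
  obtain ⟨S, κ, h1, h0, hs⟩ := exists_orthogonal_sum H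
  have h1' : ∀ i v, ((κ i)†) (κ i v) = v := fun i v => congrArg (fun f => f v) (h1 i)
  have h0' : ∀ i j, i ≠ j → ∀ v, ((κ i)†) (κ j v) = 0 := fun i j h v =>
    congrArg (fun f => f v) (h0 i j h)
  let k : ∀ i, ((H i).carrier →L[ℂ] (H i).carrier) →ₗ[ℂ] (S.carrier →L[ℂ] S.carrier) := fun i =>
    { toFun X := κ i ∘L X ∘L (κ i)†
      map_add' X Y := by simp
      map_smul' c X := by simp }
  have hk : ∀ i X Y, k i (star X * Y) = star (k i X) * k i Y := fun i X Y => by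
    ext1 v
    simp [k, ContinuousLinearMap.star_eq_adjoint, ContinuousLinearMap.adjoint_comp, h1']
  have hk0 : ∀ i j, i ≠ j → ∀ X Y, k i X * k j Y = 0 := fun i j h X Y => by
    ext1 v
    simp [k, h0' i j h]
  have hkt : ∀ i X, trace S.carrier (k i X) = trace (H i).carrier X := fun i X => by
    refine (LinearMap.trace_comp_comm' (X ∘L (κ i)†).toLinearMap (κ i).toLinearMap).trans ?_
    refine congrArg (LinearMap.trace ℂ _) ?_
    ext v
    exact congrArg X (h1' i v)
  refine ⟨S, ⟨{
    k i := CStar.ofStarMul (A := operators (H i)) (B := operators S) (k i) (hk i)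
    star_mul := hk
    mul_of_ne := hk0
    causal i := CStar.hom_ext (LinearMap.ext fun X => ?_)
    sum_one := ?_ }⟩⟩
  · have h := hkt i X
    rw [trace_eq_matrixTrace, trace_eq_matrixTrace] at h
    exact h
  · refine Eq.trans (Finset.sum_congr rfl fun i _ => ?_) hs
    exact congrArg (κ i ∘L ·) (ContinuousLinearMap.id_comp _)

/-- Every family of Hilbert spaces has a causal sum among the objects `(H, p)` with `p`
self-adjoint: the block-diagonal operators on the orthogonal sum. -/
theorem exists_causalSum_toSplitCausal (M : BiprodCompletion Quant) :
    ∃ Z : SplitDaggerCausal, Nonempty (CausalSum (toSplitCausal Quant) M Z.obj) := by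
  obtain ⟨S, ⟨c⟩⟩ := exists_corners M.X
  let p : S ⟶ S := c.expectation
  have hsa : IsSelfAdjointMap p := fun X Y => by
    rw [trace_eq_matrixTrace]
    exact c.matrixTrace_expectation X Y
  let Z : SplitCausal Quant :=
    ⟨⟨S, p, c.expectation_idem⟩, (causal_operators_iff c.expectation).2 c.causal_expectation⟩
  exact ⟨⟨Z, hsa⟩, ⟨causalSumOfSplitting (Z := Z) c.k (fun i => CStar.transpose (c.k i))
    c.k_transpose (fun i j => c.k_transpose_of_ne) rfl
    fun i => (causal_operators_iff (c.k i)).2 (c.causal i)⟩⟩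

/-- The equivalences for `Quant`. The second functor is an inverse of the first, followed by the
equivalence of the biproduct completion with the splitting. -/
theorem quant_equivalences :
    ∃ (E₁ : BiprodCompletion Quant ⥤ CStar) (E₂ : CStar ⥤ SplitDaggerCausal),
      CausallyIsomorphic (BiprodCompletion.incl Quant ⋙ E₁) toCStar ∧
      CausallyIsomorphic
        (BiprodCompletion.incl Quant ⋙ E₁ ⋙ E₂ ⋙ daggerIdempotents.ι)
        (toSplitCausal Quant) ∧
      IsCausalMonoidalEquivalence E₁ ∧ IsCausalMonoidalEquivalence E₂ ∧
      IsCausalMonoidalEquivalence daggerIdempotents.ι := by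
  obtain ⟨_, hε, hμ⟩ := exists_monoidal_toCStar
  obtain ⟨E₁, hE₁, hi₁⟩ := exists_extension toCStar isCausalFunctor_toCStar hε hμ
    (fun _ _ => rfl) (fun _ _ => rfl) exists_causalSum_toCStar
    fun A => let ⟨_, _, h⟩ := exists_causalSum_of_cstar A; ⟨_, h⟩
  have hQ : ∀ H, daggerIdempotents ((toSplitCausal Quant).obj H) := fun H X Y => rfl
  have hfd := finiteDecompositionProperty
  obtain ⟨J, hJ, hJi⟩ := exists_biprodCompletion_equivalence hQ exists_causalSum_toSplitCausal hfd
  obtain ⟨G, hG, -, hGi⟩ := hE₁.exists_inverse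
  have hι := isCausalMonoidalEquivalence_ι exists_causalSum_toSplitCausal hfd
  refine ⟨E₁, G ⋙ J, hi₁, ?_, hE₁, hG.comp hJ, hι⟩
  have h1 : CausallyIsomorphic (BiprodCompletion.incl Quant ⋙ (E₁ ⋙ G) ⋙ J ⋙ daggerIdempotents.ι)
      (BiprodCompletion.incl Quant ⋙ 𝟭 _ ⋙ J ⋙ daggerIdempotents.ι) :=
    (hGi.whiskerRight (hJ.comp hι).causal).whiskerLeft _
  have h2 : CausallyIsomorphic (BiprodCompletion.incl Quant ⋙ J ⋙ daggerIdempotents.ι)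
      (toSplitCausal Quant) := hJi.whiskerRight hι.causal
  exact h1.trans h2

end Quant

end TwoRoads

theorem mainTheorem8 :
    (∀ {C : Type*} [Category* C] [MonoidalCategory C] [SymmetricCategory C]
      [DaggerCategory C] [DaggerCompact C] [SemiAdditive C] [SemiAdditiveMonoidal C]
      [DaggerSemiAdditive C] [HasDaggerBiproducts C],
      PositiveDimensional C → FiniteDecompositionProperty (CPM C) →
      (∃ F₁ : BiprodCompletion (CPM C) ⥤ CPStar C,
        CausallyIsomorphic
          (BiprodCompletion.incl (CPM C) ⋙ F₁ ⋙ CPStar.toSplitDagger C ⋙ (daggerIdempotents C).ι)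
          (toSplitCausal (CPM C)) ∧
        IsCausalMonoidalEquivalence F₁) ∧
      IsCausalMonoidalEquivalence (CPStar.toSplitDagger C) ∧
      IsCausalMonoidalEquivalence (daggerIdempotents C).ι) ∧
    (∃ (E₁ : BiprodCompletion Quant ⥤ CStar) (E₂ : CStar ⥤ Quant.SplitDaggerCausal),
      CausallyIsomorphic (BiprodCompletion.incl Quant ⋙ E₁) Quant.toCStar ∧
      CausallyIsomorphic
        (BiprodCompletion.incl Quant ⋙ E₁ ⋙ E₂ ⋙ Quant.daggerIdempotents.ι)
        (toSplitCausal Quant) ∧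
      IsCausalMonoidalEquivalence E₁ ∧ IsCausalMonoidalEquivalence E₂ ∧
      IsCausalMonoidalEquivalence Quant.daggerIdempotents.ι) :=
  ⟨fun hpos hfd => cpm_equivalences hpos hfd, Quant.quant_equivalences⟩
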